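/- Let $W: y^2+A_1xy+A_3y=x^3+A_2x^2+A_4x+A_6$ be a minimal Weierstrass equation over $\mathbb Z$ of an elliptic curve over $\mathbb Q$, let $\mathcal W\subset\mathbb P^2_{\mathbb Z}$ be the closed subscheme it defines, and let $\omega_W=\frac{dx}{2y+A_1x+A_3}$ be the Néron differential. Let $P\in W(\mathbb Q)$, and denote by $\mathcal P$ and $-\mathcal P$ the Zariski closures in $\mathcal W$ of the points $P$ and $-P$ of the generic fibre. Then there exists a rational section $\alpha(P)$ of the sheaf $\Omega^1_{\mathcal W/\mathbb Z}$ of relative differentials such that (i) the induced differential on $\mathcal W_{\mathbb Q}$ has at most first order poles, and its residue divisor is $\frac12\big((P)-(-P)\big)$; (ii) the differential $4\alpha(P)$ is regular on $\mathcal W$ up to first order poles on $\mathcal P$ and $-\mathcal P$. Here, as usual for divisors on a normal scheme, this is meant in codimension one: $4\alpha(P)$ has at most a first order pole at the generic points of $\mathcal P$ and $-\mathcal P$, and at every other point $x\in\mathcal W$ of codimension one (including the generic points of the fibres of $\mathcal W$ over the primes) it belongs to the image of the stalk $\Omega^1_{\mathcal W/\mathbb Z,x}=\Omega^1_{\mathcal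 O_{\mathcal W,x}/\mathbb Z}$ in $\Omega^1_{\mathbb Q(\mathcal W)/\mathbb Z}$, where $\mathbb Q(\mathcal W)$ is the function field of $\mathcal W$. The differential $\alpha(P)$ is unique up to addition of an integral multiple of $\frac14\omega_W$: if $\alpha$ satisfies (i) and (ii), then a rational section $\alpha'$ satisfies (i) and (ii) if and only if $\alpha'=\alpha+\frac n4\,\omega_W$ for some $n\in\mathbb Z$. -/

import Mathlib

open AlgebraicGeometry

namespace WeierstrassModel

section Differentials

open scoped KaehlerDifferential

/-- A rational section of `Ω¹_{X/ℤ}` on an integral scheme `X`: an element of the stalk of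
`Ω¹_{X/ℤ}` at the generic point, which is the module of differentials of the function field. -/
abbrev RationalDifferential (X : Scheme.{0}) [IsIntegral X] : Type :=
  Ω[X.functionField⁄ℤ]

variable (X : Scheme.{0}) [IsIntegral X]

/-- `α` is regular at `x`: it comes from the stalk of `Ω¹_{X/ℤ}` at `x`, which is the module of
differentials of the local ring `𝒪_{X,x}` over `ℤ`. -/
def IsRegularAt (α : RationalDifferential X) (x : X) : Prop :=
  α ∈ LinearMap.range (KaehlerDifferential.map ℤ ℤ (X.presheaf.stalk x) X.functionField)

/-- `α` has at most a first order pole at `x` (used where `𝒪_{X,x}` is a discrete valuation ring):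
`f • α` is regular at `x` for every `f` in the maximal ideal of `𝒪_{X,x}`. -/
def HasAtMostSimplePoleAt (α : RationalDifferential X) (x : X) : Prop :=
  ∀ f ∈ IsLocalRing.maximalIdeal (X.presheaf.stalk x),
    IsRegularAt X (algebraMap (X.presheaf.stalk x) X.functionField f • α) x

/-- `α` has at most a first order pole with residue `c` at `x`: it has the form `g dt / t + β`, where
`t` is a uniformizer of `𝒪_{X,x}`, `g ∈ 𝒪_{X,x}` has the value `c` at `x`, and `β` is regular at `x`.
(So the residue is zero if and only if `α` is regular at `x`.) -/
def HasResidueAt (α : RationalDifferential X) (x : X)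
    (c : IsLocalRing.ResidueField (X.presheaf.stalk x)) : Prop :=
  ∃ t g : X.presheaf.stalk x,
    IsLocalRing.maximalIdeal (X.presheaf.stalk x) = Ideal.span {t} ∧
    IsLocalRing.residue (X.presheaf.stalk x) g = c ∧
    ∃ β : RationalDifferential X, IsRegularAt X β x ∧
      α = (algebraMap (X.presheaf.stalk x) X.functionField g /
            algebraMap (X.presheaf.stalk x) X.functionField t) •
          KaehlerDifferential.D ℤ X.functionField
            (algebraMap (X.presheaf.stalk x) X.functionField t) + β

/-- For `X` of dimension two, flat over `ℤ`: the differential induced by `α` on the generic fibre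
`X_ℚ` has only first order poles, and its residue divisor is `D`. The closed points of the curve
`X_ℚ` are the points `x` of codimension one of `X` whose residue field has characteristic zero, and
`X` and `X_ℚ` have the same local ring at such a point. -/
def HasResidueDivisor (α : RationalDifferential X) (D : X →₀ ℚ) : Prop :=
  ∀ x : X, Order.coheight x = 1 →
    CharZero (IsLocalRing.ResidueField (X.presheaf.stalk x)) →
    HasResidueAt X α x ((D x : ℚ) : IsLocalRing.ResidueField (X.presheaf.stalk x))

/-- `α` is regular on `X` up to first order poles along the prime divisors whose generic points are
in `S`. As usual for divisors of rational sections on a normal scheme, this is a condition at the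
points of codimension one, the generic points of the prime divisors, vertical ones included. -/
def IsRegularUpToSimplePoles (α : RationalDifferential X) (S : Set X) : Prop :=
  ∀ x : X, Order.coheight x = 1 →
    (x ∈ S → HasAtMostSimplePoleAt X α x) ∧ (x ∉ S → IsRegularAt X α x)

end Differentials

variable (W : WeierstrassCurve ℤ)

/-- The homogeneous coordinate ring `ℤ[X, Y, Z] / (F)`, where
`F = Y²Z + a₁XYZ + a₃YZ² - (X³ + a₂X²Z + a₄XZ² + a₆Z³)`. -/
abbrev CoordRing : Type :=
  MvPolynomial (Fin 3) ℤ ⧸ Ideal.span {W.toProjective.polynomial}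

/-- The quotient map `ℤ[X, Y, Z] → ℤ[X, Y, Z] / (F)`. -/
noncomputable abbrev toCoordRing : MvPolynomial (Fin 3) ℤ →ₐ[ℤ] CoordRing W :=
  Ideal.Quotient.mkₐ ℤ (Ideal.span {W.toProjective.polynomial})

/-- The grading of `ℤ[X, Y, Z] / (F)` by degree: the piece of degree `d` consists of the classes of
the homogeneous polynomials of degree `d`. -/
noncomputable def grading (d : ℕ) : Submodule ℤ (CoordRing W) :=
  (MvPolynomial.homogeneousSubmodule (Fin 3) ℤ d).map (toCoordRing W).toLinearMap

theorem mem_grading {G : MvPolynomial (Fin 3) ℤ} {d : ℕ} (hG : G.IsHomogeneous d) :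
    toCoordRing W G ∈ grading W d :=
  ⟨G, hG, rfl⟩

theorem isHomogeneous_polynomial : (W.toProjective.polynomial).IsHomogeneous 3 := by
  have hX (i : Fin 3) := MvPolynomial.isHomogeneous_X ℤ i
  have hC (r : ℤ) := MvPolynomial.isHomogeneous_C (Fin 3) r
  unfold WeierstrassCurve.Projective.polynomial
  refine .sub (.add (.add ?_ ?_) ?_) (.add (.add (.add ?_ ?_) ?_) ?_)
  · exact ((hX 1).pow 2).mul (hX 2)
  · exact (((hC _).mul (hX 0)).mul (hX 1)).mul (hX 2)
  · exact ((hC _).mul (hX 1)).mul ((hX 2).pow 2)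
  · exact (hX 0).pow 3
  · exact ((hC _).mul ((hX 0).pow 2)).mul (hX 2)
  · exact ((hC _).mul (hX 0)).mul ((hX 2).pow 2)
  · exact (hC _).mul ((hX 2).pow 3)

instance gradedMonoid : SetLike.GradedMonoid (grading W) where
  one_mem := ⟨1, MvPolynomial.isHomogeneous_one _ _, map_one (toCoordRing W)⟩
  mul_mem := by
    rintro i j _ _ ⟨a, ha, rfl⟩ ⟨b, hb, rfl⟩
    exact ⟨a * b, MvPolynomial.IsHomogeneous.mul ha hb, map_mul (toCoordRing W) a b⟩

/-- The decomposition of the class of a polynomial into homogeneous components. -/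
noncomputable def decomposePoly :
    MvPolynomial (Fin 3) ℤ →ₐ[ℤ] DirectSum ℕ fun d ↦ grading W d :=
  MvPolynomial.aeval fun i ↦ DirectSum.of (fun d ↦ grading W d) 1
    ⟨toCoordRing W (MvPolynomial.X i), mem_grading W (MvPolynomial.isHomogeneous_X ℤ i)⟩

theorem coe_decomposePoly (G : MvPolynomial (Fin 3) ℤ) :
    DirectSum.coeAlgHom (grading W) (decomposePoly W G) = toCoordRing W G := by
  have : (DirectSum.coeAlgHom (grading W)).comp (decomposePoly W) = toCoordRing W := by
    ext i
    simp [decomposePoly]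
  exact DFunLike.congr_fun this G

instance gradedMonoid_range : SetLike.GradedMonoid fun d ↦
    LinearMap.range (DirectSum.lof ℤ ℕ (fun d ↦ grading W d) d) where
  one_mem := ⟨1, rfl⟩
  mul_mem := by
    rintro i j _ _ ⟨a, rfl⟩ ⟨b, rfl⟩
    exact ⟨GradedMonoid.GMul.mul (A := fun d ↦ grading W d) a b,
      (DirectSum.of_mul_of (A := fun d ↦ grading W d) a b).symm⟩

theorem decomposePoly_eq {G : MvPolynomial (Fin 3) ℤ} {d : ℕ} (hG : G.IsHomogeneous d) :
    decomposePoly W G =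
      DirectSum.of (fun d ↦ grading W d) d ⟨toCoordRing W G, mem_grading W hG⟩ := by
  have key : decomposePoly W G ∈
      LinearMap.range (DirectSum.lof ℤ ℕ (fun d ↦ grading W d) d) := by
    rw [G.as_sum, map_sum]
    refine Submodule.sum_mem _ fun s hs ↦ ?_
    rw [decomposePoly, MvPolynomial.aeval_monomial, ← Algebra.smul_def]
    refine Submodule.smul_mem _ _ ?_
    have hd : d = ∑ i ∈ s.support, s i • 1 := by
      rw [← hG (MvPolynomial.mem_support_iff.mp hs), Finsupp.weight_apply]
      simp [Finsupp.sum]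
    rw [hd]
    exact SetLike.prod_pow_mem_graded
      (fun d ↦ LinearMap.range (DirectSum.lof ℤ ℕ (fun d ↦ grading W d) d)) _ _ _
      fun i _ ↦ ⟨_, rfl⟩
  obtain ⟨y, hy⟩ := key
  have h := coe_decomposePoly W G
  rw [← hy] at h ⊢
  have : y = ⟨toCoordRing W G, mem_grading W hG⟩ := by
    refine Subtype.ext (Eq.trans ?_ h)
    exact (DirectSum.coeAlgHom_of _ _ _).symm
  rw [this]
  rfl

/-- The decomposition of an element of `ℤ[X, Y, Z] / (F)` into homogeneous components. -/
noncomputable def decomposeHom : CoordRing W →ₐ[ℤ] DirectSum ℕ fun d ↦ grading W d :=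
  Ideal.Quotient.liftₐ _ (decomposePoly W) fun G hG ↦ by
    obtain ⟨H, rfl⟩ := Ideal.mem_span_singleton.mp hG
    rw [map_mul, decomposePoly_eq W (isHomogeneous_polynomial W)]
    have h0 : toCoordRing W W.toProjective.polynomial = 0 :=
      Ideal.Quotient.eq_zero_iff_mem.mpr (Ideal.mem_span_singleton_self _)
    have : (⟨toCoordRing W W.toProjective.polynomial,
        mem_grading W (isHomogeneous_polynomial W)⟩ : grading W 3) = 0 := Subtype.ext h0
    rw [this, map_zero, zero_mul]

noncomputable instance gradedAlgebra : GradedAlgebra (grading W) :=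
  GradedAlgebra.ofAlgHom _ (decomposeHom W)
    (by
      refine Ideal.Quotient.algHom_ext _ ?_
      ext i
      exact coe_decomposePoly W (MvPolynomial.X i))
    (by
      rintro d ⟨_, G, hG, rfl⟩
      exact decomposePoly_eq W hG)

/-- As a polynomial in `X` over `ℤ[Y, Z]`, the form `-F` is monic of degree `3` and Eisenstein at `Z`. -/
theorem finSucc_polynomial :
    ∃ p : Polynomial (MvPolynomial (Fin 2) ℤ), p.Monic ∧ p.natDegree = 3 ∧
      p.IsEisensteinAt (Ideal.span {MvPolynomial.X 1}) ∧
      MvPolynomial.finSuccEquiv ℤ 2 W.toProjective.polynomial = -p := by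
  let R := MvPolynomial (Fin 2) ℤ
  let Y : R := MvPolynomial.X 0
  let Z : R := MvPolynomial.X 1
  let b : R := MvPolynomial.C W.a₂ * Z
  let c : R := MvPolynomial.C W.a₄ * Z ^ 2 - MvPolynomial.C W.a₁ * Y * Z
  let e : R := MvPolynomial.C W.a₆ * Z ^ 3 - Y ^ 2 * Z - MvPolynomial.C W.a₃ * Y * Z ^ 2
  let p : Polynomial R := (Cubic.mk 1 b c e).toPoly
  have hm : p.Monic := Cubic.monic_of_a_eq_one rfl
  have hd : p.natDegree = 3 := Cubic.natDegree_of_a_ne_zero one_ne_zero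
  refine ⟨p, hm, hd, ?_, ?_⟩
  · have hprime : (Ideal.span {Z}).IsPrime := by
      rw [Ideal.span_singleton_prime (MvPolynomial.X_ne_zero _)]
      exact MvPolynomial.X_prime
    refine hm.isEisensteinAt_of_mem_of_notMem hprime.ne_top ?_ ?_
    · intro n hn
      rw [hd] at hn
      rw [Ideal.mem_span_singleton]
      interval_cases n
      · exact (Cubic.coeff_eq_d (P := Cubic.mk 1 b c e)) ▸
          ⟨MvPolynomial.C W.a₆ * Z ^ 2 - Y ^ 2 - MvPolynomial.C W.a₃ * Y * Z, by
            simp only [e]; ring⟩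
      · exact (Cubic.coeff_eq_c (P := Cubic.mk 1 b c e)) ▸
          ⟨MvPolynomial.C W.a₄ * Z - MvPolynomial.C W.a₁ * Y, by simp only [c]; ring⟩
      · exact (Cubic.coeff_eq_b (P := Cubic.mk 1 b c e)) ▸
          ⟨MvPolynomial.C W.a₂, by simp only [b]; ring⟩
    · rw [Ideal.span_singleton_pow, Ideal.mem_span_singleton]
      rw [show p.coeff 0 = e from Cubic.coeff_eq_d]
      rintro ⟨q, hq⟩
      have h1 : Z * (Y ^ 2) = Z * (Z * (MvPolynomial.C W.a₆ * Z - MvPolynomial.C W.a₃ * Y - q)) := by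
        simp only [e] at hq
        linear_combination -hq
      have h2 := mul_left_cancel₀ (MvPolynomial.X_ne_zero _) h1
      have h3 := congrArg (MvPolynomial.eval ![(1 : ℤ), 0]) h2
      simp [Y, Z] at h3
  · have h1 : MvPolynomial.finSuccEquiv ℤ 2 (MvPolynomial.X 1) = Polynomial.C Y :=
      MvPolynomial.finSuccEquiv_X_succ (j := 0)
    have h2 : MvPolynomial.finSuccEquiv ℤ 2 (MvPolynomial.X 2) = Polynomial.C Z :=
      MvPolynomial.finSuccEquiv_X_succ (j := 1)
    have hC (r : ℤ) : MvPolynomial.finSuccEquiv ℤ 2 (MvPolynomial.C r) =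
        Polynomial.C (MvPolynomial.C r) := by
      simp
    simp only [WeierstrassCurve.Projective.polynomial, map_sub, map_add, map_mul, map_pow, h1, h2,
      hC, MvPolynomial.finSuccEquiv_X_zero, p, Cubic.toPoly, b, c, e, map_one]
    ring

theorem prime_polynomial : Prime W.toProjective.polynomial := by
  obtain ⟨p, hm, hd, he, hp⟩ := finSucc_polynomial W
  have hprime : (Ideal.span {(MvPolynomial.X 1 : MvPolynomial (Fin 2) ℤ)}).IsPrime := by
    rw [Ideal.span_singleton_prime (MvPolynomial.X_ne_zero _)]
    exact MvPolynomial.X_prime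
  have hirr := he.irreducible hprime hm.isPrimitive (by omega)
  rw [← MulEquiv.prime_iff (MvPolynomial.finSuccEquiv ℤ 2).toMulEquiv]
  change Prime (MvPolynomial.finSuccEquiv ℤ 2 W.toProjective.polynomial)
  rw [hp]
  exact hirr.prime.neg

instance isDomain_coordRing : IsDomain (CoordRing W) :=
  (Ideal.Quotient.isDomain_iff_prime _).mpr
    ((Ideal.span_singleton_prime (prime_polynomial W).ne_zero).mpr (prime_polynomial W))

theorem Z_ne_zero : toCoordRing W (MvPolynomial.X 2) ≠ 0 := by
  intro h
  obtain ⟨p, hm, hd, -, hp⟩ := finSucc_polynomial W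
  have h1 := map_dvd (MvPolynomial.finSuccEquiv ℤ 2)
    (Ideal.mem_span_singleton.mp (Ideal.Quotient.eq_zero_iff_mem.mp h))
  have h2 : MvPolynomial.finSuccEquiv ℤ 2 (MvPolynomial.X 2) =
      Polynomial.C (MvPolynomial.X 1) := MvPolynomial.finSuccEquiv_X_succ (j := 1)
  rw [hp, h2] at h1
  replace h1 := (neg_dvd (a := p)).mp h1
  exact hm.not_dvd_of_natDegree_lt (by simp) (by simp [hd]) h1

/-- The Weierstrass model `𝒲 = Proj ℤ[X, Y, Z] / (F)`, the closed subscheme `F = 0` of `ℙ²_ℤ`. -/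
noncomputable abbrev scheme : Scheme.{0} := Proj (grading W)

theorem not_irrelevant_le {I : HomogeneousIdeal (grading W)} {i : Fin 3}
    (hi : toCoordRing W (MvPolynomial.X i) ∉ I) : ¬ HomogeneousIdeal.irrelevant (grading W) ≤ I :=
  fun h ↦ hi (h (HomogeneousIdeal.mem_irrelevant_of_mem _ one_pos
    (mem_grading W (MvPolynomial.isHomogeneous_X ℤ i))))

/-- The generic point of `𝒲`, the zero ideal. -/
noncomputable def gen : ProjectiveSpectrum (grading W) where
  asHomogeneousIdeal := ⊥
  isPrime := Ideal.isPrime_bot (α := CoordRing W)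
  not_irrelevant_le := not_irrelevant_le W (i := 2) (Z_ne_zero W)

instance irreducibleSpace : IrreducibleSpace (scheme W) := by
  have h : closure {gen W} = Set.univ :=
    Set.eq_univ_of_forall fun x ↦
      (ProjectiveSpectrum.le_iff_mem_closure (𝒜 := grading W) (gen W) x).mp
        (bot_le (a := x.asHomogeneousIdeal))
  have h2 : IsIrreducible (Set.univ : Set (ProjectiveSpectrum (grading W))) :=
    h ▸ isIrreducible_singleton.closure
  exact (irreducibleSpace_def _).mpr h2

instance isIntegral_scheme : IsIntegral (scheme W) := by
  have : ∀ x : scheme W, _root_.IsReduced ((scheme W).presheaf.stalk x) := fun x ↦ by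
    let 𝔮 := (show ProjectiveSpectrum (grading W) from x).asHomogeneousIdeal.toIdeal
    let e : (scheme W).presheaf.stalk x ≃+* HomogeneousLocalization.AtPrime (grading W) 𝔮 :=
      (Proj.stalkIso (grading W) x).commRingCatIsoToRingEquiv
    have : IsDomain (Localization 𝔮.primeCompl) := 
      IsLocalization.isDomain_localization 𝔮.primeCompl_le_nonZeroDivisors
    exact isReduced_of_injective ((algebraMap _ (Localization 𝔮.primeCompl)).comp e.toRingHom)
      ((HomogeneousLocalization.val_injective _).comp e.injective)
  have := isReduced_of_isReduced_stalk (scheme W)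
  exact isIntegral_of_irreducibleSpace_of_isReduced _


/-- Homogeneous coordinates of a rational point of the generic fibre. -/
def coords : (W.baseChange ℚ).toAffine.Point → Fin 3 → ℚ
  | .zero => ![0, 1, 0]
  | .some x y _ => ![x, y, 1]

theorem aeval_coords (P : (W.baseChange ℚ).toAffine.Point) :
    MvPolynomial.aeval (coords W P) W.toProjective.polynomial = 0 := by
  rcases P with _ | ⟨x, y, h⟩
  · simp [coords, WeierstrassCurve.Projective.polynomial]
  · have := (WeierstrassCurve.Affine.equation_iff' ..).mp h.1
    simp [coords, WeierstrassCurve.Projective.polynomial]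
    simpa [WeierstrassCurve.baseChange] using this

/-- Evaluation of a form at the homogeneous coordinates of `P`. -/
noncomputable def evalAt (P : (W.baseChange ℚ).toAffine.Point) : CoordRing W →ₐ[ℤ] ℚ :=
  Ideal.Quotient.liftₐ _ (MvPolynomial.aeval (coords W P)) fun G hG ↦ by
    obtain ⟨H, rfl⟩ := Ideal.mem_span_singleton.mp hG
    rw [map_mul, aeval_coords, zero_mul]

theorem evalAt_toCoordRing (P : (W.baseChange ℚ).toAffine.Point) (G : MvPolynomial (Fin 3) ℤ) :
    evalAt W P (toCoordRing W G) = MvPolynomial.aeval (coords W P) G := rfl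

/-- The point of `𝒲` defined by `P ∈ W(ℚ)`: the homogeneous prime ideal generated by all forms over
`ℤ` that vanish at `P`. It is the closed point `P` of the generic fibre `𝒲_ℚ ⊆ 𝒲`, and at the same
time the generic point of the Zariski closure of `P` in `𝒲`. -/
noncomputable def pointOf (P : (W.baseChange ℚ).toAffine.Point) : scheme W :=
  show ProjectiveSpectrum (grading W) from
  { asHomogeneousIdeal := (RingHom.ker (evalAt W P)).homogeneousCore (grading W)
    isPrime := (RingHom.ker_isPrime (evalAt W P)).homogeneousCore
    not_irrelevant_le := by
      have key (i : Fin 3) (h : coords W P i ≠ 0) : toCoordRing W (MvPolynomial.X i) ∉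
          (RingHom.ker (evalAt W P)).homogeneousCore (grading W) := fun hi ↦ h (by
        have := Ideal.toIdeal_homogeneousCore_le (grading W) (RingHom.ker (evalAt W P)) hi
        rwa [RingHom.mem_ker, evalAt_toCoordRing, MvPolynomial.aeval_X] at this)
      rcases P with _ | ⟨x, y, h⟩
      · exact not_irrelevant_le W (key 1 (by simp [coords]))
      · exact not_irrelevant_le W (key 2 (by simp [coords])) }

instance nonempty_basicOpen : Nonempty (Proj.basicOpen (grading W) (toCoordRing W (MvPolynomial.X 2))) :=
  ⟨⟨gen W, Z_ne_zero W⟩⟩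

/-- The rational function `Xᵢ / Z` on `𝒲`. -/
noncomputable def affineCoord (i : Fin 3) : (scheme W).functionField :=
  (scheme W).germToFunctionField (Proj.basicOpen (grading W) (toCoordRing W (MvPolynomial.X 2)))
    (Proj.awayToSection (grading W) (toCoordRing W (MvPolynomial.X 2))
      (HomogeneousLocalization.Away.mk (grading W)
        (mem_grading W (MvPolynomial.isHomogeneous_X ℤ 2)) 1 (toCoordRing W (MvPolynomial.X i))
        (mem_grading W (MvPolynomial.isHomogeneous_X ℤ i))))

/-- The Néron differential `ω_W = dx / (2y + a₁x + a₃)`, where `x = X / Z` and `y = Y / Z`. -/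
noncomputable def neronDifferential : RationalDifferential (scheme W) :=
  (2 * affineCoord W 1 + (W.a₁ : (scheme W).functionField) * affineCoord W 0 +
      (W.a₃ : (scheme W).functionField))⁻¹ •
    KaehlerDifferential.D ℤ (scheme W).functionField (affineCoord W 0)

/-- `W` is a minimal Weierstrass model over `ℤ` of its generic fibre: it is a minimal Weierstrass
equation at every prime `p`. -/
def IsMinimalModel : Prop :=
  ∀ (p : ℕ) [Fact p.Prime], (W.map (Int.castRingHom ℚ_[p])).IsMinimal ℤ_[p]

/-- The two conditions on `α(P)`: the induced differential on the generic fibre has residue divisor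
`½((P) - (-P))`, and `4α(P)` is regular on `𝒲` up to first order poles along the closures of `P`
and `-P`. -/
structure IsThirdKind (P : (W.baseChange ℚ).toAffine.Point)
    (α : RationalDifferential (scheme W)) : Prop where
  residue : HasResidueDivisor (scheme W) α
    (Finsupp.single (pointOf W P) (1 / 2) - Finsupp.single (pointOf W (-P)) (1 / 2))
  regular : IsRegularUpToSimplePoles (scheme W) (4 • α) {pointOf W P, pointOf W (-P)}

end WeierstrassModel

/-!
Let `K` be the function field of `𝒲`, `x` and `y` the affine coordinate functions, `ω` the Néron
differential and `η = 2y + a₁x + a₃`, so that `dx = η ω`. Every rational differential is `f ω` with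
`f ∈ K`, and at every point of codimension one `ω` generates the differentials of the local ring
(`neronGenerates_of_coheight`): the generic fibre is smooth, and over a prime `p` the partial
derivatives of the equation do not vanish identically modulo `p`. As `ω ≠ 0`, the differential `f ω`
is regular at such a point if and only if `f` lies in the local ring (`isRegularAt_smul_iff`), and the
theorem becomes a statement about functions. The points of codimension one are the closed points of
the generic fibre ("horizontal" points) and the generic points of the fibres over the primes
(`exists_eq_fibrePt`); these fibres are irreducible, because a Weierstrass form over a field is
prime.

*Existence.* If `P = -P`, the residue divisor is zero and `α = 0` will do. Otherwise `P = (x₀, y₀)` with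
`η₀ = 2y₀ + a₁x₀ + a₃ ≠ 0`, and `x - x₀` is a uniformizer at `P` and at `-P`, where `η` has the values
`η₀` and `-η₀`. So `½ η₀ / (x - x₀) ω` has residues `½` and `-½`, and no other poles on the generic
fibre; the same is true after adding a constant multiple of `ω`. The constant is to be chosen such
that `4α` is regular over all primes. With `x₀ = n / d` in lowest terms, `2η₀d²` is an integer
(`exists_combination`), hence of the form `kn + ld`, and `4α = (kx + l) / (dx - n) ω` differs from
`2η₀ / (x - x₀) ω` by `(k / d) ω`. The differential `4α` is regular over `p`, as
`dx - n` is not zero modulo `p` (`isThirdKind_poleCoeff`).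

*Uniqueness.* The difference `f ω` of two solutions has no poles on the generic fibre
(`HasResidueAt.sub_regular`). So `f` belongs to the affine coordinate ring over `ℚ`, that is
`f = p(x) + q(x) η` (`exists_affineToFF_eq`), and since `x` and `η` have poles of order two and three
at infinity, `f` is constant (`exists_eq_ratCast`). Regularity of `4 f ω` over all primes says that
`4f` is an integer (`exists_intCast_eq`).
-/

namespace WeierstrassModel

variable (W : WeierstrassCurve ℤ)

/-! ### Points of codimension one and fractions of forms -/

/-- The homogeneous prime ideal of a point of `𝒲`. -/
noncomputable def idealOf (x : scheme W) : Ideal (CoordRing W) :=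
  (show ProjectiveSpectrum (grading W) from x).asHomogeneousIdeal.toIdeal

instance idealOf_isPrime (x : scheme W) : (idealOf W x).IsPrime :=
  (show ProjectiveSpectrum (grading W) from x).isPrime

theorem idealOf_isHomogeneous (x : scheme W) : (idealOf W x).IsHomogeneous (grading W) :=
  (show ProjectiveSpectrum (grading W) from x).asHomogeneousIdeal.isHomogeneous

theorem idealOf_injective : Function.Injective (idealOf W) := fun _ _ h ↦
  ProjectiveSpectrum.ext (𝒜 := grading W) (HomogeneousIdeal.toIdeal_injective h)

theorem le_iff_idealOf_le {x y : scheme W} : x ≤ y ↔ idealOf W y ≤ idealOf W x := by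
  change y ⤳ x ↔ _
  rw [specializes_iff_mem_closure]
  exact (ProjectiveSpectrum.le_iff_mem_closure (𝒜 := grading W) y x).symm

/-- The generic point, as a point of the scheme. -/
noncomputable def genPt : scheme W := gen W

theorem idealOf_genPt : idealOf W (genPt W) = ⊥ := rfl

theorem genericPoint_eq_genPt : genericPoint (scheme W) = genPt W := by
  refine idealOf_injective W (le_antisymm ?_ bot_le)
  exact (le_iff_idealOf_le W).mp ((genericPoint_spec (scheme W)).specializes trivial)

theorem idealOf_genericPoint : idealOf W (genericPoint (scheme W)) = ⊥ := by
  rw [genericPoint_eq_genPt, idealOf_genPt]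

/-- A point has codimension one if its ideal is minimal among the nonzero ideals of points. -/
theorem coheight_eq_one_of {x : scheme W} (hx : idealOf W x ≠ ⊥)
    (h : ∀ y : scheme W, idealOf W y ≤ idealOf W x → idealOf W y ≠ ⊥ →
      idealOf W x ≤ idealOf W y) : Order.coheight x = 1 := by
  have hg : IsMax (genPt W) := fun y _ ↦ (le_iff_idealOf_le W).mpr (by
    rw [idealOf_genPt]; exact bot_le)
  have hlt : ∀ y : scheme W, x < y → y = genPt W := by
    intro y hy
    by_contra hne
    refine hy.not_ge ((le_iff_idealOf_le W).mpr (h y ((le_iff_idealOf_le W).mp hy.le) ?_))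
    exact fun h0 ↦ hne (idealOf_injective W h0)
  have hxg : x < genPt W := by
    refine lt_of_le_not_ge ((le_iff_idealOf_le W).mpr bot_le) fun h' ↦ hx ?_
    exact le_bot_iff.mp ((le_iff_idealOf_le W).mp h')
  refine le_antisymm ?_ ?_
  · refine (Order.coheight_le_coe_iff (n := 1)).mpr fun y hy ↦ ?_
    rw [hlt y hy, Order.coheight_eq_zero.mpr hg]
    exact Nat.cast_lt.mpr one_pos
  · refine Order.one_le_iff_ne_zero.mpr (Order.coheight_ne_zero.mpr fun h' ↦ ?_)
    exact hxg.not_ge (h' hxg.le)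

theorem idealOf_ne_bot_of_coheight {x : scheme W} (hx : Order.coheight x = 1) :
    idealOf W x ≠ ⊥ := by
  intro h
  have : x = genPt W := idealOf_injective W h
  have hg : IsMax x := fun y _ ↦ (le_iff_idealOf_le W).mpr (by
    rw [h]; exact bot_le)
  rw [Order.coheight_eq_zero.mpr hg] at hx
  exact zero_ne_one hx

theorem idealOf_le_of_coheight {x y : scheme W} (hx : Order.coheight x = 1)
    (hyx : idealOf W y ≤ idealOf W x) (hy : idealOf W y ≠ ⊥) : idealOf W x ≤ idealOf W y := by
  by_contra hne
  have h1 : x < y := lt_of_le_not_ge ((le_iff_idealOf_le W).mpr hyx)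
    fun h ↦ hne ((le_iff_idealOf_le W).mp h)
  have h2 : y < genPt W := by
    refine lt_of_le_not_ge ((le_iff_idealOf_le W).mpr bot_le) fun h' ↦ hy ?_
    exact le_bot_iff.mp ((le_iff_idealOf_le W).mp h')
  have h3 := (Order.coheight_le_coe_iff (n := 1)).mp hx.le y h1
  have h4 : Order.coheight y = 0 := by
    exact Order.lt_one_iff.mp h3
  exact h2.not_ge (Order.coheight_eq_zero.mp h4 h2.le)

/-- The function field of `𝒲`. -/
noncomputable abbrev FF : Type := (scheme W).functionField

/-- The embedding of the function field of `𝒲` into the fraction field of the homogeneous coordinate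
ring. -/
noncomputable def toFrac :
    FF W →+* Localization (idealOf W (genericPoint (scheme W))).primeCompl :=
  (algebraMap (HomogeneousLocalization.AtPrime (grading W)
      (idealOf W (genericPoint (scheme W)))) _).comp
    (Proj.stalkIso' (grading W) (genericPoint (scheme W))).toRingHom

theorem toFrac_injective : Function.Injective (toFrac W) := (toFrac W).injective

theorem le_primeCompl (x : scheme W) :
    (idealOf W x).primeCompl ≤ (idealOf W (genericPoint (scheme W))).primeCompl := by
  intro a ha h
  rw [idealOf_genericPoint] at h
  rw [(Ideal.mem_bot).mp h] at ha
  exact ha (zero_mem _)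

theorem X_two_mem_primeCompl : toCoordRing W (MvPolynomial.X 2) ∈
    (idealOf W (genericPoint (scheme W))).primeCompl := fun h ↦
  Z_ne_zero W (Ideal.mem_bot.mp (idealOf_genericPoint W ▸ h))

theorem toFrac_stalk (x : scheme W)
    (f : HomogeneousLocalization.NumDenSameDeg (grading W) (idealOf W x).primeCompl) :
    toFrac W (algebraMap ((scheme W).presheaf.stalk x) (FF W)
      ((Proj.stalkIso' (grading W) x).symm (.mk f))) =
    Localization.mk f.num.1 ⟨f.den.1, le_primeCompl W x f.den_mem⟩ := by
  have : Nonempty (Proj.basicOpen (grading W) f.den.1) := ⟨⟨x, mem_basicOpen_den _ x f⟩⟩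
  have := Scheme.algebraMap_germ_eq_germToFunctionField (X := scheme W)
    (U := Proj.basicOpen (grading W) f.den.1) (mem_basicOpen_den (grading W) x f)
    (sectionInBasicOpen (grading W) x f)
  change toFrac W (algebraMap ((scheme W).presheaf.stalk x) (FF W)
    ((scheme W).presheaf.germ (Proj.basicOpen (grading W) f.den.1) x
      (mem_basicOpen_den (grading W) x f) (sectionInBasicOpen (grading W) x f))) = _
  rw [this]
  change (Proj.stalkIso' (grading W) (genericPoint (scheme W)) _).val = _
  erw [Proj.stalkIso'_germ]
  rfl

theorem toFrac_affineCoord (i : Fin 3) :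
    toFrac W (affineCoord W i) = Localization.mk (toCoordRing W (MvPolynomial.X i))
      ⟨toCoordRing W (MvPolynomial.X 2), X_two_mem_primeCompl W⟩ := by
  change (Proj.stalkIso' (grading W) (genericPoint (scheme W)) _).val = _
  unfold affineCoord
  erw [Proj.stalkIso'_germ]
  change Localization.mk _ _ = _
  congr 1
  exact Subtype.ext (pow_one _)

theorem eval₂_smul_of_isHomogeneous {σ R A : Type*} [CommRing R] [CommRing A] (f : R →+* A)
    {G : MvPolynomial σ R} {d : ℕ} (hG : G.IsHomogeneous d) (c : A) (v : σ → A) :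
    MvPolynomial.eval₂ f (fun i ↦ c * v i) G = c ^ d * MvPolynomial.eval₂ f v G := by
  rw [MvPolynomial.eval₂_eq, MvPolynomial.eval₂_eq, Finset.mul_sum]
  refine Finset.sum_congr rfl fun s hs ↦ ?_
  have hd : s.degree = d := by
    by_contra h
    exact MvPolynomial.mem_support_iff.mp hs (hG.coeff_eq_zero h)
  simp only [mul_pow, Finset.prod_mul_distrib]
  rw [Finset.prod_pow_eq_pow_sum, ← hd, Finsupp.degree_apply, mul_left_comm]

theorem map_eval₂_int {σ A B : Type*} [CommRing A] [CommRing B] (f : A →+* B) (v : σ → A)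
    (G : MvPolynomial σ ℤ) :
    f (MvPolynomial.eval₂ (Int.castRingHom A) v G) =
      MvPolynomial.eval₂ (Int.castRingHom B) (fun i ↦ f (v i)) G := by
  rw [MvPolynomial.hom_eval₂, RingHom.eq_intCast' (f.comp _)]

theorem toCoordRing_eq_eval₂ (G : MvPolynomial (Fin 3) ℤ) :
    toCoordRing W G = MvPolynomial.eval₂ (Int.castRingHom (CoordRing W))
      (fun i ↦ toCoordRing W (MvPolynomial.X i)) G := by
  conv_lhs => rw [← MvPolynomial.eval₂_eta G]
  exact MvPolynomial.hom_eval₂ G MvPolynomial.C (toCoordRing W).toRingHom _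

theorem toFrac_aeval {G : MvPolynomial (Fin 3) ℤ} {d : ℕ} (hG : G.IsHomogeneous d) :
    toFrac W (MvPolynomial.aeval (affineCoord W) G) =
      Localization.mk (toCoordRing W G)
        (⟨toCoordRing W (MvPolynomial.X 2), X_two_mem_primeCompl W⟩ ^ d) := by
  let M := (idealOf W (genericPoint (scheme W))).primeCompl
  let z : M := ⟨toCoordRing W (MvPolynomial.X 2), X_two_mem_primeCompl W⟩
  have h2 : (fun i ↦ toFrac W (affineCoord W i)) = fun i ↦ Localization.mk 1 z *
      algebraMap (CoordRing W) (Localization M) (toCoordRing W (MvPolynomial.X i)) := by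
    funext i
    rw [toFrac_affineCoord, ← Localization.mk_one_eq_algebraMap, Localization.mk_mul]
    simp [z]
  rw [MvPolynomial.aeval_def, algebraMap_int_eq,
    map_eval₂_int (A := FF W) (B := Localization M) (toFrac W), h2,
    eval₂_smul_of_isHomogeneous (A := Localization M) _ hG,
    ← map_eval₂_int (A := CoordRing W) (B := Localization M) (algebraMap _ _),
    ← toCoordRing_eq_eval₂,
    ← Localization.mk_one_eq_algebraMap, Localization.mk_pow, Localization.mk_mul]
  simp [z]

theorem aeval_affineCoord_polynomial :
    MvPolynomial.aeval (affineCoord W) W.toProjective.polynomial = 0 := by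
  apply toFrac_injective W
  rw [toFrac_aeval W (isHomogeneous_polynomial W), map_zero,
    show toCoordRing W W.toProjective.polynomial = 0 from
      Ideal.Quotient.eq_zero_iff_mem.mpr (Ideal.mem_span_singleton_self _), Localization.mk_zero]

/-- Dehomogenization: the homomorphism from the homogeneous coordinate ring to the function field
that maps `X`, `Y`, `Z` to `x`, `y`, `1`. -/
noncomputable def dehom : CoordRing W →ₐ[ℤ] FF W :=
  Ideal.Quotient.liftₐ _ (MvPolynomial.aeval (affineCoord W)) fun G hG ↦ by
    obtain ⟨H, rfl⟩ := Ideal.mem_span_singleton.mp hG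
    rw [map_mul, aeval_affineCoord_polynomial, zero_mul]

theorem dehom_toCoordRing (G : MvPolynomial (Fin 3) ℤ) :
    dehom W (toCoordRing W G) = MvPolynomial.aeval (affineCoord W) G := rfl

theorem affineCoord_two : affineCoord W 2 = 1 := by
  apply toFrac_injective W
  rw [toFrac_affineCoord, map_one]
  exact Localization.mk_self
    (⟨_, X_two_mem_primeCompl W⟩ : (idealOf W (genericPoint (scheme W))).primeCompl)

theorem toFrac_dehom {G : CoordRing W} {d : ℕ} (hG : G ∈ grading W d) :
    toFrac W (dehom W G) = Localization.mk G
        (⟨toCoordRing W (MvPolynomial.X 2), X_two_mem_primeCompl W⟩ ^ d) := by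
  obtain ⟨G, hG, rfl⟩ := hG
  exact toFrac_aeval W hG

/-- Dehomogenization is injective on forms. -/
theorem dehom_eq_zero {G : CoordRing W} {d : ℕ} (hG : G ∈ grading W d) (h : dehom W G = 0) :
    G = 0 := by
  have h1 := toFrac_dehom W hG
  rw [h, map_zero, eq_comm, Localization.mk_eq_mk', IsLocalization.mk'_eq_zero_iff] at h1
  obtain ⟨m, hm⟩ := h1
  refine (mul_eq_zero.mp hm).resolve_left fun h ↦ m.2 ?_
  rw [h]
  exact zero_mem _

/-- The elements of the local ring of `𝒲` at `x` are the fractions `G / H` of forms of the same degree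
with `H` not vanishing at `x`. -/
theorem exists_fraction (x : scheme W) (s : (scheme W).presheaf.stalk x) :
    ∃ d, ∃ G ∈ grading W d, ∃ H ∈ grading W d, H ∉ idealOf W x ∧
      algebraMap ((scheme W).presheaf.stalk x) (FF W) s * dehom W H = dehom W G := by
  obtain ⟨t, rfl⟩ := (Proj.stalkIso' (grading W) x).symm.surjective s
  obtain ⟨f, rfl⟩ := HomogeneousLocalization.mk_surjective t
  refine ⟨f.deg, f.num.1, f.num.2, f.den.1, f.den.2, f.den_mem, ?_⟩
  apply toFrac_injective W
  have h := toFrac_stalk W x f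
  rw [map_mul]
  erw [h]
  rw [toFrac_dehom W f.num.2, toFrac_dehom W f.den.2, Localization.mk_mul, Localization.mk_eq_mk_iff,
    Localization.r_iff_exists]
  exact ⟨1, by simp; ring⟩

theorem exists_stalk (x : scheme W) {d : ℕ} {G H : CoordRing W} (hG : G ∈ grading W d)
    (hH : H ∈ grading W d) (hx : H ∉ idealOf W x) :
    ∃ s : (scheme W).presheaf.stalk x,
      algebraMap ((scheme W).presheaf.stalk x) (FF W) s * dehom W H = dehom W G := by
  let f : HomogeneousLocalization.NumDenSameDeg (grading W) (idealOf W x).primeCompl :=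
    ⟨d, ⟨G, hG⟩, ⟨H, hH⟩, hx⟩
  refine ⟨(Proj.stalkIso' (grading W) x).symm (.mk f), ?_⟩
  apply toFrac_injective W
  have h := toFrac_stalk W x f
  rw [map_mul]
  erw [h]
  rw [toFrac_dehom W f.num.2, toFrac_dehom W f.den.2, Localization.mk_mul, Localization.mk_eq_mk_iff,
    Localization.r_iff_exists]
  exact ⟨1, by simp; ring⟩

theorem stalk_injective (x : scheme W) :
    Function.Injective (algebraMap ((scheme W).presheaf.stalk x) (FF W)) :=
  IsFractionRing.injective _ _

theorem dehom_ne_zero {x : scheme W} {d : ℕ} {H : CoordRing W} (hH : H ∈ grading W d)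
    (hx : H ∉ idealOf W x) : dehom W H ≠ 0 := fun h ↦ hx (by
  rw [dehom_eq_zero W hH h]; exact zero_mem _)

/-- A fraction `G / H` of forms lies in the maximal ideal of the local ring at `x` if and only if `G`
vanishes at `x`. -/
theorem mem_maximalIdeal_iff (x : scheme W) {d : ℕ} {G H : CoordRing W} (hG : G ∈ grading W d)
    (hH : H ∈ grading W d) (hx : H ∉ idealOf W x) {s : (scheme W).presheaf.stalk x}
    (hs : algebraMap ((scheme W).presheaf.stalk x) (FF W) s * dehom W H = dehom W G) :
    s ∈ IsLocalRing.maximalIdeal ((scheme W).presheaf.stalk x) ↔ G ∈ idealOf W x := by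
  rw [IsLocalRing.mem_maximalIdeal, mem_nonunits_iff, ← not_iff_not, not_not]
  constructor
  · rintro hu hGx
    obtain ⟨t, ht⟩ := hu.exists_right_inv
    obtain ⟨e, G', hG', H', hH', hx', h'⟩ := exists_fraction W x t
    have h1 : dehom W (G * G' - H * H') = 0 := by
      rw [map_sub, map_mul, map_mul, ← hs, ← h']
      have := congrArg (algebraMap ((scheme W).presheaf.stalk x) (FF W)) ht
      rw [map_mul, map_one] at this
      linear_combination (dehom W H * dehom W H') * this
    have h2 := dehom_eq_zero W (Submodule.sub_mem _ (SetLike.mul_mem_graded hG hG')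
      (SetLike.mul_mem_graded hH hH')) h1
    have h3 : H * H' ∈ idealOf W x := by
      rw [← sub_eq_zero.mp h2]
      exact Ideal.mul_mem_right _ _ hGx
    exact ((idealOf_isPrime W x).mem_or_mem h3).elim hx hx'
  · intro hGx
    obtain ⟨t, ht⟩ := exists_stalk W x hH hG hGx
    refine IsUnit.of_mul_eq_one t (stalk_injective W x ?_)
    rw [map_mul, map_one]
    apply mul_right_cancel₀ (dehom_ne_zero W hH hx)
    rw [one_mul]
    linear_combination ht + algebraMap ((scheme W).presheaf.stalk x) (FF W) t * hs

end WeierstrassModel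

namespace WeierstrassModel

/-! ### Reduction modulo a prime -/

/-- As a polynomial in `X` over `k[Y, Z]`, the form `-F` is monic of degree `3` and Eisenstein at `Z`. -/
theorem finSucc_polynomial_field {k : Type*} [Field k] (W : WeierstrassCurve k) :
    ∃ p : Polynomial (MvPolynomial (Fin 2) k), p.Monic ∧ p.natDegree = 3 ∧
      p.IsEisensteinAt (Ideal.span {MvPolynomial.X 1}) ∧
      MvPolynomial.finSuccEquiv k 2 W.toProjective.polynomial = -p := by
  let R := MvPolynomial (Fin 2) k
  let Y : R := MvPolynomial.X 0
  let Z : R := MvPolynomial.X 1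
  let b : R := MvPolynomial.C W.a₂ * Z
  let c : R := MvPolynomial.C W.a₄ * Z ^ 2 - MvPolynomial.C W.a₁ * Y * Z
  let e : R := MvPolynomial.C W.a₆ * Z ^ 3 - Y ^ 2 * Z - MvPolynomial.C W.a₃ * Y * Z ^ 2
  let p : Polynomial R := (Cubic.mk 1 b c e).toPoly
  have hm : p.Monic := Cubic.monic_of_a_eq_one rfl
  have hd : p.natDegree = 3 := Cubic.natDegree_of_a_ne_zero one_ne_zero
  refine ⟨p, hm, hd, ?_, ?_⟩
  · have hprime : (Ideal.span {Z}).IsPrime := by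
      rw [Ideal.span_singleton_prime (MvPolynomial.X_ne_zero _)]
      exact MvPolynomial.X_prime
    refine hm.isEisensteinAt_of_mem_of_notMem hprime.ne_top ?_ ?_
    · intro n hn
      rw [hd] at hn
      rw [Ideal.mem_span_singleton]
      interval_cases n
      · exact (Cubic.coeff_eq_d (P := Cubic.mk 1 b c e)) ▸
          ⟨MvPolynomial.C W.a₆ * Z ^ 2 - Y ^ 2 - MvPolynomial.C W.a₃ * Y * Z, by
            simp only [e]; ring⟩
      · exact (Cubic.coeff_eq_c (P := Cubic.mk 1 b c e)) ▸
          ⟨MvPolynomial.C W.a₄ * Z - MvPolynomial.C W.a₁ * Y, by simp only [c]; ring⟩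
      · exact (Cubic.coeff_eq_b (P := Cubic.mk 1 b c e)) ▸
          ⟨MvPolynomial.C W.a₂, by simp only [b]; ring⟩
    · rw [Ideal.span_singleton_pow, Ideal.mem_span_singleton]
      rw [show p.coeff 0 = e from Cubic.coeff_eq_d]
      rintro ⟨q, hq⟩
      have h1 : Z * (Y ^ 2) = Z * (Z * (MvPolynomial.C W.a₆ * Z - MvPolynomial.C W.a₃ * Y - q)) := by
        simp only [e] at hq
        linear_combination -hq
      have h2 := mul_left_cancel₀ (MvPolynomial.X_ne_zero _) h1
      have h3 := congrArg (MvPolynomial.eval ![(1 : k), 0]) h2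
      simp [Y, Z] at h3
  · have h1 : MvPolynomial.finSuccEquiv k 2 (MvPolynomial.X 1) = Polynomial.C Y :=
      MvPolynomial.finSuccEquiv_X_succ (j := 0)
    have h2 : MvPolynomial.finSuccEquiv k 2 (MvPolynomial.X 2) = Polynomial.C Z :=
      MvPolynomial.finSuccEquiv_X_succ (j := 1)
    have hC (r : k) : MvPolynomial.finSuccEquiv k 2 (MvPolynomial.C r) =
        Polynomial.C (MvPolynomial.C r) := (MvPolynomial.finSuccEquiv k 2).commutes r
    simp only [WeierstrassCurve.Projective.polynomial, map_sub, map_add, map_mul, map_pow, h1, h2,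
      hC, MvPolynomial.finSuccEquiv_X_zero, p, Cubic.toPoly, b, c, e, map_one]
    ring

theorem prime_polynomial_field {k : Type*} [Field k] (W : WeierstrassCurve k) :
    Prime W.toProjective.polynomial := by
  obtain ⟨p, hm, hd, he, hp⟩ := finSucc_polynomial_field W
  have hprime : (Ideal.span {(MvPolynomial.X 1 : MvPolynomial (Fin 2) k)}).IsPrime := by
    rw [Ideal.span_singleton_prime (MvPolynomial.X_ne_zero _)]
    exact MvPolynomial.X_prime
  have hirr := he.irreducible hprime hm.isPrimitive (by omega)
  rw [← MulEquiv.prime_iff (MvPolynomial.finSuccEquiv k 2).toMulEquiv]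
  change Prime (MvPolynomial.finSuccEquiv k 2 W.toProjective.polynomial)
  rw [hp]
  exact hirr.prime.neg

variable (W : WeierstrassCurve ℤ)

theorem toCoordRing_surjective : Function.Surjective (toCoordRing W) :=
  Ideal.Quotient.mk_surjective

theorem toCoordRing_eq_zero_iff {G : MvPolynomial (Fin 3) ℤ} :
    toCoordRing W G = 0 ↔ W.toProjective.polynomial ∣ G :=
  Ideal.Quotient.eq_zero_iff_mem.trans Ideal.mem_span_singleton

/-- Reduction of the coefficients modulo `n`: divisibility by `n` in the homogeneous coordinate ring. -/
theorem natCast_dvd_toCoordRing_iff (n : ℕ) (G : MvPolynomial (Fin 3) ℤ) :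
    (n : CoordRing W) ∣ toCoordRing W G ↔
      (W.map (Int.castRingHom (ZMod n))).toProjective.polynomial ∣
        MvPolynomial.map (Int.castRingHom (ZMod n)) G := by
  rw [WeierstrassCurve.Projective.map_polynomial]
  constructor
  · rintro ⟨s, hs⟩
    obtain ⟨S, rfl⟩ := toCoordRing_surjective W s
    have h1 : toCoordRing W (G - n * S) = 0 := by
      rw [map_sub, map_mul, hs, map_natCast, sub_self]
    obtain ⟨Q, hQ⟩ := (toCoordRing_eq_zero_iff W).mp h1
    refine ⟨MvPolynomial.map (Int.castRingHom (ZMod n)) Q, ?_⟩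
    rw [← map_mul, ← hQ, map_sub, map_mul, map_natCast]
    have : (n : MvPolynomial (Fin 3) (ZMod n)) = 0 := CharP.cast_eq_zero _ n
    rw [this, zero_mul, sub_zero]
  · rintro ⟨Q, hQ⟩
    obtain ⟨Q, rfl⟩ := MvPolynomial.map_surjective (Int.castRingHom (ZMod n))
      (ZMod.ringHom_surjective _) Q
    rw [← map_mul, ← sub_eq_zero, ← map_sub] at hQ
    have h1 : (MvPolynomial.C (n : ℤ) : MvPolynomial (Fin 3) ℤ) ∣
        G - W.toProjective.polynomial * Q := by
      rw [MvPolynomial.C_dvd_iff_dvd_coeff]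
      intro i
      have := congrArg (MvPolynomial.coeff i) hQ
      rw [MvPolynomial.coeff_map, MvPolynomial.coeff_zero] at this
      exact (ZMod.intCast_zmod_eq_zero_iff_dvd _ n).mp (by simpa using this)
    have h2 := map_dvd (toCoordRing W) h1
    rw [map_sub, map_mul, (toCoordRing_eq_zero_iff W).mpr dvd_rfl, zero_mul, sub_zero] at h2
    simpa using h2

theorem eq_zero_of_toCoordRing_eq_zero {G : MvPolynomial (Fin 3) ℤ} {d : ℕ}
    (hG : G.IsHomogeneous d) (hd : d < 3) (h : toCoordRing W G = 0) : G = 0 := by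
  obtain ⟨Q, hQ⟩ := (toCoordRing_eq_zero_iff W).mp h
  by_contra hne
  have hQ0 : Q ≠ 0 := by rintro rfl; exact hne (by rw [hQ, mul_zero])
  have hd' := congrArg MvPolynomial.totalDegree hQ
  rw [MvPolynomial.totalDegree_mul_of_isDomain (prime_polynomial W).ne_zero hQ0,
    (isHomogeneous_polynomial W).totalDegree (prime_polynomial W).ne_zero,
    hG.totalDegree hne] at hd'
  omega

instance charZero_coordRing : CharZero (CoordRing W) := by
  refine charZero_of_inj_zero fun n hn ↦ ?_
  have h := eq_zero_of_toCoordRing_eq_zero W (MvPolynomial.isHomogeneous_C (Fin 3) (n : ℤ))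
    (by norm_num) (by simpa using hn)
  simpa using h

theorem natCast_prime (p : ℕ) [Fact p.Prime] : Prime (p : CoordRing W) := by
  have hF := prime_polynomial_field (W.map (Int.castRingHom (ZMod p)))
  have h0 (G : MvPolynomial (Fin 3) ℤ) := natCast_dvd_toCoordRing_iff W p G
  have h1 : ¬ (p : CoordRing W) ∣ 1 := by
    rw [← map_one (toCoordRing W), h0, map_one]
    exact fun h ↦ hF.not_isUnit (isUnit_of_dvd_one h)
  refine ⟨?_, fun h ↦ h1 h.dvd, fun a b hab ↦ ?_⟩
  · exact_mod_cast (Fact.out : p.Prime).ne_zero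
  · obtain ⟨a, rfl⟩ := toCoordRing_surjective W a
    obtain ⟨b, rfl⟩ := toCoordRing_surjective W b
    rw [← map_mul, h0, map_mul] at hab
    rw [h0, h0]
    exact hF.dvd_or_dvd hab

/-- A form of degree at most two that is divisible by `p` on the curve is divisible by `p`. -/
theorem map_eq_zero_of_natCast_dvd (p : ℕ) [Fact p.Prime] {G : MvPolynomial (Fin 3) ℤ} {d : ℕ}
    (hG : G.IsHomogeneous d) (hd : d < 3) (h : (p : CoordRing W) ∣ toCoordRing W G) :
    MvPolynomial.map (Int.castRingHom (ZMod p)) G = 0 := by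
  have hF := (prime_polynomial_field (W.map (Int.castRingHom (ZMod p)))).ne_zero
  obtain ⟨Q, hQ⟩ := (natCast_dvd_toCoordRing_iff W p G).mp h
  by_contra hne
  have hQ0 : Q ≠ 0 := by rintro rfl; exact hne (by rw [hQ, mul_zero])
  have hd' := congrArg MvPolynomial.totalDegree hQ
  have h3 : (W.map (Int.castRingHom (ZMod p))).toProjective.polynomial.IsHomogeneous 3 := by
    rw [WeierstrassCurve.Projective.map_polynomial]
    exact (isHomogeneous_polynomial W).map _
  rw [MvPolynomial.totalDegree_mul_of_isDomain hF hQ0, h3.totalDegree hF,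
    (hG.map _).totalDegree hne] at hd'
  omega

theorem intCast_mem_grading (n : ℤ) : (n : CoordRing W) ∈ grading W 0 := by
  have := mem_grading W (MvPolynomial.isHomogeneous_C (Fin 3) n)
  simpa using this

instance charZero_FF : CharZero (FF W) := by
  refine charZero_of_inj_zero fun n hn ↦ ?_
  have h := dehom_eq_zero W (intCast_mem_grading W n) (by simpa using hn)
  exact_mod_cast h

end WeierstrassModel

namespace WeierstrassModel

variable (W : WeierstrassCurve ℤ)

/-! ### Local rings as subrings of the function field -/

/-- The local ring of `𝒲` at `x`, as a subring of the function field. -/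
noncomputable def localRing (x : scheme W) : Subring (FF W) :=
  (algebraMap ((scheme W).presheaf.stalk x) (FF W)).range

/-- The maximal ideal of the local ring of `𝒲` at `x`, as a subset of the function field. -/
def maxSet (x : scheme W) : Set (FF W) :=
  algebraMap ((scheme W).presheaf.stalk x) (FF W) ''
    (IsLocalRing.maximalIdeal ((scheme W).presheaf.stalk x) : Set _)

variable {W} {x : scheme W}

theorem algebraMap_mem_localRing (s : (scheme W).presheaf.stalk x) :
    algebraMap ((scheme W).presheaf.stalk x) (FF W) s ∈ localRing W x := ⟨s, rfl⟩

theorem algebraMap_mem_maxSet {s : (scheme W).presheaf.stalk x} :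
    algebraMap ((scheme W).presheaf.stalk x) (FF W) s ∈ maxSet W x ↔
      s ∈ IsLocalRing.maximalIdeal ((scheme W).presheaf.stalk x) :=
  (stalk_injective W x).mem_set_image

theorem mem_localRing_of_mem_maxSet {r : FF W} (h : r ∈ maxSet W x) : r ∈ localRing W x := by
  obtain ⟨s, -, rfl⟩ := h
  exact algebraMap_mem_localRing s

theorem zero_mem_maxSet : (0 : FF W) ∈ maxSet W x := ⟨0, zero_mem _, map_zero _⟩

theorem one_notMem_maxSet : (1 : FF W) ∉ maxSet W x := by
  rw [← map_one (algebraMap ((scheme W).presheaf.stalk x) (FF W)), algebraMap_mem_maxSet]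
  exact (Ideal.ne_top_iff_one _).mp (IsLocalRing.maximalIdeal.isMaximal _).ne_top

theorem add_mem_maxSet {r s : FF W} (hr : r ∈ maxSet W x) (hs : s ∈ maxSet W x) :
    r + s ∈ maxSet W x := by
  obtain ⟨r, hr, rfl⟩ := hr
  obtain ⟨s, hs, rfl⟩ := hs
  exact ⟨r + s, add_mem hr hs, map_add _ _ _⟩

theorem mul_mem_maxSet {r s : FF W} (hr : r ∈ localRing W x) (hs : s ∈ maxSet W x) :
    r * s ∈ maxSet W x := by
  obtain ⟨r, rfl⟩ := hr
  obtain ⟨s, hs, rfl⟩ := hs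
  exact ⟨r * s, Ideal.mul_mem_left _ _ hs, map_mul _ _ _⟩

theorem neg_mem_maxSet {r : FF W} (hr : r ∈ maxSet W x) : -r ∈ maxSet W x := by
  rw [← neg_one_mul]
  exact mul_mem_maxSet (neg_mem (one_mem _)) hr

theorem sub_mem_maxSet {r s : FF W} (hr : r ∈ maxSet W x) (hs : s ∈ maxSet W x) :
    r - s ∈ maxSet W x := by
  rw [sub_eq_add_neg]
  exact add_mem_maxSet hr (neg_mem_maxSet hs)

theorem mem_or_mem_maxSet {r s : FF W} (hr : r ∈ localRing W x) (hs : s ∈ localRing W x)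
    (h : r * s ∈ maxSet W x) : r ∈ maxSet W x ∨ s ∈ maxSet W x := by
  obtain ⟨r, rfl⟩ := hr
  obtain ⟨s, rfl⟩ := hs
  rw [← map_mul, algebraMap_mem_maxSet] at h
  rw [algebraMap_mem_maxSet, algebraMap_mem_maxSet]
  exact (IsLocalRing.maximalIdeal.isMaximal _).isPrime.mem_or_mem h

theorem mem_maxSet_of_pow {r : FF W} (hr : r ∈ localRing W x) {n : ℕ}
    (h : r ^ n ∈ maxSet W x) : r ∈ maxSet W x := by
  induction n with
  | zero => exact absurd (by simpa using h) one_notMem_maxSet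
  | succ n ih =>
    rw [pow_succ] at h
    exact (mem_or_mem_maxSet (pow_mem hr n) hr h).elim ih id

theorem inv_mem_localRing {r : FF W} (hr : r ∈ localRing W x) (h : r ∉ maxSet W x) :
    r⁻¹ ∈ localRing W x := by
  obtain ⟨r, rfl⟩ := hr
  rw [algebraMap_mem_maxSet, IsLocalRing.mem_maximalIdeal, mem_nonunits_iff, not_not] at h
  obtain ⟨t, ht⟩ := h.exists_right_inv
  refine ⟨t, ?_⟩
  refine eq_inv_of_mul_eq_one_right ?_
  rw [← map_mul, ht, map_one]

theorem inv_notMem_localRing {r : FF W} (h : r ∈ maxSet W x) (h0 : r ≠ 0) :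
    r⁻¹ ∉ localRing W x := fun h' ↦ one_notMem_maxSet (by
  rw [← inv_mul_cancel₀ h0]; exact mul_mem_maxSet h' h)

theorem dehom_div_mem_localRing {d : ℕ} {G H : CoordRing W} (hG : G ∈ grading W d)
    (hH : H ∈ grading W d) (hx : H ∉ idealOf W x) :
    dehom W G / dehom W H ∈ localRing W x := by
  obtain ⟨s, hs⟩ := exists_stalk W x hG hH hx
  exact ⟨s, eq_div_of_mul_eq (dehom_ne_zero W hH hx) hs⟩

theorem dehom_div_mem_maxSet_iff {d : ℕ} {G H : CoordRing W} (hG : G ∈ grading W d)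
    (hH : H ∈ grading W d) (hx : H ∉ idealOf W x) :
    dehom W G / dehom W H ∈ maxSet W x ↔ G ∈ idealOf W x := by
  obtain ⟨s, hs⟩ := exists_stalk W x hG hH hx
  rw [← mem_maximalIdeal_iff W x hG hH hx hs, ← algebraMap_mem_maxSet,
    eq_div_of_mul_eq (dehom_ne_zero W hH hx) hs]

theorem exists_eq_dehom_div {r : FF W} (hr : r ∈ localRing W x) :
    ∃ d, ∃ G ∈ grading W d, ∃ H ∈ grading W d, H ∉ idealOf W x ∧ r = dehom W G / dehom W H := by
  obtain ⟨s, rfl⟩ := hr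
  obtain ⟨d, G, hG, H, hH, hx, h⟩ := exists_fraction W x s
  exact ⟨d, G, hG, H, hH, hx, eq_div_of_mul_eq (dehom_ne_zero W hH hx) h⟩

theorem intCast_mem_maxSet_iff (n : ℤ) :
    (n : FF W) ∈ maxSet W x ↔ (n : CoordRing W) ∈ idealOf W x := by
  rw [← dehom_div_mem_maxSet_iff (intCast_mem_grading W n) SetLike.GradedOne.one_mem
    ((Ideal.ne_top_iff_one _).mp (idealOf_isPrime W x).ne_top)]
  simp

/-- A point of `𝒲` is horizontal if it lies on the generic fibre. -/
def IsHorizontal (x : scheme W) : Prop := ∀ n : ℤ, (n : CoordRing W) ∈ idealOf W x → n = 0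

theorem isHorizontal_of_charZero
    [CharZero (IsLocalRing.ResidueField ((scheme W).presheaf.stalk x))] : IsHorizontal x := by
  intro n hn
  rw [← intCast_mem_maxSet_iff, ← map_intCast (algebraMap ((scheme W).presheaf.stalk x) (FF W)),
    algebraMap_mem_maxSet, ← IsLocalRing.residue_eq_zero_iff, map_intCast] at hn
  exact_mod_cast hn

theorem charZero_of_isHorizontal (h : IsHorizontal x) :
    CharZero (IsLocalRing.ResidueField ((scheme W).presheaf.stalk x)) := by
  refine charZero_of_inj_zero fun n hn ↦ ?_
  rw [← map_natCast (IsLocalRing.residue ((scheme W).presheaf.stalk x)),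
    IsLocalRing.residue_eq_zero_iff, ← algebraMap_mem_maxSet] at hn
  have := h n ((intCast_mem_maxSet_iff _).mp (by simpa using hn))
  exact_mod_cast this

theorem ratCast_mem_localRing (h : IsHorizontal x) (q : ℚ) : (q : FF W) ∈ localRing W x := by
  have h1 : ((q.den : ℤ) : FF W)⁻¹ ∈ localRing W x := by
    refine inv_mem_localRing (intCast_mem _ _) fun h' ↦ q.den_ne_zero ?_
    exact_mod_cast h _ ((intCast_mem_maxSet_iff _).mp h')
  rw [Rat.cast_def, div_eq_mul_inv]
  exact mul_mem (intCast_mem _ _) (by exact_mod_cast h1)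

theorem ratCast_mem_maxSet_iff (h : IsHorizontal x) (q : ℚ) :
    (q : FF W) ∈ maxSet W x ↔ q = 0 := by
  constructor
  · intro hq
    by_contra hne
    refine inv_notMem_localRing hq (by exact_mod_cast hne) ?_
    rw [← Rat.cast_inv]
    exact ratCast_mem_localRing h _
  · rintro rfl
    simpa using zero_mem_maxSet

/-! ### Generators of the maximal ideal -/

/-- `t` generates the maximal ideal of the local ring at `x`. -/
def IsUniformizer (x : scheme W) (t : FF W) : Prop :=
  t ∈ maxSet W x ∧ ∀ r ∈ maxSet W x, ∃ s ∈ localRing W x, r = s * t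

theorem IsUniformizer.exists_span {t : FF W} (ht : IsUniformizer x t) :
    ∃ t' : (scheme W).presheaf.stalk x,
      IsLocalRing.maximalIdeal ((scheme W).presheaf.stalk x) = Ideal.span {t'} ∧
      algebraMap ((scheme W).presheaf.stalk x) (FF W) t' = t := by
  obtain ⟨⟨t', ht', rfl⟩, h⟩ := ht
  refine ⟨t', le_antisymm (fun r hr ↦ ?_) ((Ideal.span_singleton_le_iff_mem _).mpr ht'), rfl⟩
  obtain ⟨_, ⟨s, rfl⟩, hs⟩ := h _ (algebraMap_mem_maxSet.mpr hr)
  rw [← map_mul] at hs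
  exact Ideal.mem_span_singleton'.mpr ⟨s, (stalk_injective W x hs).symm⟩

theorem isUniformizer_of_span {t : (scheme W).presheaf.stalk x}
    (ht : IsLocalRing.maximalIdeal ((scheme W).presheaf.stalk x) = Ideal.span {t}) :
    IsUniformizer x (algebraMap ((scheme W).presheaf.stalk x) (FF W) t) := by
  refine ⟨algebraMap_mem_maxSet.mpr (ht ▸ Ideal.mem_span_singleton_self t), ?_⟩
  rintro _ ⟨r, hr, rfl⟩
  rw [SetLike.mem_coe, ht, Ideal.mem_span_singleton'] at hr
  obtain ⟨s, rfl⟩ := hr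
  exact ⟨_, algebraMap_mem_localRing s, map_mul _ _ _⟩

end WeierstrassModel

namespace WeierstrassModel

variable {W : WeierstrassCurve ℤ} {x : scheme W}

/-! ### Affine charts -/

theorem dehom_X (i : Fin 3) : dehom W (toCoordRing W (MvPolynomial.X i)) = affineCoord W i := by
  rw [dehom_toCoordRing, MvPolynomial.aeval_X]

/-- The coordinate functions `Xᵢ / Xⱼ` of the chart `Xⱼ ≠ 0`. -/
noncomputable def chart (W : WeierstrassCurve ℤ) (j i : Fin 3) : FF W :=
  affineCoord W i / affineCoord W j

theorem affineCoord_ne_zero {j : Fin 3} (hj : toCoordRing W (MvPolynomial.X j) ∉ idealOf W x) :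
    affineCoord W j ≠ 0 := by
  rw [← dehom_X]
  exact dehom_ne_zero W (mem_grading W (MvPolynomial.isHomogeneous_X ℤ j)) hj

theorem chart_mem_localRing {j : Fin 3} (hj : toCoordRing W (MvPolynomial.X j) ∉ idealOf W x)
    (i : Fin 3) : chart W j i ∈ localRing W x := by
  rw [chart, ← dehom_X, ← dehom_X]
  exact dehom_div_mem_localRing (mem_grading W (MvPolynomial.isHomogeneous_X ℤ i))
    (mem_grading W (MvPolynomial.isHomogeneous_X ℤ j)) hj

theorem aeval_chart {j : Fin 3} (hj : affineCoord W j ≠ 0) {G : MvPolynomial (Fin 3) ℤ} {d : ℕ}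
    (hG : G.IsHomogeneous d) :
    MvPolynomial.aeval (chart W j) G = dehom W (toCoordRing W G) / affineCoord W j ^ d := by
  have h : affineCoord W = fun i ↦ affineCoord W j * chart W j i := by
    funext i
    rw [chart, mul_div_cancel₀ _ hj]
  rw [dehom_toCoordRing, eq_div_iff (pow_ne_zero _ hj)]
  conv_rhs => rw [h]
  rw [MvPolynomial.aeval_def, MvPolynomial.aeval_def,
    eval₂_smul_of_isHomogeneous (A := FF W) _ hG, mul_comm]

theorem aeval_chart_mem_maxSet_iff {j : Fin 3}
    (hj : toCoordRing W (MvPolynomial.X j) ∉ idealOf W x) {G : MvPolynomial (Fin 3) ℤ} {d : ℕ}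
    (hG : G.IsHomogeneous d) :
    MvPolynomial.aeval (chart W j) G ∈ maxSet W x ↔ toCoordRing W G ∈ idealOf W x := by
  have hX := (MvPolynomial.isHomogeneous_X ℤ j).pow d
  rw [one_mul] at hX
  have h : toCoordRing W (MvPolynomial.X j ^ d) ∉ idealOf W x := fun h ↦ hj (by
    rw [map_pow] at h; exact (idealOf_isPrime W x).mem_of_pow_mem _ h)
  rw [← dehom_div_mem_maxSet_iff (mem_grading W hG) (mem_grading W hX) h,
    aeval_chart (affineCoord_ne_zero hj) hG, map_pow, map_pow, dehom_X]

theorem aeval_mem_localRing {v : Fin 3 → FF W} (hv : ∀ i, v i ∈ localRing W x)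
    (G : MvPolynomial (Fin 3) ℤ) : MvPolynomial.aeval v G ∈ localRing W x := by
  induction G using MvPolynomial.induction_on with
  | C a => simp [intCast_mem]
  | add p q hp hq => rw [map_add]; exact add_mem hp hq
  | mul_X p i hp => rw [map_mul, MvPolynomial.aeval_X]; exact mul_mem hp (hv i)

theorem exists_eq_aeval_chart_div {j : Fin 3}
    (hj : toCoordRing W (MvPolynomial.X j) ∉ idealOf W x) {r : FF W} (hr : r ∈ localRing W x) :
    ∃ d, ∃ G H : MvPolynomial (Fin 3) ℤ, G.IsHomogeneous d ∧ H.IsHomogeneous d ∧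
      MvPolynomial.aeval (chart W j) H ∉ maxSet W x ∧
      r = MvPolynomial.aeval (chart W j) G / MvPolynomial.aeval (chart W j) H := by
  obtain ⟨d, _, ⟨G, hG, rfl⟩, _, ⟨H, hH, rfl⟩, hx, rfl⟩ := exists_eq_dehom_div hr
  refine ⟨d, G, H, hG, hH, (aeval_chart_mem_maxSet_iff hj hH).not.mpr hx, ?_⟩
  have h0 := affineCoord_ne_zero hj
  rw [aeval_chart h0 hG, aeval_chart h0 hH, div_div_div_cancel_right₀ (pow_ne_zero _ h0)]
  rfl

theorem exists_coord_notMem (x : scheme W) :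
    toCoordRing W (MvPolynomial.X 2) ∉ idealOf W x ∨
      (toCoordRing W (MvPolynomial.X 0) ∈ idealOf W x ∧
        toCoordRing W (MvPolynomial.X 2) ∈ idealOf W x ∧
        toCoordRing W (MvPolynomial.X 1) ∉ idealOf W x) := by
  by_cases hZ : toCoordRing W (MvPolynomial.X 2) ∈ idealOf W x
  · right
    have hF : toCoordRing W W.toProjective.polynomial = 0 :=
      (toCoordRing_eq_zero_iff W).mpr dvd_rfl
    have hX : toCoordRing W (MvPolynomial.X 0) ∈ idealOf W x := by
      refine (idealOf_isPrime W x).mem_of_pow_mem 3 ?_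
      have h : (MvPolynomial.X 0 ^ 3 : MvPolynomial (Fin 3) ℤ) =
          (MvPolynomial.X 1 ^ 2 + MvPolynomial.C W.a₁ * MvPolynomial.X 0 * MvPolynomial.X 1 +
            MvPolynomial.C W.a₃ * MvPolynomial.X 1 * MvPolynomial.X 2 -
            MvPolynomial.C W.a₂ * MvPolynomial.X 0 ^ 2 -
            MvPolynomial.C W.a₄ * MvPolynomial.X 0 * MvPolynomial.X 2 -
            MvPolynomial.C W.a₆ * MvPolynomial.X 2 ^ 2) * MvPolynomial.X 2 -
          W.toProjective.polynomial := by
        unfold WeierstrassCurve.Projective.polynomial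
        ring
      rw [← map_pow, h, map_sub, hF, sub_zero, map_mul]
      exact Ideal.mul_mem_left _ _ hZ
    refine ⟨hX, hZ, fun hY ↦ ?_⟩
    refine (show ProjectiveSpectrum (grading W) from x).not_irrelevant_le ?_
    refine (HomogeneousIdeal.irrelevant_le _).mpr ?_
    rintro d hd _ ⟨G, hG, rfl⟩
    have h1 : G ∈ Ideal.span (MvPolynomial.X '' (Set.univ : Set (Fin 3))) := by
      refine MvPolynomial.mem_ideal_span_X_image.mpr fun m hm ↦ ?_
      by_contra! h0
      have hd' : m.degree = d := by
        by_contra h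
        exact MvPolynomial.mem_support_iff.mp hm (MvPolynomial.IsHomogeneous.coeff_eq_zero hG h)
      rw [Finsupp.degree_eq_sum, Finset.sum_eq_zero fun i _ ↦ h0 i trivial] at hd'
      omega
    have h2 : Ideal.span (MvPolynomial.X '' (Set.univ : Set (Fin 3))) ≤
        (idealOf W x).comap (toCoordRing W) := by
      rw [Ideal.span_le]
      rintro _ ⟨i, -, rfl⟩
      fin_cases i
      exacts [hX, hY, hZ]
    exact h2 h1
  · exact Or.inl hZ

/-! ### The Weierstrass equation and the Néron differential -/

variable (W)

/-- The partial derivative `2y + a₁x + a₃` of the Weierstrass equation. -/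
noncomputable def derivY : FF W :=
  2 * affineCoord W 1 + (W.a₁ : FF W) * affineCoord W 0 + (W.a₃ : FF W)

/-- The negative `3x² + 2a₂x + a₄ - a₁y` of the partial derivative of the Weierstrass equation with
respect to `x`. -/
noncomputable def derivX : FF W :=
  3 * affineCoord W 0 ^ 2 + 2 * (W.a₂ : FF W) * affineCoord W 0 + (W.a₄ : FF W) -
    (W.a₁ : FF W) * affineCoord W 1

theorem affine_equation : affineCoord W 1 ^ 2 + (W.a₁ : FF W) * affineCoord W 0 * affineCoord W 1 +
    (W.a₃ : FF W) * affineCoord W 1 = affineCoord W 0 ^ 3 + (W.a₂ : FF W) * affineCoord W 0 ^ 2 +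
      (W.a₄ : FF W) * affineCoord W 0 + (W.a₆ : FF W) := by
  have h := aeval_affineCoord_polynomial W
  unfold WeierstrassCurve.Projective.polynomial at h
  simp only [map_sub, map_add, map_mul, map_pow, MvPolynomial.aeval_X, MvPolynomial.aeval_C,
    affineCoord_two, algebraMap_int_eq, Int.coe_castRingHom] at h
  linear_combination h

/-- The form `2Y + a₁X + a₃Z`. -/
noncomputable def formY : MvPolynomial (Fin 3) ℤ :=
  MvPolynomial.C 2 * MvPolynomial.X 1 + MvPolynomial.C W.a₁ * MvPolynomial.X 0 +
    MvPolynomial.C W.a₃ * MvPolynomial.X 2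

/-- The form `3X² + 2a₂XZ + a₄Z² - a₁YZ`. -/
noncomputable def formX : MvPolynomial (Fin 3) ℤ :=
  MvPolynomial.C 3 * MvPolynomial.X 0 ^ 2 +
    MvPolynomial.C (2 * W.a₂) * (MvPolynomial.X 0 * MvPolynomial.X 2) +
    MvPolynomial.C W.a₄ * MvPolynomial.X 2 ^ 2 -
    MvPolynomial.C W.a₁ * (MvPolynomial.X 1 * MvPolynomial.X 2)

theorem formY_isHomogeneous : (formY W).IsHomogeneous 1 := by
  have hX (i : Fin 3) := MvPolynomial.isHomogeneous_X ℤ i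
  exact (((hX 1).C_mul _).add ((hX 0).C_mul _)).add ((hX 2).C_mul _)

theorem formX_isHomogeneous : (formX W).IsHomogeneous 2 := by
  have hX (i : Fin 3) := MvPolynomial.isHomogeneous_X ℤ i
  exact (((((hX 0).pow 2).C_mul _).add (((hX 0).mul (hX 2)).C_mul _)).add
    (((hX 2).pow 2).C_mul _)).sub (((hX 1).mul (hX 2)).C_mul _)

theorem dehom_formY : dehom W (toCoordRing W (formY W)) = derivY W := by
  rw [dehom_toCoordRing]
  simp [formY, derivY, affineCoord_two]

theorem dehom_formX : dehom W (toCoordRing W (formX W)) = derivX W := by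
  rw [dehom_toCoordRing]
  simp [formX, derivX, affineCoord_two]

theorem derivY_ne_zero : derivY W ≠ 0 := by
  rw [← dehom_formY]
  intro h
  have h1 := dehom_eq_zero W (mem_grading W (formY_isHomogeneous W)) h
  have h2 := eq_zero_of_toCoordRing_eq_zero W (formY_isHomogeneous W) (by norm_num) h1
  have h3 := congrArg (MvPolynomial.eval ![0, 1, 0]) h2
  simp [formY] at h3

/-- The universal derivation of the function field. -/
noncomputable abbrev dd : Derivation ℤ (FF W) (RationalDifferential (scheme W)) :=
  KaehlerDifferential.D ℤ (FF W)

theorem dd_intCast (n : ℤ) : dd W (n : FF W) = 0 := (dd W).map_algebraMap n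

theorem dd_x : dd W (affineCoord W 0) = derivY W • neronDifferential W := by
  change _ = derivY W • (derivY W)⁻¹ • dd W (affineCoord W 0)
  rw [smul_smul, mul_inv_cancel₀ (derivY_ne_zero W), one_smul]

theorem derivY_smul_dd_y : derivY W • dd W (affineCoord W 1) = derivX W • dd W (affineCoord W 0) := by
  have h := congrArg (dd W) (affine_equation W)
  simp only [map_add, Derivation.leibniz, Derivation.leibniz_pow, dd_intCast] at h
  rw [derivY, derivX]
  linear_combination (norm := module) h

theorem dd_y : dd W (affineCoord W 1) = derivX W • neronDifferential W := by
  have h := derivY_smul_dd_y W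
  rw [dd_x, smul_comm] at h
  exact smul_right_injective _ (derivY_ne_zero W) h

end WeierstrassModel

namespace WeierstrassModel

variable {W : WeierstrassCurve ℤ} {x : scheme W}

/-! ### Generation of the differentials by the Néron differential -/

theorem IsRegularAt.add {α β : RationalDifferential (scheme W)} (hα : IsRegularAt (scheme W) α x)
    (hβ : IsRegularAt (scheme W) β x) : IsRegularAt (scheme W) (α + β) x :=
  add_mem (S := Submodule ((scheme W).presheaf.stalk x) _) hα hβ

theorem IsRegularAt.smul {α : RationalDifferential (scheme W)} (hα : IsRegularAt (scheme W) α x)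
    {r : FF W} (hr : r ∈ localRing W x) : IsRegularAt (scheme W) (r • α) x := by
  obtain ⟨s, rfl⟩ := hr
  have h : algebraMap ((scheme W).presheaf.stalk x) (FF W) s • α = s • α := algebraMap_smul _ _ _
  rw [h]
  exact Submodule.smul_mem _ s hα

theorem isRegularAt_zero : IsRegularAt (scheme W) 0 x :=
  zero_mem (S := Submodule ((scheme W).presheaf.stalk x) _) _

theorem IsRegularAt.neg {α : RationalDifferential (scheme W)} (hα : IsRegularAt (scheme W) α x) :
    IsRegularAt (scheme W) (-α) x :=
  neg_mem (S := Submodule ((scheme W).presheaf.stalk x) _) hα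

theorem isRegularAt_dd {r : FF W} (hr : r ∈ localRing W x) :
    IsRegularAt (scheme W) (dd W r) x := by
  obtain ⟨s, rfl⟩ := hr
  exact ⟨KaehlerDifferential.D ℤ _ s, KaehlerDifferential.map_D _ _ _ _ s⟩

/-- The elements of the local ring at `x` whose differential is a multiple of the Néron differential
by an element of the local ring. -/
noncomputable def derivSubring (x : scheme W) : Subring (FF W) where
  carrier := {r | r ∈ localRing W x ∧ ∃ c ∈ localRing W x, dd W r = c • neronDifferential W}
  zero_mem' := ⟨zero_mem _, 0, zero_mem _, by rw [map_zero, zero_smul]⟩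
  one_mem' := ⟨one_mem _, 0, zero_mem _, by rw [Derivation.map_one_eq_zero, zero_smul]⟩
  add_mem' := by
    rintro r s ⟨hr, c, hc, hrc⟩ ⟨hs, e, he, hse⟩
    exact ⟨add_mem hr hs, c + e, add_mem hc he, by rw [map_add, hrc, hse, add_smul]⟩
  neg_mem' := by
    rintro r ⟨hr, c, hc, hrc⟩
    exact ⟨neg_mem hr, -c, neg_mem hc, by rw [map_neg, hrc, neg_smul]⟩
  mul_mem' := by
    rintro r s ⟨hr, c, hc, hrc⟩ ⟨hs, e, he, hse⟩
    refine ⟨mul_mem hr hs, r * e + s * c, add_mem (mul_mem hr he) (mul_mem hs hc), ?_⟩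
    rw [Derivation.leibniz, hrc, hse, smul_smul, smul_smul, add_smul]

theorem inv_mem_derivSubring {r : FF W} (hr : r ∈ derivSubring x) (h : r ∉ maxSet W x) :
    r⁻¹ ∈ derivSubring x := by
  obtain ⟨hr, c, hc, hrc⟩ := hr
  have hi := inv_mem_localRing hr h
  refine ⟨hi, -(r⁻¹ ^ 2) * c, mul_mem (neg_mem (pow_mem hi 2)) hc, ?_⟩
  rw [Derivation.leibniz_inv, hrc, smul_smul]

/-- If the coordinate functions of a chart around `x` belong to the subring of elements whose
differential is an integral multiple of `ω`, then so does the whole local ring. -/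
theorem localRing_le_derivSubring {j : Fin 3}
    (hj : toCoordRing W (MvPolynomial.X j) ∉ idealOf W x)
    (h : ∀ i, chart W j i ∈ derivSubring x) {r : FF W} (hr : r ∈ localRing W x) :
    r ∈ derivSubring x := by
  have key (G : MvPolynomial (Fin 3) ℤ) : MvPolynomial.aeval (chart W j) G ∈ derivSubring x := by
    induction G using MvPolynomial.induction_on with
    | C a => simp [intCast_mem]
    | add p q hp hq => rw [map_add]; exact add_mem hp hq
    | mul_X p i hp => rw [map_mul, MvPolynomial.aeval_X]; exact mul_mem hp (h i)
  obtain ⟨d, G, H, -, -, hH, rfl⟩ := exists_eq_aeval_chart_div hj hr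
  rw [div_eq_mul_inv]
  exact mul_mem (key G) (inv_mem_derivSubring (key H) hH)

theorem IsRegularAt.exists_smul (h : ∀ r ∈ localRing W x, r ∈ derivSubring x)
    {α : RationalDifferential (scheme W)} (hα : IsRegularAt (scheme W) α x) :
    ∃ c ∈ localRing W x, α = c • neronDifferential W := by
  obtain ⟨β, rfl⟩ := hα
  have hβ : β ∈ Submodule.span ((scheme W).presheaf.stalk x)
      (Set.range (KaehlerDifferential.D ℤ ((scheme W).presheaf.stalk x))) := by
    rw [KaehlerDifferential.span_range_derivation]; trivial
  induction hβ using Submodule.span_induction with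
  | mem β hβ =>
    obtain ⟨s, rfl⟩ := hβ
    rw [KaehlerDifferential.map_D]
    exact (h _ (algebraMap_mem_localRing s)).2
  | zero => exact ⟨0, zero_mem _, by rw [map_zero, zero_smul]⟩
  | add β γ _ _ h1 h2 =>
    obtain ⟨c, hc, h1⟩ := h1
    obtain ⟨e, he, h2⟩ := h2
    exact ⟨c + e, add_mem hc he, by rw [map_add, h1, h2, add_smul]⟩
  | smul s β _ h1 =>
    obtain ⟨c, hc, h1⟩ := h1
    refine ⟨algebraMap _ _ s * c, mul_mem (algebraMap_mem_localRing s) hc, ?_⟩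
    rw [map_smul, h1, mul_smul, algebraMap_smul]

/-- The module of differentials of the local ring at `x` is generated by `ω`, in the sense that its
image in the rational differentials is the set of multiples of `ω` by elements of the local ring. This
is expressed by generators: the differentials of the elements of the local ring are such multiples, and
`ω` is regular. -/
def NeronGenerates (x : scheme W) : Prop :=
  (∀ r ∈ localRing W x, r ∈ derivSubring x) ∧ IsRegularAt (scheme W) (neronDifferential W) x

theorem neronGenerates_of_notMem {j : Fin 3}
    (hj : toCoordRing W (MvPolynomial.X j) ∉ idealOf W x)
    (h : ∀ i, chart W j i ∈ derivSubring x) {i : Fin 3} {c : FF W} (hc : c ∈ localRing W x)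
    (hcm : c ∉ maxSet W x) (hi : dd W (chart W j i) = c • neronDifferential W) :
    NeronGenerates x := by
  refine ⟨fun r hr ↦ localRing_le_derivSubring hj h hr, ?_⟩
  have h0 : c ≠ 0 := by rintro rfl; exact hcm zero_mem_maxSet
  have h1 := (isRegularAt_dd (chart_mem_localRing hj i)).smul (inv_mem_localRing hc hcm)
  rwa [hi, smul_smul, inv_mul_cancel₀ h0, one_smul] at h1

theorem chart_two (i : Fin 3) : chart W 2 i = affineCoord W i := by
  rw [chart, affineCoord_two, div_one]

theorem x_mem_localRing (hZ : toCoordRing W (MvPolynomial.X 2) ∉ idealOf W x) (i : Fin 3) :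
    affineCoord W i ∈ localRing W x := chart_two (W := W) i ▸ chart_mem_localRing hZ i

theorem aeval_affineCoord (hZ : toCoordRing W (MvPolynomial.X 2) ∉ idealOf W x)
    {G : MvPolynomial (Fin 3) ℤ} {d : ℕ} (hG : G.IsHomogeneous d) :
    (dehom W (toCoordRing W G) ∈ localRing W x) ∧ 
    (dehom W (toCoordRing W G) ∈ maxSet W x ↔ toCoordRing W G ∈ idealOf W x) := by
  have h1 := aeval_mem_localRing (chart_mem_localRing hZ) G
  have h2 := aeval_chart_mem_maxSet_iff hZ hG
  rw [aeval_chart (affineCoord_ne_zero hZ) hG, affineCoord_two, one_pow, div_one] at h1 h2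
  exact ⟨h1, h2⟩

/-- At a point of the affine part at which the equation has a nonvanishing partial derivative, the
differentials are generated by `ω`. -/
theorem neronGenerates_affine (hZ : toCoordRing W (MvPolynomial.X 2) ∉ idealOf W x)
    (h : toCoordRing W (formX W) ∉ idealOf W x ∨ toCoordRing W (formY W) ∉ idealOf W x) :
    NeronGenerates x := by
  have hX := aeval_affineCoord hZ (formX_isHomogeneous W)
  have hY := aeval_affineCoord hZ (formY_isHomogeneous W)
  rw [dehom_formX] at hX
  rw [dehom_formY] at hY
  have h0 : ∀ i, chart W 2 i ∈ derivSubring x := by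
    intro i
    refine ⟨chart_mem_localRing hZ i, ?_⟩
    rw [chart_two]
    fin_cases i
    · exact ⟨_, hY.1, dd_x W⟩
    · exact ⟨_, hX.1, dd_y W⟩
    · exact ⟨0, zero_mem _, by simp [affineCoord_two]⟩
  rcases h with h | h
  · exact neronGenerates_of_notMem hZ h0 (i := 1) hX.1 (hX.2.not.mpr h) (chart_two (W := W) 1 ▸ dd_y W)
  · exact neronGenerates_of_notMem hZ h0 (i := 0) hY.1 (hY.2.not.mpr h) (chart_two (W := W) 0 ▸ dd_x W)

theorem mem_localRing_genPt (r : FF W) : r ∈ localRing W (genPt W) := by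
  obtain ⟨a, b, hb, rfl⟩ := IsFractionRing.div_surjective
    (A := (scheme W).presheaf.stalk (genPt W)) r
  rw [div_eq_mul_inv]
  refine mul_mem (algebraMap_mem_localRing a) (inv_mem_localRing (algebraMap_mem_localRing b) ?_)
  intro h
  obtain ⟨d, G, hG, H, hH, hx, he⟩ := exists_eq_dehom_div (algebraMap_mem_localRing b)
  rw [he, dehom_div_mem_maxSet_iff hG hH hx, idealOf_genPt, Ideal.mem_bot] at h
  rw [h, map_zero, zero_div] at he
  exact nonZeroDivisors.ne_zero hb (stalk_injective W _ (he.trans (map_zero _).symm))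

/-- Every rational differential is a multiple of the Néron differential. -/
theorem exists_eq_smul_neronDifferential (α : RationalDifferential (scheme W)) :
    ∃ f : FF W, α = f • neronDifferential W := by
  have hgen : NeronGenerates (genPt W) := by
    refine neronGenerates_affine (fun h ↦ Z_ne_zero W h) (Or.inr fun h ↦ ?_)
    refine derivY_ne_zero W ?_
    rw [← dehom_formY, Ideal.mem_bot.mp h, map_zero]
  have hα : α ∈ Submodule.span (FF W) (Set.range (KaehlerDifferential.D ℤ (FF W))) := by
    rw [KaehlerDifferential.span_range_derivation]; trivial
  induction hα using Submodule.span_induction with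
  | mem α hα =>
    obtain ⟨r, rfl⟩ := hα
    obtain ⟨-, c, -, hc⟩ := hgen.1 r (mem_localRing_genPt r)
    exact ⟨c, hc⟩
  | zero => exact ⟨0, by rw [zero_smul]⟩
  | add β γ _ _ h1 h2 =>
    obtain ⟨c, h1⟩ := h1
    obtain ⟨e, h2⟩ := h2
    exact ⟨c + e, by rw [h1, h2, add_smul]⟩
  | smul s β _ h1 =>
    obtain ⟨c, h1⟩ := h1
    exact ⟨s * c, by rw [h1, mul_smul]⟩

section Infinity

variable (W)

/-- The partial derivative with respect to `w = Z / Y` of the equation in the chart at infinity. -/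
noncomputable def derivW : FF W :=
  1 + (W.a₁ : FF W) * chart W 1 0 + 2 * (W.a₃ : FF W) * chart W 1 2 -
    (W.a₂ : FF W) * chart W 1 0 ^ 2 - 2 * (W.a₄ : FF W) * chart W 1 0 * chart W 1 2 -
    3 * (W.a₆ : FF W) * chart W 1 2 ^ 2

/-- The partial derivative with respect to `z = X / Y` of the equation in the chart at infinity. -/
noncomputable def derivZ : FF W :=
  (W.a₁ : FF W) * chart W 1 2 - 3 * chart W 1 0 ^ 2 -
    2 * (W.a₂ : FF W) * chart W 1 0 * chart W 1 2 - (W.a₄ : FF W) * chart W 1 2 ^ 2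

theorem y_ne_zero : affineCoord W 1 ≠ 0 := by
  rw [← dehom_X]
  intro h
  have hX := MvPolynomial.isHomogeneous_X ℤ (1 : Fin 3)
  have h1 := dehom_eq_zero W (mem_grading W hX) h
  exact MvPolynomial.X_ne_zero _ (eq_zero_of_toCoordRing_eq_zero W hX (by norm_num) h1)

theorem dd_chart_one_zero : dd W (chart W 1 0) = (-derivW W) • neronDifferential W := by
  have hy := y_ne_zero W
  rw [chart, div_eq_mul_inv, Derivation.leibniz, Derivation.leibniz_inv, dd_x, dd_y, smul_smul,
    smul_smul, smul_smul, ← add_smul]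
  congr 1
  rw [derivW, derivX, derivY, chart, chart, affineCoord_two]
  field_simp
  linear_combination 3 * affine_equation W

theorem dd_chart_one_two : dd W (chart W 1 2) = derivZ W • neronDifferential W := by
  have hy := y_ne_zero W
  rw [chart, affineCoord_two, one_div, Derivation.leibniz_inv, dd_y, smul_smul]
  congr 1
  rw [derivX, derivZ, chart, chart, affineCoord_two]
  field_simp
  ring

variable {W}

/-- At the points with `Z = 0` the differentials are generated by `ω`, because `dz` is a unit times `ω`
for the coordinate `z = X / Y`. -/
theorem neronGenerates_infinity (hX : toCoordRing W (MvPolynomial.X 0) ∈ idealOf W x)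
    (hZ : toCoordRing W (MvPolynomial.X 2) ∈ idealOf W x)
    (hY : toCoordRing W (MvPolynomial.X 1) ∉ idealOf W x) :
    NeronGenerates x := by
  have hl := chart_mem_localRing hY
  have hz : chart W 1 0 ∈ maxSet W x := by
    have h := aeval_chart_mem_maxSet_iff hY (MvPolynomial.isHomogeneous_X ℤ 0)
    rw [MvPolynomial.aeval_X] at h
    exact h.mpr hX
  have hw : chart W 1 2 ∈ maxSet W x := by
    have h := aeval_chart_mem_maxSet_iff hY (MvPolynomial.isHomogeneous_X ℤ 2)
    rw [MvPolynomial.aeval_X] at h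
    exact h.mpr hZ
  have hn (n : ℤ) : (n : FF W) ∈ localRing W x := intCast_mem _ n
  have hWm : derivW W - 1 ∈ maxSet W x := by
    rw [show derivW W - 1 = ((W.a₁ : FF W) - (W.a₂ : FF W) * chart W 1 0) * chart W 1 0 +
      (((2 * W.a₃ : ℤ) : FF W) - ((2 * W.a₄ : ℤ) : FF W) * chart W 1 0 -
        ((3 * W.a₆ : ℤ) : FF W) * chart W 1 2) * chart W 1 2 by
          rw [derivW]; push_cast; ring]
    exact add_mem_maxSet (mul_mem_maxSet (sub_mem (hn _) (mul_mem (hn _) (hl 0))) hz)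
      (mul_mem_maxSet (sub_mem (sub_mem (hn _) (mul_mem (hn _) (hl 0))) (mul_mem (hn _) (hl 2))) hw)
  have hWl : derivW W ∈ localRing W x := by
    rw [← sub_add_cancel (derivW W) 1]
    exact add_mem (mem_localRing_of_mem_maxSet hWm) (one_mem _)
  have hZl : derivZ W ∈ localRing W x := by
    rw [show derivZ W = (W.a₁ : FF W) * chart W 1 2 - ((3 : ℤ) : FF W) * chart W 1 0 ^ 2 -
      ((2 * W.a₂ : ℤ) : FF W) * chart W 1 0 * chart W 1 2 - (W.a₄ : FF W) * chart W 1 2 ^ 2 by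
        rw [derivZ]; push_cast; ring]
    exact sub_mem (sub_mem (sub_mem (mul_mem (hn _) (hl 2)) (mul_mem (hn _) (pow_mem (hl 0) 2)))
      (mul_mem (mul_mem (hn _) (hl 0)) (hl 2))) (mul_mem (hn _) (pow_mem (hl 2) 2))
  refine neronGenerates_of_notMem hY ?_ (i := 0) (neg_mem hWl) ?_ (dd_chart_one_zero W)
  · intro i
    refine ⟨hl i, ?_⟩
    fin_cases i
    · exact ⟨_, neg_mem hWl, dd_chart_one_zero W⟩
    · refine ⟨0, zero_mem _, ?_⟩
      change dd W (chart W 1 1) = _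
      rw [chart, div_self (y_ne_zero W), Derivation.map_one_eq_zero, zero_smul]
    · exact ⟨_, hZl, dd_chart_one_two W⟩
  · intro h
    refine one_notMem_maxSet (x := x) ?_
    rw [show (1 : FF W) = - (derivW W - 1) - -derivW W by ring]
    exact sub_mem_maxSet (neg_mem_maxSet hWm) h

end Infinity

end WeierstrassModel

namespace WeierstrassModel

variable (W : WeierstrassCurve ℤ)

/-! ### The affine coordinate ring of the generic fibre -/

/-- The affine coordinate ring of the generic fibre. -/
abbrev AffineRing : Type := (W.baseChange ℚ).toAffine.CoordinateRing

/-- The coordinate function `x`. -/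
noncomputable def affX : AffineRing W :=
  WeierstrassCurve.Affine.CoordinateRing.mk _ (Polynomial.C Polynomial.X)

/-- The coordinate function `y`. -/
noncomputable def affY : AffineRing W :=
  WeierstrassCurve.Affine.CoordinateRing.mk _ Polynomial.X

theorem map_affine_polynomial {A : Type*} [CommRing A] (g : Polynomial (Polynomial ℚ) →+* A) :
    g (W.baseChange ℚ).toAffine.polynomial =
      g Polynomial.X ^ 2 + (W.a₁ : A) * g (Polynomial.C Polynomial.X) * g Polynomial.X +
        (W.a₃ : A) * g Polynomial.X - (g (Polynomial.C Polynomial.X) ^ 3 +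
        (W.a₂ : A) * g (Polynomial.C Polynomial.X) ^ 2 +
        (W.a₄ : A) * g (Polynomial.C Polynomial.X) + (W.a₆ : A)) := by
  have h (n : ℤ) : Polynomial.C (Polynomial.C (algebraMap ℤ ℚ n)) =
      (n : Polynomial (Polynomial ℚ)) := by simp
  have h' : (W.baseChange ℚ).toAffine.polynomial = Polynomial.X ^ 2 +
      (W.a₁ : Polynomial (Polynomial ℚ)) * Polynomial.C Polynomial.X * Polynomial.X +
      (W.a₃ : Polynomial (Polynomial ℚ)) * Polynomial.X - (Polynomial.C Polynomial.X ^ 3 +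
      (W.a₂ : Polynomial (Polynomial ℚ)) * Polynomial.C Polynomial.X ^ 2 +
      (W.a₄ : Polynomial (Polynomial ℚ)) * Polynomial.C Polynomial.X +
      (W.a₆ : Polynomial (Polynomial ℚ))) := by
    rw [← h, ← h, ← h, ← h, ← h]
    simp only [WeierstrassCurve.Affine.polynomial, WeierstrassCurve.baseChange,
      WeierstrassCurve.map, map_add, map_mul, map_pow]
    ring
  rw [h']
  simp only [map_add, map_sub, map_mul, map_pow, map_intCast]

theorem affine_polynomial_eval₂ {A : Type*} [CommRing A] [Algebra ℚ A] (a b : A) :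
    Polynomial.eval₂ (Polynomial.aeval (R := ℚ) a).toRingHom b
      (W.baseChange ℚ).toAffine.polynomial =
    b ^ 2 + (W.a₁ : A) * a * b + (W.a₃ : A) * b -
      (a ^ 3 + (W.a₂ : A) * a ^ 2 + (W.a₄ : A) * a + (W.a₆ : A)) := by
  have h := map_affine_polynomial W
    (Polynomial.eval₂RingHom (Polynomial.aeval (R := ℚ) a).toRingHom b)
  have hX : (Polynomial.aeval (R := ℚ) a).toRingHom Polynomial.X = a := Polynomial.aeval_X a
  simpa only [Polynomial.coe_eval₂RingHom, Polynomial.eval₂_X, Polynomial.eval₂_C, hX] using h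

theorem affine_equation_affineRing : affY W ^ 2 + (W.a₁ : AffineRing W) * affX W * affY W +
    (W.a₃ : AffineRing W) * affY W - (affX W ^ 3 + (W.a₂ : AffineRing W) * affX W ^ 2 +
      (W.a₄ : AffineRing W) * affX W + (W.a₆ : AffineRing W)) = 0 :=
  (map_affine_polynomial W (WeierstrassCurve.Affine.CoordinateRing.mk _)).symm.trans
    AdjoinRoot.mk_self

/-- A homomorphism from the affine coordinate ring of the generic fibre is given by a solution of the
Weierstrass equation. -/
noncomputable def affineLift {A : Type*} [CommRing A] [Algebra ℚ A] (a b : A)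
    (h : b ^ 2 + (W.a₁ : A) * a * b + (W.a₃ : A) * b -
      (a ^ 3 + (W.a₂ : A) * a ^ 2 + (W.a₄ : A) * a + (W.a₆ : A)) = 0) : AffineRing W →+* A :=
  AdjoinRoot.lift (Polynomial.aeval (R := ℚ) a).toRingHom b
    ((affine_polynomial_eval₂ W a b).trans h)

variable {W} in
theorem affineLift_mk {A : Type*} [CommRing A] [Algebra ℚ A] {a b : A}
    (h : b ^ 2 + (W.a₁ : A) * a * b + (W.a₃ : A) * b -
      (a ^ 3 + (W.a₂ : A) * a ^ 2 + (W.a₄ : A) * a + (W.a₆ : A)) = 0) (p : Polynomial (Polynomial ℚ)) :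
    affineLift W a b h (WeierstrassCurve.Affine.CoordinateRing.mk _ p) =
      Polynomial.eval₂ (Polynomial.aeval (R := ℚ) a).toRingHom b p :=
  AdjoinRoot.lift_mk _ _

/-- The embedding of the affine coordinate ring into the function field. -/
noncomputable def affineToFF : AffineRing W →+* FF W :=
  affineLift W (affineCoord W 0) (affineCoord W 1) (by linear_combination affine_equation W)

theorem affineToFF_X : affineToFF W (affX W) = affineCoord W 0 := by
  rw [affX, affineToFF, affineLift_mk]; simp

theorem affineToFF_Y : affineToFF W (affY W) = affineCoord W 1 := by
  rw [affY, affineToFF, affineLift_mk]; simp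

/-- Dehomogenization with values in the affine coordinate ring. -/
noncomputable def dehomAffine : CoordRing W →ₐ[ℤ] AffineRing W :=
  Ideal.Quotient.liftₐ _ (MvPolynomial.aeval ![affX W, affY W, 1]) fun G hG ↦ by
    obtain ⟨H, rfl⟩ := Ideal.mem_span_singleton.mp hG
    rw [map_mul]
    convert zero_mul _
    have := affine_equation_affineRing W
    unfold WeierstrassCurve.Projective.polynomial
    simp
    linear_combination this

theorem affineToFF_dehomAffine (G : CoordRing W) :
    affineToFF W (dehomAffine W G) = dehom W G := by
  obtain ⟨G, rfl⟩ := toCoordRing_surjective W G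
  rw [dehom_toCoordRing]
  change affineToFF W (MvPolynomial.aeval ![affX W, affY W, 1] G) = _
  rw [MvPolynomial.aeval_def, MvPolynomial.aeval_def, algebraMap_int_eq,
    RingHom.eq_intCast' (algebraMap ℤ (AffineRing W)), map_eval₂_int (A := AffineRing W) (B := FF W)]
  congr 1
  funext i
  fin_cases i
  · exact affineToFF_X W
  · exact affineToFF_Y W
  · exact (map_one _).trans (affineCoord_two W).symm

/-- The elements of the affine coordinate ring with a multiple that is the dehomogenization of a form
over `ℤ`; see `exists_form`. -/
noncomputable def formSubring : Subring (AffineRing W) where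
  carrier := {a | ∃ N : ℤ, N ≠ 0 ∧ ∃ d, ∃ G ∈ grading W d, N * a = dehomAffine W G}
  zero_mem' := ⟨1, one_ne_zero, 0, 0, zero_mem _, by simp⟩
  one_mem' := ⟨1, one_ne_zero, 0, 1, SetLike.GradedOne.one_mem, by simp⟩
  neg_mem' := by
    rintro a ⟨N, hN, d, G, hG, h⟩
    exact ⟨N, hN, d, -G, neg_mem hG, by rw [map_neg, ← h]; ring⟩
  mul_mem' := by
    rintro a b ⟨N, hN, d, G, hG, h⟩ ⟨N', hN', d', G', hG', h'⟩
    refine ⟨N * N', mul_ne_zero hN hN', _, G * G', SetLike.mul_mem_graded hG hG', ?_⟩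
    rw [map_mul, ← h, ← h']
    push_cast
    ring
  add_mem' := by
    rintro a b ⟨N, hN, d, G, hG, h⟩ ⟨N', hN', d', G', hG', h'⟩
    have hZ (e : ℕ) : toCoordRing W (MvPolynomial.X 2) ^ e ∈ grading W e := by
      have := mem_grading W ((MvPolynomial.isHomogeneous_X ℤ (2 : Fin 3)).pow e)
      rwa [one_mul, map_pow] at this
    have hZ1 : dehomAffine W (toCoordRing W (MvPolynomial.X 2)) = 1 := by
      change MvPolynomial.aeval ![affX W, affY W, 1] (MvPolynomial.X 2) = 1
      rw [MvPolynomial.aeval_X]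
      rfl
    have h1 : (N' : CoordRing W) * (toCoordRing W (MvPolynomial.X 2) ^ d' * G) ∈
        grading W (d' + d) := by
      have := SetLike.mul_mem_graded (intCast_mem_grading W N') (SetLike.mul_mem_graded (hZ d') hG)
      rwa [zero_add] at this
    have h2 : (N : CoordRing W) * (toCoordRing W (MvPolynomial.X 2) ^ d * G') ∈
        grading W (d' + d) := by
      have := SetLike.mul_mem_graded (intCast_mem_grading W N) (SetLike.mul_mem_graded (hZ d) hG')
      rwa [zero_add, add_comm d] at this
    refine ⟨N * N', mul_ne_zero hN hN', _, _, add_mem h1 h2, ?_⟩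
    simp only [map_add, map_mul, map_pow, hZ1, one_pow, map_intCast, ← h, ← h']
    push_cast
    ring

/-- Every element of the affine coordinate ring has a multiple that is the dehomogenization of a form
over `ℤ`. -/
theorem exists_form (a : AffineRing W) :
    ∃ N : ℤ, N ≠ 0 ∧ ∃ d, ∃ G ∈ grading W d, N * a = dehomAffine W G := by
  change a ∈ formSubring W
  have hcoord (i : Fin 3) : (![affX W, affY W, 1] : Fin 3 → AffineRing W) i ∈ formSubring W := by
    refine ⟨1, one_ne_zero, 1, toCoordRing W (MvPolynomial.X i),
      mem_grading W (MvPolynomial.isHomogeneous_X ℤ i), ?_⟩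
    change _ = MvPolynomial.aeval ![affX W, affY W, 1] (MvPolynomial.X i)
    rw [MvPolynomial.aeval_X, Int.cast_one, one_mul]
  obtain ⟨f, rfl⟩ := AdjoinRoot.mk_surjective a
  induction f using Polynomial.induction_on' with
  | add p q hp hq => rw [map_add]; exact add_mem hp hq
  | monomial n p =>
    rw [← Polynomial.C_mul_X_pow_eq_monomial, map_mul, map_pow]
    refine mul_mem ?_ (pow_mem (hcoord 1) n)
    induction p using Polynomial.induction_on' with
    | add p q hp hq => rw [map_add, map_add]; exact add_mem hp hq
    | monomial m q =>
      rw [← Polynomial.C_mul_X_pow_eq_monomial, map_mul, map_mul, map_pow, map_pow]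
      refine mul_mem ?_ (pow_mem (hcoord 0) m)
      refine ⟨q.den, by exact_mod_cast q.den_ne_zero, 0, (q.num : CoordRing W),
        intCast_mem_grading W q.num, ?_⟩
      rw [map_intCast, ← map_intCast (AdjoinRoot.mk (W.baseChange ℚ).toAffine.polynomial),
        ← map_intCast (AdjoinRoot.mk (W.baseChange ℚ).toAffine.polynomial), ← map_mul]
      congr 1
      have h : Polynomial.C (Polynomial.C ((q.den : ℤ) : ℚ)) * Polynomial.C (Polynomial.C q) =
          Polynomial.C (Polynomial.C (q.num : ℚ)) := by
        rw [← map_mul, ← map_mul]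
        congr 2
        exact_mod_cast q.den_mul_eq_num
      simpa only [map_intCast] using h

theorem affineToFF_injective : Function.Injective (affineToFF W) := by
  rw [injective_iff_map_eq_zero]
  intro a ha
  obtain ⟨N, hN, d, G, hG, h⟩ := exists_form W a
  have h1 : dehom W G = 0 := by
    rw [← affineToFF_dehomAffine, ← h, map_mul, ha, mul_zero]
  rw [dehom_eq_zero W hG h1, map_zero] at h
  have : (N : AffineRing W) ≠ 0 := by
    have h0 : CharZero (AffineRing W) := charZero_of_injective_algebraMap
      (FaithfulSMul.algebraMap_injective ℚ (AffineRing W))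
    exact_mod_cast hN
  exact (mul_eq_zero.mp h).resolve_left this

end WeierstrassModel

namespace WeierstrassModel

variable (W : WeierstrassCurve ℤ)

/-! ### Nonvanishing of the Néron differential -/

/-- The function field is an algebra over the affine coordinate ring. -/
noncomputable abbrev algebraAffineRing : Algebra (AffineRing W) (FF W) := (affineToFF W).toAlgebra

theorem isFractionRing_affineRing :
    let _ := algebraAffineRing W
    IsFractionRing (AffineRing W) (FF W) := by
  let _ := algebraAffineRing W
  have : FaithfulSMul (AffineRing W) (FF W) :=
    (faithfulSMul_iff_algebraMap_injective _ _).mpr (affineToFF_injective W)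
  refine IsFractionRing.of_field _ _ fun r ↦ ?_
  obtain ⟨d, G, hG, H, hH, hx, rfl⟩ := exists_eq_dehom_div (mem_localRing_genPt r)
  refine ⟨dehomAffine W G, dehomAffine W H, ?_⟩
  rw [← affineToFF_dehomAffine, ← affineToFF_dehomAffine]
  rfl

/-- The homomorphism from the affine coordinate ring to the dual numbers over the function field that
is given by a tangent vector to the curve. -/
noncomputable def affineToDual : AffineRing W →+* TrivSqZeroExt (FF W) (FF W) :=
  affineLift W (.inl (affineCoord W 0) + .inr (derivY W)) (.inl (affineCoord W 1) + .inr (derivX W))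
    (by
      have h := affine_equation W
      ext
      · simp
        linear_combination h
      · simp [derivX, derivY]
        ring)

theorem fst_affineToDual (a : AffineRing W) : (affineToDual W a).fst = affineToFF W a := by
  have h : (TrivSqZeroExt.fstHom (FF W) (FF W) (FF W)).toRingHom.comp (affineToDual W) =
      affineToFF W := by
    refine AdjoinRoot.ringHom_ext (Polynomial.ringHom_ext' (Subsingleton.elim _ _) ?_) ?_
    · change (affineToDual W (affX W)).fst = affineToFF W (affX W)
      rw [affineToFF_X, affX, affineToDual, affineLift_mk]
      simp
    · change (affineToDual W (affY W)).fst = affineToFF W (affY W)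
      rw [affineToFF_Y, affY, affineToDual, affineLift_mk]
      simp
  exact DFunLike.congr_fun h a

/-- The homomorphism from the function field to its dual numbers that is given by a tangent vector to
the curve. -/
noncomputable def toDual : FF W →+* TrivSqZeroExt (FF W) (FF W) :=
  letI := algebraAffineRing W
  haveI := isFractionRing_affineRing W
  IsLocalization.lift (M := nonZeroDivisors (AffineRing W)) (g := affineToDual W) fun a ↦ by
    rw [TrivSqZeroExt.isUnit_iff_isUnit_fst, fst_affineToDual, isUnit_iff_ne_zero]
    exact fun h ↦ nonZeroDivisors.ne_zero a.2
      (affineToFF_injective W (h.trans (map_zero _).symm))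

theorem toDual_affineToFF (a : AffineRing W) : toDual W (affineToFF W a) = affineToDual W a := by
  let _ := algebraAffineRing W
  have := isFractionRing_affineRing W
  exact IsLocalization.lift_eq (M := nonZeroDivisors (AffineRing W)) _ a

theorem fst_toDual (r : FF W) : (toDual W r).fst = r := by
  let _ := algebraAffineRing W
  have := isFractionRing_affineRing W
  have h : (TrivSqZeroExt.fstHom (FF W) (FF W) (FF W)).toRingHom.comp (toDual W) =
      RingHom.id (FF W) := by
    refine IsLocalization.ringHom_ext (nonZeroDivisors (AffineRing W)) ?_
    refine RingHom.ext fun a ↦ ?_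
    change (toDual W (affineToFF W a)).fst = affineToFF W a
    rw [toDual_affineToFF, fst_affineToDual]
  exact DFunLike.congr_fun h r

/-- The derivation of the function field that is dual to the Néron differential. -/
noncomputable def tangent : Derivation ℤ (FF W) (FF W) :=
  Derivation.mk' ((AddMonoidHom.mk' (fun r ↦ (toDual W r).snd) fun r s ↦ by
    rw [map_add, TrivSqZeroExt.snd_add]).toIntLinearMap) fun r s ↦ by
      change (toDual W (r * s)).snd = r • (toDual W s).snd + s • (toDual W r).snd
      rw [map_mul, TrivSqZeroExt.snd_mul, fst_toDual, fst_toDual, op_smul_eq_smul]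

theorem tangent_x : tangent W (affineCoord W 0) = derivY W := by
  change (toDual W (affineCoord W 0)).snd = _
  rw [← affineToFF_X, toDual_affineToFF, affX, affineToDual, affineLift_mk]
  simp

theorem neronDifferential_ne_zero : neronDifferential W ≠ 0 := by
  intro h
  have h1 := dd_x W
  rw [h, smul_zero] at h1
  have h2 := (tangent W).liftKaehlerDifferential_comp_D (affineCoord W 0)
  rw [h1, map_zero, tangent_x] at h2
  exact derivY_ne_zero W h2.symm

variable {W} {x : scheme W}

theorem isRegularAt_smul_iff (hx : NeronGenerates x) {f : FF W} :
    IsRegularAt (scheme W) (f • neronDifferential W) x ↔ f ∈ localRing W x := by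
  refine ⟨fun h ↦ ?_, fun h ↦ hx.2.smul h⟩
  obtain ⟨c, hc, hfc⟩ := h.exists_smul hx.1
  rwa [smul_left_injective _ (neronDifferential_ne_zero W) hfc]

end WeierstrassModel

namespace WeierstrassModel

variable {W : WeierstrassCurve ℤ} {x y : scheme W}

/-! ### Horizontal points of the affine part -/

theorem notMem_of_le (hyx : idealOf W y ≤ idealOf W x) {G : CoordRing W} (hG : G ∉ idealOf W x) :
    G ∉ idealOf W y := fun h ↦ hG (hyx h)

theorem localRing_le (hyx : idealOf W y ≤ idealOf W x) {r : FF W} (hr : r ∈ localRing W x) :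
    r ∈ localRing W y := by
  obtain ⟨d, G, hG, H, hH, hx, rfl⟩ := exists_eq_dehom_div hr
  exact dehom_div_mem_localRing hG hH (notMem_of_le hyx hx)

theorem mem_maxSet_of_le (hyx : idealOf W y ≤ idealOf W x) {r : FF W} (hr : r ∈ localRing W x)
    (hy : r ∈ maxSet W y) : r ∈ maxSet W x := by
  obtain ⟨d, G, hG, H, hH, hx, rfl⟩ := exists_eq_dehom_div hr
  rw [dehom_div_mem_maxSet_iff hG hH hx]
  exact hyx ((dehom_div_mem_maxSet_iff hG hH (notMem_of_le hyx hx)).mp hy)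

theorem IsHorizontal.of_le (hyx : idealOf W y ≤ idealOf W x) (hx : IsHorizontal x) :
    IsHorizontal y := fun n hn ↦ hx n (hyx hn)

theorem Δ_ne_zero (W : WeierstrassCurve ℤ) [(W.baseChange ℚ).IsElliptic] : W.Δ ≠ 0 := by
  have h := (W.baseChange ℚ).isUnit_Δ.ne_zero
  intro h0
  rw [WeierstrassCurve.baseChange, WeierstrassCurve.map_Δ, h0, map_zero] at h
  exact h rfl

/-- The generic fibre is nonsingular: at a horizontal point the two partial derivatives do not vanish
simultaneously. -/
theorem formX_or_formY_notMem [(W.baseChange ℚ).IsElliptic] (hx : IsHorizontal x)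
    (hZ : toCoordRing W (MvPolynomial.X 2) ∉ idealOf W x) :
    toCoordRing W (formX W) ∉ idealOf W x ∨ toCoordRing W (formY W) ∉ idealOf W x := by
  have hX := aeval_affineCoord hZ (formX_isHomogeneous W)
  have hY := aeval_affineCoord hZ (formY_isHomogeneous W)
  rw [← hX.2, ← hY.2, dehom_formX, dehom_formY]
  obtain ⟨a, ha⟩ := x_mem_localRing hZ 0
  obtain ⟨b, hb⟩ := x_mem_localRing hZ 1
  have := charZero_of_isHorizontal hx
  let κ := IsLocalRing.ResidueField ((scheme W).presheaf.stalk x)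
  let res := IsLocalRing.residue ((scheme W).presheaf.stalk x)
  let ι := algebraMap ((scheme W).presheaf.stalk x) (FF W)
  have hE : b ^ 2 + (W.a₁ : (scheme W).presheaf.stalk x) * a * b + W.a₃ * b =
      a ^ 3 + W.a₂ * a ^ 2 + W.a₄ * a + W.a₆ := by
    apply stalk_injective W x
    simp only [map_add, map_mul, map_pow, map_intCast, ha, hb]
    exact affine_equation W
  have hΔ : (W.map (Int.castRingHom κ)).toAffine.Δ ≠ 0 := by
    rw [WeierstrassCurve.map_Δ]
    simpa using Δ_ne_zero W
  have hns := (WeierstrassCurve.Affine.equation_iff_nonsingular_of_Δ_ne_zero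
    (x := res a) (y := res b) hΔ).mp (by
      rw [WeierstrassCurve.Affine.equation_iff]
      have := congrArg res hE
      simp only [map_add, map_mul, map_pow, map_intCast] at this
      exact this)
  rw [WeierstrassCurve.Affine.nonsingular_iff] at hns
  refine hns.2.imp (fun h h' ↦ h ?_) fun h h' ↦ h ?_
  · have h1 : derivX W = ι (3 * a ^ 2 + 2 * W.a₂ * a + W.a₄ - W.a₁ * b) := by
      simp only [ι, map_add, map_sub, map_mul, map_pow, map_intCast, ha, hb, derivX, map_ofNat]
    rw [h1, algebraMap_mem_maxSet, ← IsLocalRing.residue_eq_zero_iff] at h'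
    simp only [map_add, map_sub, map_mul, map_pow, map_intCast, map_ofNat] at h'
    exact (sub_eq_zero.mp h').symm
  · have h1 : derivY W = ι (2 * b + W.a₁ * a + W.a₃) := by
      simp only [ι, map_add, map_mul, map_intCast, ha, hb, derivY, map_ofNat]
    rw [h1, algebraMap_mem_maxSet, ← IsLocalRing.residue_eq_zero_iff] at h'
    simp only [map_add, map_mul, map_intCast, map_ofNat] at h'
    change res b = - res b - (W.a₁ : κ) * res a - (W.a₃ : κ)
    linear_combination h'

variable (W) in
/-- The value of a polynomial with rational coefficients at the coordinate function `x`. -/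
noncomputable abbrev polyX (p : Polynomial ℚ) : FF W := Polynomial.aeval (affineCoord W 0) p

variable (W) in
theorem affineToFF_basis (p q : Polynomial ℚ) :
    affineToFF W (p • (1 : AffineRing W) +
      q • WeierstrassCurve.Affine.CoordinateRing.mk _ Polynomial.X) =
    polyX W p + polyX W q * affineCoord W 1 := by
  rw [WeierstrassCurve.Affine.CoordinateRing.smul, WeierstrassCurve.Affine.CoordinateRing.smul,
    mul_one, ← map_mul, ← map_add, affineToFF, affineLift_mk]
  simp

/-- The elements of the affine coordinate ring are the `p(x) + q(x) (2y + a₁x + a₃)` with polynomials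
`p` and `q`. -/
theorem exists_polyX_add (a : AffineRing W) :
    ∃ p q : Polynomial ℚ, affineToFF W a = polyX W p + polyX W q * derivY W := by
  obtain ⟨p, q, rfl⟩ := WeierstrassCurve.Affine.CoordinateRing.exists_smul_basis_eq a
  refine ⟨p - Polynomial.C (1 / 2) * q *
    ((W.a₁ : Polynomial ℚ) * Polynomial.X + (W.a₃ : Polynomial ℚ)),
    Polynomial.C (1 / 2) * q, ?_⟩
  rw [affineToFF_basis, derivY]
  simp
  ring

theorem polyX_add_eq_zero {p q : Polynomial ℚ} (h : polyX W p + polyX W q * derivY W = 0) :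
    p = 0 ∧ q = 0 := by
  have h1 := affineToFF_basis W
    (p + q * ((W.a₁ : Polynomial ℚ) * Polynomial.X + (W.a₃ : Polynomial ℚ))) (2 * q)
  have h2 : polyX W (p + q * ((W.a₁ : Polynomial ℚ) * Polynomial.X + (W.a₃ : Polynomial ℚ))) +
      polyX W (2 * q) * affineCoord W 1 = 0 := by
    rw [← h, derivY]
    simp [map_ofNat]
    ring
  rw [h2, ← map_zero (affineToFF W)] at h1
  obtain ⟨h3, h4⟩ := WeierstrassCurve.Affine.CoordinateRing.smul_basis_eq_zero
    (affineToFF_injective W h1)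
  have h5 : q = 0 := by simpa using h4
  exact ⟨by simpa [h5] using h3, h5⟩

theorem polyX_eq_zero {p : Polynomial ℚ} (h : polyX W p = 0) : p = 0 :=
  (polyX_add_eq_zero (q := 0) (by simpa using h)).1

variable (W) in
/-- The polynomial `4x³ + b₂x² + 2b₄x + b₆`, the square of `2y + a₁x + a₃`. -/
noncomputable def sqPoly : Polynomial ℚ :=
  4 * Polynomial.X ^ 3 + (W.b₂ : Polynomial ℚ) * Polynomial.X ^ 2 +
    2 * (W.b₄ : Polynomial ℚ) * Polynomial.X + (W.b₆ : Polynomial ℚ)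

variable (W) in
theorem polyX_sqPoly : polyX W (sqPoly W) = derivY W ^ 2 := by
  simp [map_ofNat, sqPoly, derivY, WeierstrassCurve.b₂, WeierstrassCurve.b₄, WeierstrassCurve.b₆]
  linear_combination -4 * affine_equation W

variable (W) in
theorem polyX_derivative_sqPoly : polyX W (Polynomial.derivative (sqPoly W)) =
    4 * derivX W + 2 * W.a₁ * derivY W := by
  simp only [sqPoly, Polynomial.derivative_add, Polynomial.derivative_mul,
    Polynomial.derivative_ofNat, Polynomial.derivative_intCast, Polynomial.derivative_X_pow,
    Polynomial.derivative_X]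
  simp [map_ofNat, derivX, derivY, WeierstrassCurve.b₂, WeierstrassCurve.b₄]
  ring

theorem affineToFF_mem_localRing (hx : IsHorizontal x)
    (hZ : toCoordRing W (MvPolynomial.X 2) ∉ idealOf W x) (a : AffineRing W) :
    affineToFF W a ∈ localRing W x := by
  obtain ⟨N, hN, d, G, hG, h⟩ := exists_form W a
  have h1 : (N : FF W) * affineToFF W a = dehom W G := by
    rw [← affineToFF_dehomAffine, ← h, map_mul, map_intCast]
  have h2 : affineToFF W a = ((N : ℚ)⁻¹ : ℚ) * dehom W G := by
    have : (N : FF W) ≠ 0 := by exact_mod_cast hN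
    rw [← h1]
    push_cast
    field_simp
  rw [h2]
  obtain ⟨G, hG, rfl⟩ := hG
  exact mul_mem (ratCast_mem_localRing hx _) (aeval_affineCoord hZ hG).1

theorem polyX_mem_localRing (hx : IsHorizontal x)
    (hZ : toCoordRing W (MvPolynomial.X 2) ∉ idealOf W x) (p : Polynomial ℚ) :
    polyX W p ∈ localRing W x := by
  have h := affineToFF_basis W p 0
  have h1 : polyX W p = affineToFF W (p • 1 + (0 : Polynomial ℚ) •
      WeierstrassCurve.Affine.CoordinateRing.mk _ Polynomial.X) := by
    rw [h, polyX, polyX, map_zero, zero_mul, add_zero]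
  rw [h1]
  exact affineToFF_mem_localRing hx hZ _

theorem derivY_mem_localRing (hZ : toCoordRing W (MvPolynomial.X 2) ∉ idealOf W x) :
    derivY W ∈ localRing W x :=
  dehom_formY W ▸ (aeval_affineCoord hZ (formY_isHomogeneous W)).1

/-- The prime ideal of the polynomials in `x` that vanish at a horizontal point. -/
noncomputable def polyIdeal (hx : IsHorizontal x)
    (hZ : toCoordRing W (MvPolynomial.X 2) ∉ idealOf W x) : Ideal (Polynomial ℚ) where
  carrier := {p | polyX W p ∈ maxSet W x}
  zero_mem' := by simpa using zero_mem_maxSet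
  add_mem' := by
    intro p q hp hq
    simpa using add_mem_maxSet hp hq
  smul_mem' := by
    intro p q hq
    simpa using mul_mem_maxSet (polyX_mem_localRing hx hZ p) hq

theorem mem_polyIdeal (hx : IsHorizontal x)
    (hZ : toCoordRing W (MvPolynomial.X 2) ∉ idealOf W x) {p : Polynomial ℚ} :
    p ∈ polyIdeal hx hZ ↔ polyX W p ∈ maxSet W x := Iff.rfl

theorem polyIdeal_isPrime (hx : IsHorizontal x)
    (hZ : toCoordRing W (MvPolynomial.X 2) ∉ idealOf W x) : (polyIdeal hx hZ).IsPrime := by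
  refine ⟨fun h ↦ one_notMem_maxSet (x := x) ?_, fun {p q} h ↦ ?_⟩
  · have := (Ideal.eq_top_iff_one _).mp h
    simpa [mem_polyIdeal] using this
  · rw [mem_polyIdeal, polyX, map_mul] at h
    exact mem_or_mem_maxSet (polyX_mem_localRing hx hZ p) (polyX_mem_localRing hx hZ q) h

theorem polyX_norm (p q : Polynomial ℚ) : polyX W (p ^ 2 - q ^ 2 * sqPoly W) =
    (polyX W p + polyX W q * derivY W) * (polyX W p - polyX W q * derivY W) := by
  rw [polyX, map_sub, map_mul, map_pow, map_pow]
  have := polyX_sqPoly W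
  rw [polyX] at this
  rw [this]
  ring

theorem norm_ne_zero {p q : Polynomial ℚ} (h : polyX W p + polyX W q * derivY W ≠ 0) :
    p ^ 2 - q ^ 2 * sqPoly W ≠ 0 := by
  intro h0
  have h1 := polyX_norm (W := W) p q
  rw [h0, polyX, map_zero] at h1
  have h2 : polyX W p + polyX W (-q) * derivY W = 0 := by
    rw [polyX, polyX, map_neg, neg_mul, ← sub_eq_add_neg]
    exact (mul_eq_zero.mp h1.symm).resolve_left h
  obtain ⟨hp, hq⟩ := polyX_add_eq_zero h2
  rw [neg_eq_zero] at hq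
  exact h (by simp [hp, hq])

theorem dehom_mem_maxSet_iff (hZ : toCoordRing W (MvPolynomial.X 2) ∉ idealOf W x) {d : ℕ}
    {G : CoordRing W} (hG : G ∈ grading W d) : dehom W G ∈ maxSet W x ↔ G ∈ idealOf W x := by
  obtain ⟨G, hG, rfl⟩ := hG
  exact (aeval_affineCoord hZ hG).2

theorem exists_dehom_eq_polyX (G : CoordRing W) :
    ∃ p q : Polynomial ℚ, dehom W G = polyX W p + polyX W q * derivY W := by
  rw [← affineToFF_dehomAffine]
  exact exists_polyX_add _

theorem exists_form_mem {I : Ideal (CoordRing W)} (hI : I.IsHomogeneous (grading W)) (h : I ≠ ⊥) :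
    ∃ d, ∃ G ∈ grading W d, G ∈ I ∧ G ≠ 0 := by
  obtain ⟨a, ha, ha0⟩ := Submodule.exists_mem_ne_zero_of_ne_bot h
  by_contra! h'
  refine ha0 ?_
  classical
  rw [← DirectSum.sum_support_decompose (grading W) a]
  exact Finset.sum_eq_zero fun i _ ↦ h' i _ (SetLike.coe_mem _) (hI i ha)

theorem polyIdeal_ne_bot (hx : IsHorizontal x)
    (hZ : toCoordRing W (MvPolynomial.X 2) ∉ idealOf W x) (h : idealOf W x ≠ ⊥) :
    polyIdeal hx hZ ≠ ⊥ := by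
  obtain ⟨d, G, hG, hGx, hG0⟩ := exists_form_mem (idealOf_isHomogeneous W x) h
  obtain ⟨p, q, hpq⟩ := exists_dehom_eq_polyX G
  have h0 : dehom W G ≠ 0 := fun h ↦ hG0 (dehom_eq_zero W hG h)
  refine fun h ↦ norm_ne_zero (hpq ▸ h0) ((Submodule.eq_bot_iff _).mp h _ ?_)
  rw [mem_polyIdeal, polyX_norm, mul_comm]
  exact mul_mem_maxSet (sub_mem (polyX_mem_localRing hx hZ _)
    (mul_mem (polyX_mem_localRing hx hZ _) (derivY_mem_localRing hZ)))
    (hpq ▸ (dehom_mem_maxSet_iff hZ hG).mpr hGx)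

theorem two_inv_mul_mem {r : FF W} (hx : IsHorizontal x) (h : 2 * r ∈ maxSet W x) :
    r ∈ maxSet W x := by
  have h1 := mul_mem_maxSet (ratCast_mem_localRing hx (1 / 2)) h
  rwa [← mul_assoc, show (((1 / 2 : ℚ) : FF W) * 2) = 1 by push_cast; norm_num, one_mul] at h1

/-- A point of the generic fibre in the affine part has codimension one unless it is the generic
point. -/
theorem coheight_eq_one_affine (hx : IsHorizontal x)
    (hZ : toCoordRing W (MvPolynomial.X 2) ∉ idealOf W x) (h : idealOf W x ≠ ⊥) :
    Order.coheight x = 1 := by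
  refine coheight_eq_one_of W h fun y hyx hy ↦ ?_
  have hy' := hx.of_le hyx
  have hZ' := notMem_of_le hyx hZ
  -- The two points lie over the same point of the affine line.
  have hJ : polyIdeal hy' hZ' = polyIdeal hx hZ := by
    have hp := polyIdeal_isPrime hy' hZ'
    refine (hp.isMaximal (polyIdeal_ne_bot hy' hZ' hy)).eq_of_le
      (polyIdeal_isPrime hx hZ).ne_top fun p hp ↦ ?_
    exact mem_maxSet_of_le hyx (polyX_mem_localRing hx hZ p) hp
  have hpol (p : Polynomial ℚ) : polyX W p ∈ maxSet W y ↔ polyX W p ∈ maxSet W x := by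
    rw [← mem_polyIdeal hy' hZ', hJ, mem_polyIdeal]
  have key (d : ℕ) (G : CoordRing W) (hG : G ∈ grading W d) (hGx : G ∈ idealOf W x) :
      G ∈ idealOf W y := by
    rw [← dehom_mem_maxSet_iff hZ' hG]
    rw [← dehom_mem_maxSet_iff hZ hG] at hGx
    obtain ⟨p, q, hpq⟩ := exists_dehom_eq_polyX G
    rw [hpq] at hGx ⊢
    have hpl := polyX_mem_localRing hx hZ p
    have hql := polyX_mem_localRing hx hZ q
    have hηl := derivY_mem_localRing hZ
    have hc : polyX W p - polyX W q * derivY W ∈ localRing W x := sub_mem hpl (mul_mem hql hηl)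
    have hN : polyX W (p ^ 2 - q ^ 2 * sqPoly W) ∈ maxSet W y := by
      rw [hpol, polyX_norm, mul_comm]
      exact mul_mem_maxSet hc hGx
    rw [polyX_norm] at hN
    rcases mem_or_mem_maxSet (add_mem (localRing_le hyx hpl)
      (mul_mem (localRing_le hyx hql) (localRing_le hyx hηl))) (localRing_le hyx hc) hN with h1 | h1
    · exact h1
    · have h2 := mem_maxSet_of_le hyx hc h1
      have h3 : polyX W p ∈ maxSet W x := two_inv_mul_mem hx (by
        have := add_mem_maxSet hGx h2
        rwa [show polyX W p + polyX W q * derivY W + (polyX W p - polyX W q * derivY W) =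
          2 * polyX W p by ring] at this)
      have h4 : polyX W q * derivY W ∈ maxSet W x := by
        have := sub_mem_maxSet hGx h3
        rwa [add_sub_cancel_left] at this
      have h5 : (polyX W q * derivY W) ^ 2 ∈ maxSet W y := by
        have h6 : polyX W (q ^ 2 * sqPoly W) = (polyX W q * derivY W) ^ 2 := by
          rw [mul_pow, ← polyX_sqPoly, polyX, map_mul, map_pow]
        rw [← h6, hpol, h6, sq]
        exact mul_mem_maxSet (mul_mem hql hηl) h4
      exact add_mem_maxSet ((hpol p).mpr h3) (mem_maxSet_of_pow
        (mul_mem (localRing_le hyx hql) (localRing_le hyx hηl)) h5)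
  intro G hG
  classical
  rw [← DirectSum.sum_support_decompose (grading W) G]
  exact Ideal.sum_mem _ fun i _ ↦ key i _ (SetLike.coe_mem _) (idealOf_isHomogeneous W x i hG)

/-- To check that `t` generates the maximal ideal at a point of the affine part of the generic fibre,
it suffices to consider the elements `p(x) + q(x) (2y + a₁x + a₃)`. -/
theorem isUniformizer_of_forall (hZ : toCoordRing W (MvPolynomial.X 2) ∉ idealOf W x)
    {t : FF W} (ht : t ∈ maxSet W x)
    (h : ∀ p q : Polynomial ℚ, polyX W p + polyX W q * derivY W ∈ maxSet W x →
      ∃ s ∈ localRing W x, polyX W p + polyX W q * derivY W = s * t) : IsUniformizer x t := by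
  refine ⟨ht, fun r hr ↦ ?_⟩
  obtain ⟨d, G, H, hG, hH, hHx, rfl⟩ :=
    exists_eq_aeval_chart_div hZ (mem_localRing_of_mem_maxSet hr)
  have h2 : chart W 2 = affineCoord W := funext chart_two
  have hHl := aeval_mem_localRing (chart_mem_localRing hZ) H
  have hHi := inv_mem_localRing hHl hHx
  have hH0 : MvPolynomial.aeval (chart W 2) H ≠ 0 := fun h0 ↦ hHx (h0 ▸ zero_mem_maxSet)
  have hGm : MvPolynomial.aeval (chart W 2) G ∈ maxSet W x := by
    have := mul_mem_maxSet hHl hr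
    rwa [mul_div_cancel₀ _ hH0] at this
  rw [h2, ← dehom_toCoordRing] at hGm
  obtain ⟨p, q, hpq⟩ := exists_dehom_eq_polyX (toCoordRing W G)
  obtain ⟨s, hs, hst⟩ := h p q (hpq ▸ hGm)
  refine ⟨(MvPolynomial.aeval (chart W 2) H)⁻¹ * s, mul_mem hHi hs, ?_⟩
  rw [h2, ← dehom_toCoordRing W G, hpq, hst]
  ring

theorem polyX_mul (p q : Polynomial ℚ) : polyX W (p * q) = polyX W p * polyX W q := map_mul _ _ _

/-- At a point where `2y + a₁x + a₃` does not vanish, the projection to the affine line is unramified.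
-/
theorem isUniformizer_polyX (hx : IsHorizontal x)
    (hZ : toCoordRing W (MvPolynomial.X 2) ∉ idealOf W x) (hηm : derivY W ∉ maxSet W x)
    {π : Polynomial ℚ} (hπ : polyIdeal hx hZ = Ideal.span {π}) : IsUniformizer x (polyX W π) := by
  have hp := polyX_mem_localRing hx hZ
  have hη := derivY_mem_localRing hZ
  have hdvd (p : Polynomial ℚ) (h : polyX W p ∈ maxSet W x) : ∃ p', p = π * p' := by
    rw [← mem_polyIdeal hx hZ, hπ] at h
    exact Ideal.mem_span_singleton.mp h
  have hπm : polyX W π ∈ maxSet W x := by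
    rw [← mem_polyIdeal hx hZ, hπ]
    exact Ideal.mem_span_singleton_self π
  refine isUniformizer_of_forall hZ hπm fun p q hpq ↦ ?_
  have hcl : polyX W p - polyX W q * derivY W ∈ localRing W x :=
    sub_mem (hp p) (mul_mem (hp q) hη)
  by_cases hqm : polyX W q ∈ maxSet W x
  · have hpm : polyX W p ∈ maxSet W x := by
      have := sub_mem_maxSet hpq (mul_mem_maxSet hη hqm)
      rwa [mul_comm (derivY W), add_sub_cancel_right] at this
    obtain ⟨p', rfl⟩ := hdvd p hpm
    obtain ⟨q', rfl⟩ := hdvd q hqm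
    refine ⟨polyX W p' + polyX W q' * derivY W, add_mem (hp _) (mul_mem (hp _) hη), ?_⟩
    rw [polyX_mul, polyX_mul]
    ring
  · have hcm : polyX W p - polyX W q * derivY W ∉ maxSet W x := by
      intro hc
      have h1 := sub_mem_maxSet hpq hc
      rw [show polyX W p + polyX W q * derivY W - (polyX W p - polyX W q * derivY W) =
        2 * (polyX W q * derivY W) by ring] at h1
      exact (mem_or_mem_maxSet (hp q) hη (two_inv_mul_mem hx h1)).elim hqm hηm
    have hc0 : polyX W p - polyX W q * derivY W ≠ 0 := fun h ↦ hcm (h ▸ zero_mem_maxSet)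
    -- The norm of `p(x) + q(x) (2y + a₁x + a₃)` is a polynomial in `x` that vanishes at the point.
    obtain ⟨N, hN⟩ := hdvd (p ^ 2 - q ^ 2 * sqPoly W) (by
      rw [polyX_norm, mul_comm]; exact mul_mem_maxSet hcl hpq)
    have h1 := polyX_norm (W := W) p q
    rw [hN, polyX_mul] at h1
    refine ⟨polyX W N * (polyX W p - polyX W q * derivY W)⁻¹,
      mul_mem (hp _) (inv_mem_localRing hcl hcm), ?_⟩
    field_simp
    linear_combination -h1

/-- The local ring at a closed point of the affine part of the generic fibre is a principal ideal
ring: its maximal ideal is generated by a polynomial in `x`, or by `2y + a₁x + a₃` if this vanishes at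
the point. -/
theorem exists_isUniformizer_affine [(W.baseChange ℚ).IsElliptic] (hx : IsHorizontal x)
    (hZ : toCoordRing W (MvPolynomial.X 2) ∉ idealOf W x) : ∃ t, IsUniformizer x t := by
  have hp := polyX_mem_localRing hx hZ
  have hη := derivY_mem_localRing hZ
  obtain ⟨π, hπ⟩ := (IsPrincipalIdealRing.principal (polyIdeal hx hZ)).principal
  have hdvd (p : Polynomial ℚ) (h : polyX W p ∈ maxSet W x) : ∃ p', p = π * p' := by
    rw [← mem_polyIdeal hx hZ, hπ] at h
    exact Ideal.mem_span_singleton.mp h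
  have hπm : polyX W π ∈ maxSet W x := by
    rw [← mem_polyIdeal hx hZ, hπ]
    exact Ideal.mem_span_singleton_self π
  by_cases hηm : derivY W ∈ maxSet W x
  · obtain ⟨F, hF⟩ := hdvd (sqPoly W) (by
      rw [polyX_sqPoly, sq]; exact mul_mem_maxSet hη hηm)
    have hFm : polyX W F ∉ maxSet W x := by
      intro hFm
      have h1 : polyX W (Polynomial.derivative (sqPoly W)) ∈ maxSet W x := by
        rw [hF, Polynomial.derivative_mul, polyX, map_add, ← polyX, ← polyX, polyX_mul, polyX_mul]
        refine add_mem_maxSet (mul_mem_maxSet (hp _) hFm) ?_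
        rw [mul_comm]
        exact mul_mem_maxSet (hp _) hπm
      rw [polyX_derivative_sqPoly] at h1
      have h2 : 2 * (2 * derivX W) ∈ maxSet W x := by
        have := sub_mem_maxSet h1 (mul_mem_maxSet
          (intCast_mem (localRing W x) (2 * W.a₁)) hηm)
        push_cast at this
        rwa [add_sub_cancel_right, show (4 : FF W) = 2 * 2 by norm_num, mul_assoc] at this
      have h3 := two_inv_mul_mem hx (two_inv_mul_mem hx h2)
      rw [← dehom_formX, dehom_mem_maxSet_iff hZ (mem_grading W (formX_isHomogeneous W))] at h3
      rw [← dehom_formY, dehom_mem_maxSet_iff hZ (mem_grading W (formY_isHomogeneous W))] at hηm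
      exact (formX_or_formY_notMem hx hZ).elim (· h3) (· hηm)
    have hF0 : polyX W F ≠ 0 := fun h ↦ hFm (h ▸ zero_mem_maxSet)
    refine ⟨derivY W, isUniformizer_of_forall hZ hηm fun p q hpq ↦ ?_⟩
    have hpm : polyX W p ∈ maxSet W x := by
      have := sub_mem_maxSet hpq (mul_mem_maxSet (hp q) hηm)
      rwa [add_sub_cancel_right] at this
    obtain ⟨p', rfl⟩ := hdvd p hpm
    refine ⟨polyX W p' * (polyX W F)⁻¹ * derivY W + polyX W q,
      add_mem (mul_mem (mul_mem (hp _) (inv_mem_localRing (hp _) hFm)) hη) (hp _), ?_⟩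
    have h4 := polyX_sqPoly W
    rw [hF, polyX_mul] at h4
    rw [polyX_mul]
    field_simp
    linear_combination polyX W p' * h4
  · exact ⟨polyX W π, isUniformizer_polyX hx hZ hηm hπ⟩

end WeierstrassModel

namespace WeierstrassModel

variable {W : WeierstrassCurve ℤ} {x y : scheme W}

/-! ### The point at infinity of the generic fibre -/

theorem polynomial_aeval_mem_localRing (hx : IsHorizontal x) {r : FF W} (hr : r ∈ localRing W x)
    (p : Polynomial ℚ) : Polynomial.aeval r p ∈ localRing W x := by
  rw [Polynomial.aeval_eq_sum_range]
  refine sum_mem fun i _ ↦ ?_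
  rw [Rat.smul_def]
  exact mul_mem (ratCast_mem_localRing hx _) (pow_mem hr i)

variable (W) in
/-- The unit `v` in the equation `w v = z³` of the curve near infinity, where `z = X / Y` and
`w = Z / Y`. -/
noncomputable def infUnit : FF W :=
  1 + (W.a₁ : FF W) * chart W 1 0 + (W.a₃ : FF W) * chart W 1 2 - (W.a₂ : FF W) * chart W 1 0 ^ 2 -
    (W.a₄ : FF W) * chart W 1 0 * chart W 1 2 - (W.a₆ : FF W) * chart W 1 2 ^ 2

variable (W) in
theorem chart_mul_infUnit : chart W 1 2 * infUnit W = chart W 1 0 ^ 3 := by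
  have hy := y_ne_zero W
  rw [infUnit, chart, chart, affineCoord_two]
  field_simp
  linear_combination affine_equation W

/-- `x` lies on the line `Z = 0`, that is on the closure of the zero of the group law. -/
structure AtInfinity (x : scheme W) : Prop where
  hX : toCoordRing W (MvPolynomial.X 0) ∈ idealOf W x
  hZ : toCoordRing W (MvPolynomial.X 2) ∈ idealOf W x
  hY : toCoordRing W (MvPolynomial.X 1) ∉ idealOf W x

theorem notMem_or_atInfinity (x : scheme W) :
    toCoordRing W (MvPolynomial.X 2) ∉ idealOf W x ∨ AtInfinity x :=
  (exists_coord_notMem x).imp_right fun ⟨h1, h2, h3⟩ ↦ ⟨h1, h2, h3⟩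

namespace AtInfinity

theorem chart_mem_maxSet {i : Fin 3} (hi : toCoordRing W (MvPolynomial.X i) ∈ idealOf W x)
    (h : AtInfinity x) : chart W 1 i ∈ maxSet W x := by
  have := (aeval_chart_mem_maxSet_iff h.hY (MvPolynomial.isHomogeneous_X ℤ i)).mpr hi
  rwa [MvPolynomial.aeval_X] at this

theorem z_mem (h : AtInfinity x) : chart W 1 0 ∈ maxSet W x := chart_mem_maxSet h.hX h

theorem w_mem (h : AtInfinity x) : chart W 1 2 ∈ maxSet W x := chart_mem_maxSet h.hZ h

theorem infUnit_mem (h : AtInfinity x) : infUnit W ∈ localRing W x := by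
  have hz := mem_localRing_of_mem_maxSet h.z_mem
  have hw := mem_localRing_of_mem_maxSet h.w_mem
  have hc (n : ℤ) : (n : FF W) ∈ localRing W x := intCast_mem _ n
  exact sub_mem (sub_mem (sub_mem (add_mem (add_mem (one_mem _) (mul_mem (hc _) hz))
    (mul_mem (hc _) hw)) (mul_mem (hc _) (pow_mem hz 2))) (mul_mem (mul_mem (hc _) hz) hw))
    (mul_mem (hc _) (pow_mem hw 2))

theorem infUnit_notMem (h : AtInfinity x) : infUnit W ∉ maxSet W x := by
  intro h'
  have hz := mem_localRing_of_mem_maxSet h.z_mem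
  have hw := mem_localRing_of_mem_maxSet h.w_mem
  have hc (n : ℤ) : (n : FF W) ∈ localRing W x := intCast_mem _ n
  refine one_notMem_maxSet (x := x) ?_
  have h1 : infUnit W - (((W.a₁ : FF W) - (W.a₂ : FF W) * chart W 1 0) * chart W 1 0 +
      ((W.a₃ : FF W) - (W.a₄ : FF W) * chart W 1 0 - (W.a₆ : FF W) * chart W 1 2) *
        chart W 1 2) = 1 := by
    rw [infUnit]; ring
  rw [← h1]
  exact sub_mem_maxSet h' (add_mem_maxSet
    (mul_mem_maxSet (sub_mem (hc _) (mul_mem (hc _) hz)) h.z_mem)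
    (mul_mem_maxSet (sub_mem (sub_mem (hc _) (mul_mem (hc _) hz)) (mul_mem (hc _) hw)) h.w_mem))

theorem infUnit_ne_zero (h : AtInfinity x) : infUnit W ≠ 0 :=
  fun h0 ↦ h.infUnit_notMem (h0 ▸ zero_mem_maxSet)

variable (W) in
theorem _root_.WeierstrassModel.w_ne_zero : chart W 1 2 ≠ 0 := by
  rw [chart, affineCoord_two]
  exact one_div_ne_zero (y_ne_zero W)

theorem z_ne_zero (h : AtInfinity x) : chart W 1 0 ≠ 0 := fun h0 ↦ by
  have := chart_mul_infUnit W
  rw [h0] at this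
  exact mul_ne_zero (w_ne_zero W) h.infUnit_ne_zero (by rw [this]; ring)

theorem x_eq (h : AtInfinity x) : affineCoord W 0 = infUnit W / chart W 1 0 ^ 2 := by
  have hz := h.z_ne_zero
  rw [eq_div_iff (pow_ne_zero _ hz)]
  apply mul_left_cancel₀ (w_ne_zero W)
  rw [chart_mul_infUnit]
  have hy := y_ne_zero W
  rw [chart, chart, affineCoord_two]
  field_simp

theorem y_eq (h : AtInfinity x) : affineCoord W 1 = infUnit W / chart W 1 0 ^ 3 := by
  rw [← chart_mul_infUnit, chart, affineCoord_two]
  have hv := h.infUnit_ne_zero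
  have hy := y_ne_zero W
  field_simp

theorem x_ne_zero (h : AtInfinity x) : affineCoord W 0 ≠ 0 := by
  rw [h.x_eq]
  exact div_ne_zero h.infUnit_ne_zero (pow_ne_zero _ h.z_ne_zero)

theorem inv_x_mem (h : AtInfinity x) : (affineCoord W 0)⁻¹ ∈ maxSet W x := by
  rw [h.x_eq, inv_div, div_eq_mul_inv, mul_comm, sq, ← mul_assoc]
  exact mul_mem_maxSet (mul_mem (inv_mem_localRing h.infUnit_mem h.infUnit_notMem)
    (mem_localRing_of_mem_maxSet h.z_mem)) h.z_mem

/-- A form `G` has at infinity the value `G(0, 1, 0)`. -/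
theorem exists_aeval_eq (h : AtInfinity x) (G : MvPolynomial (Fin 3) ℤ) :
    ∃ s ∈ localRing W x, MvPolynomial.aeval (chart W 1) G =
      ((MvPolynomial.eval ![0, 1, 0] G : ℤ) : FF W) + s * chart W 1 0 := by
  have hi (i : Fin 3) : ∃ s ∈ localRing W x, chart W 1 i =
      (((![0, 1, 0] : Fin 3 → ℤ) i : ℤ) : FF W) + s * chart W 1 0 := by
    fin_cases i
    · exact ⟨1, one_mem _, by simp⟩
    · exact ⟨0, zero_mem _, by simp [chart, y_ne_zero]⟩
    · refine ⟨(infUnit W)⁻¹ * chart W 1 0 ^ 2, mul_mem (inv_mem_localRing h.infUnit_mem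
        h.infUnit_notMem) (pow_mem (mem_localRing_of_mem_maxSet h.z_mem) 2), ?_⟩
      change chart W 1 2 = ((0 : ℤ) : FF W) + _
      have hv := h.infUnit_ne_zero
      rw [Int.cast_zero, zero_add, mul_assoc, ← pow_succ, ← chart_mul_infUnit]
      field_simp
  induction G using MvPolynomial.induction_on with
  | C a => exact ⟨0, zero_mem _, by simp⟩
  | add p q hp hq =>
    obtain ⟨s, hs, hp⟩ := hp
    obtain ⟨t, ht, hq⟩ := hq
    exact ⟨s + t, add_mem hs ht, by rw [map_add, map_add, hp, hq]; push_cast; ring⟩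
  | mul_X p i hp =>
    obtain ⟨s, hs, hp⟩ := hp
    obtain ⟨t, ht, hi⟩ := hi i
    refine ⟨s * chart W 1 i + ((MvPolynomial.eval ![0, 1, 0] p : ℤ) : FF W) * t,
      add_mem (mul_mem hs (chart_mem_localRing h.hY i)) (mul_mem (intCast_mem _ _) ht), ?_⟩
    rw [map_mul, map_mul, MvPolynomial.aeval_X, MvPolynomial.eval_X, hp]
    push_cast
    linear_combination ((MvPolynomial.eval ![0, 1, 0] p : ℤ) : FF W) * hi

theorem aeval_mem_maxSet_iff (h : AtInfinity x) (hx : IsHorizontal x)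
    (G : MvPolynomial (Fin 3) ℤ) : MvPolynomial.aeval (chart W 1) G ∈ maxSet W x ↔
      MvPolynomial.eval ![0, 1, 0] G = 0 := by
  obtain ⟨s, hs, hG⟩ := h.exists_aeval_eq G
  have h1 := mul_mem_maxSet hs h.z_mem
  constructor
  · intro h2
    have h3 := sub_mem_maxSet h2 h1
    rw [hG, add_sub_cancel_right, intCast_mem_maxSet_iff] at h3
    exact hx _ h3
  · intro h0
    rwa [hG, h0, Int.cast_zero, zero_add]

theorem isUniformizer (h : AtInfinity x) (hx : IsHorizontal x) : IsUniformizer x (chart W 1 0) := by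
  refine ⟨h.z_mem, fun r hr ↦ ?_⟩
  obtain ⟨d, G, H, hG, hH, hHx, rfl⟩ :=
    exists_eq_aeval_chart_div h.hY (mem_localRing_of_mem_maxSet hr)
  have hHl := aeval_mem_localRing (chart_mem_localRing h.hY) H
  have hH0 : MvPolynomial.aeval (chart W 1) H ≠ 0 := fun h0 ↦ hHx (h0 ▸ zero_mem_maxSet)
  have hGm := mul_mem_maxSet hHl hr
  rw [mul_div_cancel₀ _ hH0, h.aeval_mem_maxSet_iff hx] at hGm
  obtain ⟨s, hs, hG⟩ := h.exists_aeval_eq G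
  refine ⟨(MvPolynomial.aeval (chart W 1) H)⁻¹ * s, mul_mem (inv_mem_localRing hHl hHx) hs, ?_⟩
  rw [hG, hGm, Int.cast_zero, zero_add]
  ring

end AtInfinity

/-- The ideal of a point of `𝒲` is generated by the forms that vanish at the point. -/
theorem idealOf_le_of_forall
    (h : ∀ d, ∀ G : MvPolynomial (Fin 3) ℤ, G.IsHomogeneous d → toCoordRing W G ∈ idealOf W x →
      toCoordRing W G ∈ idealOf W y) : idealOf W x ≤ idealOf W y := by
  intro a ha
  classical
  rw [← DirectSum.sum_support_decompose (grading W) a]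
  refine Ideal.sum_mem _ fun i _ ↦ ?_
  obtain ⟨G, hG, hGa⟩ := SetLike.coe_mem (DirectSum.decompose (grading W) a i)
  have hm := idealOf_isHomogeneous W x i ha
  have hGa' : toCoordRing W G = (DirectSum.decompose (grading W) a i : CoordRing W) := hGa
  rw [← hGa'] at hm ⊢
  exact h i G hG hm

/-- The generic fibre has only one point at infinity. -/
theorem AtInfinity.le (hx : AtInfinity x) (hx' : IsHorizontal x) (hy : AtInfinity y)
    (hy' : IsHorizontal y) : idealOf W x ≤ idealOf W y := by
  refine idealOf_le_of_forall fun d G hG h ↦ ?_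
  rwa [← aeval_chart_mem_maxSet_iff hy.hY hG, hy.aeval_mem_maxSet_iff hy',
    ← hx.aeval_mem_maxSet_iff hx', aeval_chart_mem_maxSet_iff hx.hY hG]

/-- A polynomial of degree `n` in `x` has order `-n` with respect to `x⁻¹` at infinity. -/
theorem AtInfinity.polyX_mul_inv_pow (h : AtInfinity x) (hx : IsHorizontal x) (p : Polynomial ℚ) :
    polyX W p * (affineCoord W 0)⁻¹ ^ p.natDegree ∈ localRing W x ∧
      (p ≠ 0 → polyX W p * (affineCoord W 0)⁻¹ ^ p.natDegree ∉ maxSet W x) := by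
  have h0 := h.x_ne_zero
  have hi := mem_localRing_of_mem_maxSet h.inv_x_mem
  have h1 : polyX W p * (affineCoord W 0)⁻¹ ^ p.natDegree =
      Polynomial.aeval (affineCoord W 0)⁻¹ p.reverse := by
    let _ := invertibleOfNonzero h0
    have h2 := Polynomial.eval₂_reverse_mul_pow (algebraMap ℚ (FF W)) (affineCoord W 0) p
    rw [invOf_eq_inv] at h2
    rw [polyX, Polynomial.aeval_def, Polynomial.aeval_def, ← h2, mul_assoc, ← mul_pow,
      mul_inv_cancel₀ h0, one_pow, mul_one]
  rw [h1]
  refine ⟨polynomial_aeval_mem_localRing hx hi _, fun hp hm ↦ hp ?_⟩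
  rw [← Polynomial.divX_mul_X_add p.reverse, map_add, map_mul, Polynomial.aeval_X,
    Polynomial.aeval_C, Polynomial.coeff_zero_reverse] at hm
  have h3 := sub_mem_maxSet hm (mul_mem_maxSet
    (polynomial_aeval_mem_localRing hx hi p.reverse.divX) h.inv_x_mem)
  rw [add_sub_cancel_left, eq_ratCast, ratCast_mem_maxSet_iff hx] at h3
  exact Polynomial.leadingCoeff_eq_zero.mp h3

theorem coheight_eq_one_atInfinity (h : AtInfinity x) (hx : IsHorizontal x) :
    Order.coheight x = 1 := by
  refine coheight_eq_one_of W (fun h0 ↦ Z_ne_zero W ?_) fun y hyx hy ↦ ?_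
  · have := h.hZ
    rwa [h0] at this
  have hy' := hx.of_le hyx
  rcases notMem_or_atInfinity y with hZ | hi
  · -- A nonzero polynomial in `x` vanishing at `y` would be of order zero at infinity.
    obtain ⟨p, hp, hp0⟩ := Submodule.exists_mem_ne_zero_of_ne_bot (polyIdeal_ne_bot hy' hZ hy)
    rw [mem_polyIdeal] at hp
    obtain ⟨h1, h2⟩ := h.polyX_mul_inv_pow hx p
    refine absurd (mem_maxSet_of_le hyx h1 ?_) (h2 hp0)
    rw [mul_comm]
    exact mul_mem_maxSet (localRing_le hyx (pow_mem (mem_localRing_of_mem_maxSet h.inv_x_mem) _)) hp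
  · exact h.le hx hi hy'

/-- A function that is regular on the affine part of the generic fibre and at infinity is constant. -/
theorem AtInfinity.exists_eq_ratCast (h : AtInfinity x) (hx : IsHorizontal x) {p q : Polynomial ℚ}
    (hf : polyX W p + polyX W q * derivY W ∈ localRing W x) :
    ∃ c : ℚ, polyX W p + polyX W q * derivY W = c := by
  let z := chart W 1 0
  have hz : z ≠ 0 := h.z_ne_zero
  have hzm : z ∈ maxSet W x := h.z_mem
  have hzl := mem_localRing_of_mem_maxSet hzm
  have hvl := h.infUnit_mem
  have hv := h.infUnit_ne_zero
  have hvm := h.infUnit_notMem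
  have hzpow {n : ℕ} (hn : n ≠ 0) : z ^ n ∈ maxSet W x := by
    obtain ⟨n, rfl⟩ := Nat.exists_eq_succ_of_ne_zero hn
    rw [pow_succ]
    exact mul_mem_maxSet (pow_mem hzl n) hzm
  have hmul {r s : FF W} (hr : r ∈ localRing W x) (hrm : r ∉ maxSet W x) (hs : s ∈ localRing W x)
      (hsm : s ∉ maxSet W x) : r * s ∉ maxSet W x := fun h' ↦
    (mem_or_mem_maxSet hr hs h').elim hrm hsm
  -- The orders of the poles of `p(x)` and `q(x) (2y + a₁x + a₃)` have different parity.
  have hpz (p : Polynomial ℚ) : ∃ u ∈ localRing W x, (p ≠ 0 → u ∉ maxSet W x) ∧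
      polyX W p * z ^ (2 * p.natDegree) = u := by
    obtain ⟨h1, h2⟩ := h.polyX_mul_inv_pow hx p
    refine ⟨_, mul_mem h1 (pow_mem hvl p.natDegree), fun hp ↦ hmul h1 (h2 hp) (pow_mem hvl _)
      fun h' ↦ hvm (mem_maxSet_of_pow hvl h'), ?_⟩
    have h3 := h.x_eq
    rw [h3, inv_div, mul_assoc, ← mul_pow, div_mul_cancel₀ _ hv, pow_mul]
  have hη : derivY W * z ^ 3 ∈ localRing W x ∧ derivY W * z ^ 3 ∉ maxSet W x := by
    have h1 : derivY W * z ^ 3 = infUnit W * 2 + ((W.a₁ : FF W) * infUnit W +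
        (W.a₃ : FF W) * z ^ 2) * z := by
      have h2 := h.x_eq
      have h3 := h.y_eq
      change _ = _ / z ^ 2 at h2
      change _ = _ / z ^ 3 at h3
      rw [derivY, h2, h3]
      field_simp
      ring
    have h4 : (W.a₁ : FF W) * infUnit W + (W.a₃ : FF W) * z ^ 2 ∈ localRing W x :=
      add_mem (mul_mem (intCast_mem _ _) hvl) (mul_mem (intCast_mem _ _) (pow_mem hzl 2))
    have h2l : (2 : FF W) ∈ localRing W x := by exact_mod_cast intCast_mem (localRing W x) 2
    have h2m : (2 : FF W) ∉ maxSet W x := fun h' ↦ by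
      have := (ratCast_mem_maxSet_iff hx 2).mp (by exact_mod_cast h')
      norm_num at this
    rw [h1]
    refine ⟨add_mem (mul_mem hvl h2l) (mul_mem h4 hzl), fun h' ↦ ?_⟩
    have h5 := sub_mem_maxSet h' (mul_mem_maxSet h4 hzm)
    rw [add_sub_cancel_right] at h5
    exact hmul hvl hvm h2l h2m h5
  obtain ⟨u, hu, hum, hup⟩ := hpz p
  obtain ⟨u', hu', hum', huq⟩ := hpz q
  have hp : polyX W p = u / z ^ (2 * p.natDegree) := eq_div_of_mul_eq (pow_ne_zero _ hz) hup
  have hq : polyX W q * derivY W =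
      u' * (derivY W * z ^ 3) / z ^ (2 * q.natDegree + 3) := by
    rw [← huq, pow_add]
    field_simp
  have hql := mul_mem hu' hη.1
  -- The pole of `p(x)` does not dominate.
  have key1 (hlt : q = 0 ∨ 2 * q.natDegree + 3 < 2 * p.natDegree) : p.natDegree = 0 := by
    by_contra hn
    have hp0 : p ≠ 0 := by rintro rfl; exact hn Polynomial.natDegree_zero
    refine hum hp0 ?_
    have h1 : u = z ^ (2 * p.natDegree) * (polyX W p + polyX W q * derivY W) -
        z ^ (2 * p.natDegree) * (polyX W q * derivY W) := by
      rw [← hup]; ring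
    rw [h1]
    refine sub_mem_maxSet ?_ ?_
    · rw [mul_comm]
      exact mul_mem_maxSet hf (hzpow (by omega))
    · rcases hlt with rfl | hlt
      · simpa using zero_mem_maxSet
      · obtain ⟨k, hk⟩ := Nat.exists_eq_add_of_lt hlt
        rw [hq, hk, add_assoc (2 * q.natDegree + 3), pow_add, mul_div_assoc',
          mul_assoc (z ^ (2 * q.natDegree + 3)), mul_div_cancel_left₀ _ (pow_ne_zero _ hz), mul_comm]
        exact mul_mem_maxSet hql (hzpow (by omega))
  have key2 : q = 0 := by
    by_contra hq0
    rcases lt_or_gt_of_ne (show 2 * q.natDegree + 3 ≠ 2 * p.natDegree by omega) with hlt | hlt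
    · have := key1 (Or.inr hlt)
      omega
    · refine hmul hu' (hum' hq0) hη.1 hη.2 ?_
      have h1 : u' * (derivY W * z ^ 3) =
          z ^ (2 * q.natDegree + 3) * (polyX W p + polyX W q * derivY W) -
          z ^ (2 * q.natDegree + 3) * polyX W p := by
        rw [← huq, pow_add]; ring
      rw [h1]
      refine sub_mem_maxSet ?_ ?_
      · rw [mul_comm]
        exact mul_mem_maxSet hf (hzpow (by omega))
      · obtain ⟨k, hk⟩ := Nat.exists_eq_add_of_lt hlt
        rw [hp, hk, add_assoc (2 * p.natDegree), pow_add, mul_div_assoc',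
          mul_assoc (z ^ (2 * p.natDegree)), mul_div_cancel_left₀ _ (pow_ne_zero _ hz), mul_comm]
        exact mul_mem_maxSet hu (hzpow (by omega))
  have hp0 := key1 (Or.inl key2)
  refine ⟨p.coeff 0, ?_⟩
  rw [key2, Polynomial.eq_C_of_natDegree_eq_zero hp0]
  simp

end WeierstrassModel

namespace WeierstrassModel

variable {W : WeierstrassCurve ℤ} {x y : scheme W}

/-! ### Rational points -/

theorem mem_idealOf_pointOf (P : (W.baseChange ℚ).toAffine.Point) {G : MvPolynomial (Fin 3) ℤ}
    {d : ℕ} (hG : G.IsHomogeneous d) :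
    toCoordRing W G ∈ idealOf W (pointOf W P) ↔ MvPolynomial.aeval (coords W P) G = 0 := by
  rw [← evalAt_toCoordRing, ← RingHom.mem_ker]
  exact ⟨fun h ↦ Ideal.toIdeal_homogeneousCore_le (grading W) _ h,
    Ideal.mem_homogeneousCore_of_homogeneous_of_mem ⟨d, mem_grading W hG⟩⟩

theorem isHorizontal_pointOf (P : (W.baseChange ℚ).toAffine.Point) :
    IsHorizontal (pointOf W P) := by
  intro n hn
  have h := mem_idealOf_pointOf P (MvPolynomial.isHomogeneous_C (Fin 3) n)
  rw [MvPolynomial.aeval_C] at h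
  have h1 := h.mp (by simpa using hn)
  simpa using h1

theorem atInfinity_pointOf_zero : AtInfinity (pointOf W 0) where
  hX := (mem_idealOf_pointOf _ (MvPolynomial.isHomogeneous_X ℤ 0)).mpr (by
    rw [MvPolynomial.aeval_X]; rfl)
  hZ := (mem_idealOf_pointOf _ (MvPolynomial.isHomogeneous_X ℤ 2)).mpr (by
    rw [MvPolynomial.aeval_X]; rfl)
  hY := (mem_idealOf_pointOf _ (MvPolynomial.isHomogeneous_X ℤ 1)).not.mpr (by
    rw [MvPolynomial.aeval_X]; exact one_ne_zero)

theorem coords_some {x₀ y₀ : ℚ} (hP : (W.baseChange ℚ).toAffine.Nonsingular x₀ y₀) :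
    coords W (.some x₀ y₀ hP) = ![x₀, y₀, 1] := rfl

theorem Z_notMem_pointOf_some {x₀ y₀ : ℚ} (hP : (W.baseChange ℚ).toAffine.Nonsingular x₀ y₀) :
    toCoordRing W (MvPolynomial.X 2) ∉ idealOf W (pointOf W (.some x₀ y₀ hP)) := by
  rw [mem_idealOf_pointOf _ (MvPolynomial.isHomogeneous_X ℤ 2), MvPolynomial.aeval_X]
  exact one_ne_zero

theorem affine_equation_rat {x₀ y₀ : ℚ} (hP : (W.baseChange ℚ).toAffine.Nonsingular x₀ y₀) :
    y₀ ^ 2 + W.a₁ * x₀ * y₀ + W.a₃ * y₀ = x₀ ^ 3 + W.a₂ * x₀ ^ 2 + W.a₄ * x₀ + W.a₆ := by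
  have := (WeierstrassCurve.Affine.equation_iff ..).mp hP.1
  simpa [WeierstrassCurve.baseChange] using this

theorem isHomogeneous_linear (m n : ℤ) (i j : Fin 3) :
    (MvPolynomial.C m * MvPolynomial.X i + MvPolynomial.C n * MvPolynomial.X j).IsHomogeneous 1 :=
  ((MvPolynomial.isHomogeneous_X ℤ i).C_mul _).add ((MvPolynomial.isHomogeneous_X ℤ j).C_mul _)

theorem coord_sub_mem_maxSet {x₀ y₀ : ℚ} (hP : (W.baseChange ℚ).toAffine.Nonsingular x₀ y₀)
    (i : Fin 3) : affineCoord W i - ((![x₀, y₀, 1] : Fin 3 → ℚ) i : ℚ) ∈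
      maxSet W (pointOf W (.some x₀ y₀ hP)) := by
  let q : ℚ := (![x₀, y₀, 1] : Fin 3 → ℚ) i
  have hZ := Z_notMem_pointOf_some hP
  have hhor := isHorizontal_pointOf (W := W) (.some x₀ y₀ hP)
  have hG := isHomogeneous_linear q.den (-q.num) i 2
  have hd : (q.den : ℚ) ≠ 0 := by exact_mod_cast q.den_ne_zero
  have hmem := (aeval_affineCoord hZ hG).2.mpr ((mem_idealOf_pointOf _ hG).mpr (by
    have : (q.den : ℚ) * q - q.num = 0 := by rw [mul_comm, Rat.mul_den_eq_num, sub_self]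
    rw [coords_some]
    simp only [map_add, map_mul, MvPolynomial.aeval_X, MvPolynomial.aeval_C]
    simp only [algebraMap_int_eq, Int.coe_castRingHom, Int.cast_neg, Int.cast_natCast]
    change (q.den : ℚ) * q + -q.num * 1 = 0
    linear_combination this))
  have h1 := mul_mem_maxSet (ratCast_mem_localRing hhor (1 / q.den)) hmem
  convert h1 using 1
  rw [dehom_toCoordRing]
  simp only [map_add, map_mul, MvPolynomial.aeval_X, MvPolynomial.aeval_C, affineCoord_two]
  simp only [algebraMap_int_eq, Int.coe_castRingHom, Int.cast_neg, Int.cast_natCast]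
  have hd' : (q.den : FF W) ≠ 0 := by exact_mod_cast q.den_ne_zero
  change affineCoord W i - (q : FF W) = _
  rw [Rat.cast_def q]
  push_cast
  field_simp
  ring

theorem x_sub_mem_maxSet {x₀ y₀ : ℚ} (hP : (W.baseChange ℚ).toAffine.Nonsingular x₀ y₀) :
    affineCoord W 0 - (x₀ : FF W) ∈ maxSet W (pointOf W (.some x₀ y₀ hP)) :=
  coord_sub_mem_maxSet hP 0

theorem y_sub_mem_maxSet {x₀ y₀ : ℚ} (hP : (W.baseChange ℚ).toAffine.Nonsingular x₀ y₀) :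
    affineCoord W 1 - (y₀ : FF W) ∈ maxSet W (pointOf W (.some x₀ y₀ hP)) :=
  coord_sub_mem_maxSet hP 1

theorem derivY_sub_mem_maxSet {x₀ y₀ : ℚ} (hP : (W.baseChange ℚ).toAffine.Nonsingular x₀ y₀) :
    derivY W - ((2 * y₀ + W.a₁ * x₀ + W.a₃ : ℚ) : FF W) ∈
      maxSet W (pointOf W (.some x₀ y₀ hP)) := by
  have h1 := mul_mem_maxSet (intCast_mem _ 2) (y_sub_mem_maxSet hP)
  have h2 := mul_mem_maxSet (intCast_mem _ W.a₁) (x_sub_mem_maxSet hP)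
  convert add_mem_maxSet h1 h2 using 1
  rw [derivY]
  push_cast
  ring

/-- A point of the generic fibre with rational coordinates `x₀` and `y₀` is the point defined by
`(x₀, y₀)`. -/
theorem eq_pointOf_some {x₀ y₀ : ℚ} (hP : (W.baseChange ℚ).toAffine.Nonsingular x₀ y₀)
    (hx : IsHorizontal x) (hZ : toCoordRing W (MvPolynomial.X 2) ∉ idealOf W x)
    (h0 : affineCoord W 0 - (x₀ : FF W) ∈ maxSet W x)
    (h1 : affineCoord W 1 - (y₀ : FF W) ∈ maxSet W x) : x = pointOf W (.some x₀ y₀ hP) := by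
  have hi (i : Fin 3) : affineCoord W i - ((coords W (.some x₀ y₀ hP) i : ℚ) : FF W) ∈
      maxSet W x := by
    fin_cases i
    · exact h0
    · exact h1
    · change affineCoord W 2 - ((1 : ℚ) : FF W) ∈ _
      rw [affineCoord_two, Rat.cast_one, sub_self]
      exact zero_mem_maxSet
  have key (G : MvPolynomial (Fin 3) ℤ) : MvPolynomial.aeval (affineCoord W) G -
      ((MvPolynomial.aeval (coords W (.some x₀ y₀ hP)) G : ℚ) : FF W) ∈ maxSet W x := by
    induction G using MvPolynomial.induction_on with
    | C a => simpa using zero_mem_maxSet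
    | add p q hp hq =>
      convert add_mem_maxSet hp hq using 1
      rw [map_add, map_add]; push_cast; ring
    | mul_X p i hp =>
      convert add_mem_maxSet (mul_mem_maxSet (x_mem_localRing hZ i) hp)
        (mul_mem_maxSet (ratCast_mem_localRing hx
          (MvPolynomial.aeval (coords W (.some x₀ y₀ hP)) p)) (hi i)) using 1
      rw [map_mul, map_mul, MvPolynomial.aeval_X, MvPolynomial.aeval_X]; push_cast; ring
  have hmem {d : ℕ} {G : MvPolynomial (Fin 3) ℤ} (hG : G.IsHomogeneous d) :
      toCoordRing W G ∈ idealOf W x ↔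
        toCoordRing W G ∈ idealOf W (pointOf W (.some x₀ y₀ hP)) := by
    rw [← (aeval_affineCoord hZ hG).2, mem_idealOf_pointOf _ hG, dehom_toCoordRing,
      ← ratCast_mem_maxSet_iff hx]
    exact ⟨fun h ↦ by simpa using sub_mem_maxSet h (key G),
      fun h ↦ by simpa using add_mem_maxSet (key G) h⟩
  exact idealOf_injective W (le_antisymm
    (idealOf_le_of_forall fun d G hG h ↦ (hmem hG).mp h)
    (idealOf_le_of_forall fun d G hG h ↦ (hmem hG).mpr h))

theorem negY_eq (x₀ y₀ : ℚ) :
    (W.baseChange ℚ).toAffine.negY x₀ y₀ = -y₀ - W.a₁ * x₀ - W.a₃ := by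
  simp [WeierstrassCurve.Affine.negY, WeierstrassCurve.baseChange]

/-- The only points of the generic fibre with the same `x`-coordinate as `P` are `P` and `-P`. -/
theorem eq_pointOf_or_eq_pointOf_neg {x₀ y₀ : ℚ}
    (hP : (W.baseChange ℚ).toAffine.Nonsingular x₀ y₀)
    (hx : IsHorizontal x) (hZ : toCoordRing W (MvPolynomial.X 2) ∉ idealOf W x)
    (h0 : affineCoord W 0 - (x₀ : FF W) ∈ maxSet W x) :
    x = pointOf W (.some x₀ y₀ hP) ∨ x = pointOf W (-.some x₀ y₀ hP) := by
  have hr := ratCast_mem_localRing hx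
  have hxl := x_mem_localRing hZ 0
  have hyl := x_mem_localRing hZ 1
  have h1 : (affineCoord W 1 - (y₀ : FF W)) *
      (affineCoord W 1 - (((W.baseChange ℚ).toAffine.negY x₀ y₀ : ℚ) : FF W)) ∈ maxSet W x := by
    have hc (n : ℤ) : (n : FF W) ∈ localRing W x := intCast_mem _ n
    convert mul_mem_maxSet (x := x) (r := affineCoord W 0 ^ 2 + affineCoord W 0 * x₀ +
      (x₀ : FF W) ^ 2 + (W.a₂ : FF W) * (affineCoord W 0 + x₀) + W.a₄ - W.a₁ * affineCoord W 1) ?_ h0 using 1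
    · have h2 : (((y₀ ^ 2 + W.a₁ * x₀ * y₀ + W.a₃ * y₀ : ℚ)) : FF W) =
        ((x₀ ^ 3 + W.a₂ * x₀ ^ 2 + W.a₄ * x₀ + W.a₆ : ℚ) : FF W) := by
        rw [affine_equation_rat hP]
      have h3 := affine_equation W
      rw [negY_eq]
      push_cast at h2 ⊢
      linear_combination h3 - h2
    · exact sub_mem (add_mem (add_mem (add_mem (add_mem (pow_mem hxl 2) (mul_mem hxl (hr _)))
        (pow_mem (hr _) 2)) (mul_mem (hc _) (add_mem hxl (hr _)))) (hc _)) (mul_mem (hc _) hyl)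
  refine (mem_or_mem_maxSet (sub_mem hyl (hr _)) (sub_mem hyl (hr _)) h1).imp
    (fun h ↦ ?_) fun h ↦ ?_
  · exact eq_pointOf_some hP hx hZ h0 h
  · exact eq_pointOf_some _ hx hZ h0 h

theorem isUniformizer_x_sub (hx : IsHorizontal x)
    (hZ : toCoordRing W (MvPolynomial.X 2) ∉ idealOf W x) (hη : derivY W ∉ maxSet W x) {x₀ : ℚ}
    (h : affineCoord W 0 - (x₀ : FF W) ∈ maxSet W x) :
    IsUniformizer x (affineCoord W 0 - (x₀ : FF W)) := by
  have h1 : polyX W (Polynomial.X - Polynomial.C x₀) = affineCoord W 0 - (x₀ : FF W) := by simp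
  rw [← h1]
  refine isUniformizer_polyX hx hZ hη (Eq.symm ?_)
  have hmax : (Ideal.span {Polynomial.X - Polynomial.C x₀}).IsMaximal :=
    PrincipalIdealRing.isMaximal_of_irreducible (Polynomial.irreducible_X_sub_C x₀)
  refine hmax.eq_of_le (polyIdeal_isPrime hx hZ).ne_top ?_
  rw [Ideal.span_singleton_le_iff_mem, mem_polyIdeal, h1]
  exact h

/-! ### The fibres over the primes -/

/-- The generic point of the fibre of `𝒲` over `p`. -/
noncomputable def fibrePt (W : WeierstrassCurve ℤ) (p : ℕ) [Fact p.Prime] : scheme W :=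
  show ProjectiveSpectrum (grading W) from
  { asHomogeneousIdeal := ⟨Ideal.span {(p : CoordRing W)}, by
      refine Ideal.homogeneous_span _ _ ?_
      rintro _ rfl
      exact ⟨0, by simpa using intCast_mem_grading W p⟩⟩
    isPrime := (Ideal.span_singleton_prime (natCast_prime W p).ne_zero).mpr (natCast_prime W p)
    not_irrelevant_le := not_irrelevant_le W (i := 2) fun h ↦ by
      have h1 := map_eq_zero_of_natCast_dvd W p (MvPolynomial.isHomogeneous_X ℤ 2) (by norm_num)
        (Ideal.mem_span_singleton.mp h)
      rw [MvPolynomial.map_X] at h1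
      exact MvPolynomial.X_ne_zero _ h1 }

theorem mem_idealOf_fibrePt (p : ℕ) [Fact p.Prime] {a : CoordRing W} :
    a ∈ idealOf W (fibrePt W p) ↔ (p : CoordRing W) ∣ a := Ideal.mem_span_singleton

/-- A form of degree at most two vanishes on the fibre over `p` only if its coefficients are divisible
by `p`. -/
theorem map_eq_zero_of_mem_fibrePt (p : ℕ) [Fact p.Prime] {G : MvPolynomial (Fin 3) ℤ} {d : ℕ}
    (hG : G.IsHomogeneous d) (hd : d < 3) (h : toCoordRing W G ∈ idealOf W (fibrePt W p)) :
    MvPolynomial.map (Int.castRingHom (ZMod p)) G = 0 :=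
  map_eq_zero_of_natCast_dvd W p hG hd ((mem_idealOf_fibrePt p).mp h)

theorem Z_notMem_fibrePt (p : ℕ) [Fact p.Prime] :
    toCoordRing W (MvPolynomial.X 2) ∉ idealOf W (fibrePt W p) := fun h ↦ by
  have h1 := map_eq_zero_of_mem_fibrePt p (MvPolynomial.isHomogeneous_X ℤ 2) (by norm_num) h
  rw [MvPolynomial.map_X] at h1
  exact MvPolynomial.X_ne_zero _ h1

theorem natCast_mem_fibrePt (p : ℕ) [Fact p.Prime] :
    (p : CoordRing W) ∈ idealOf W (fibrePt W p) := Ideal.mem_span_singleton_self _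

theorem intCast_mem_fibrePt_iff (p : ℕ) [Fact p.Prime] (n : ℤ) :
    (n : CoordRing W) ∈ idealOf W (fibrePt W p) ↔ (p : ℤ) ∣ n := by
  constructor
  · intro h
    have h1 := map_eq_zero_of_mem_fibrePt (W := W) p (MvPolynomial.isHomogeneous_C (Fin 3) n)
      (by norm_num) (by simpa using h)
    rw [MvPolynomial.map_C, MvPolynomial.C_eq_zero] at h1
    exact (ZMod.intCast_zmod_eq_zero_iff_dvd n p).mp h1
  · rintro ⟨m, rfl⟩
    push_cast
    exact Ideal.mul_mem_right _ _ (natCast_mem_fibrePt p)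

theorem not_isHorizontal_fibrePt (p : ℕ) [hp : Fact p.Prime] : ¬ IsHorizontal (fibrePt W p) :=
  fun h ↦ hp.out.ne_zero (by
    exact_mod_cast h p (by exact_mod_cast natCast_mem_fibrePt (W := W) p))

theorem coheight_fibrePt (p : ℕ) [hp : Fact p.Prime] : Order.coheight (fibrePt W p) = 1 := by
  refine coheight_eq_one_of W (fun h ↦ (natCast_prime W p).ne_zero ?_) fun y hyx hy ↦ ?_
  · have := natCast_mem_fibrePt (W := W) p
    rwa [h] at this
  by_contra hne
  have hpy : (p : CoordRing W) ∉ idealOf W y := fun h ↦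
    hne ((Ideal.span_singleton_le_iff_mem _).mpr h)
  -- The elements of the smaller prime ideal are divisible by all powers of `p`.
  have key (n : ℕ) : ∀ a ∈ idealOf W y, (p : CoordRing W) ^ n ∣ a := by
    induction n with
    | zero => intro a _; simp
    | succ n ih =>
      intro a ha
      obtain ⟨b, rfl⟩ := (mem_idealOf_fibrePt p).mp (hyx ha)
      have hb := ((idealOf_isPrime W y).mem_or_mem ha).resolve_left hpy
      rw [pow_succ']
      exact mul_dvd_mul_left _ (ih b hb)
  refine hy ((Submodule.eq_bot_iff _).mpr fun a ha ↦ ?_)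
  have h1 := Ideal.iInf_pow_eq_bot_of_isDomain (Ideal.span {(p : CoordRing W)})
    (idealOf_isPrime W (fibrePt W p)).ne_top
  rw [← Ideal.mem_bot, ← h1, Ideal.mem_iInf]
  intro n
  rw [Ideal.span_singleton_pow, Ideal.mem_span_singleton]
  exact key n a ha

/-- The points of codimension one that do not lie on the generic fibre are the generic points of the
fibres over the primes. -/
theorem exists_eq_fibrePt (hc : Order.coheight x = 1) (hx : ¬ IsHorizontal x) :
    ∃ (p : ℕ) (_ : Fact p.Prime), x = fibrePt W p := by
  simp only [IsHorizontal, not_forall] at hx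
  obtain ⟨n, hn, hn0⟩ := hx
  have hn' : ((n.natAbs : ℕ) : CoordRing W) ∈ idealOf W x := by
    rw [← Int.cast_natCast]
    rcases Int.natAbs_eq n with h | h
    · rwa [← h]
    · rw [show ((n.natAbs : ℕ) : ℤ) = -n by omega, Int.cast_neg]
      exact neg_mem hn
  have key (m : ℕ) (hm : m ≠ 0) (h : (m : CoordRing W) ∈ idealOf W x) :
      ∃ p : ℕ, p.Prime ∧ (p : CoordRing W) ∈ idealOf W x := by
    induction m using induction_on_primes with
    | zero => exact absurd rfl hm
    | one =>
      exact absurd (by simpa using h) ((Ideal.ne_top_iff_one _).mp (idealOf_isPrime W x).ne_top)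
    | prime_mul p a hp ih =>
      rw [Nat.cast_mul] at h
      rcases (idealOf_isPrime W x).mem_or_mem h with h | h
      · exact ⟨p, hp, h⟩
      · exact ih (right_ne_zero_of_mul hm) h
  obtain ⟨p, hp, hpx⟩ := key n.natAbs (Int.natAbs_ne_zero.mpr hn0) hn'
  have : Fact p.Prime := ⟨hp⟩
  have hle : idealOf W (fibrePt W p) ≤ idealOf W x := (Ideal.span_singleton_le_iff_mem _).mpr hpx
  refine ⟨p, this, idealOf_injective W (le_antisymm (idealOf_le_of_coheight W hc hle
    (idealOf_ne_bot_of_coheight W (coheight_fibrePt p))) hle)⟩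

theorem neronGenerates_fibrePt (p : ℕ) [hp : Fact p.Prime] : NeronGenerates (fibrePt W p) := by
  refine neronGenerates_affine (Z_notMem_fibrePt p) ?_
  by_contra! h
  have h1 := map_eq_zero_of_mem_fibrePt p (formX_isHomogeneous W) (by norm_num) h.1
  have h2 := map_eq_zero_of_mem_fibrePt p (formY_isHomogeneous W) (by norm_num) h.2
  have h3 := congrArg (MvPolynomial.eval ![0, 1, 0]) h2
  have h4 := congrArg (MvPolynomial.eval ![1, 0, 0]) h1
  simp [formY] at h3
  simp [formX] at h4
  exact one_ne_zero (α := ZMod p) (by linear_combination h4 - h3)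

/-- A rational constant that is regular along the fibres over all primes is an integer. -/
theorem exists_intCast_eq {q : ℚ}
    (h : ∀ (p : ℕ) [Fact p.Prime], (q : FF W) ∈ localRing W (fibrePt W p)) : ∃ n : ℤ, q = n := by
  suffices hd : q.den = 1 from ⟨q.num, ((Rat.den_eq_one_iff q).mp hd).symm⟩
  by_contra hd
  obtain ⟨p, hp, hpd⟩ := Nat.exists_prime_and_dvd hd
  have : Fact p.Prime := ⟨hp⟩
  have h1 : ((q.den : ℤ) : FF W) ∈ maxSet W (fibrePt W p) := by
    rw [intCast_mem_maxSet_iff, intCast_mem_fibrePt_iff]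
    exact_mod_cast hpd
  have h2 := mul_mem_maxSet (h p) h1
  have h3 : (q : FF W) * ((q.den : ℤ) : FF W) = (q.num : FF W) := by
    have := Rat.mul_den_eq_num q
    exact_mod_cast this
  rw [h3, intCast_mem_maxSet_iff, intCast_mem_fibrePt_iff] at h2
  have h4 : p ∣ q.num.natAbs := Int.natCast_dvd.mp h2
  exact hp.one_lt.ne' (Nat.dvd_one.mp (q.reduced ▸ Nat.dvd_gcd h4 hpd))

end WeierstrassModel

namespace WeierstrassModel

variable {W : WeierstrassCurve ℤ} {x y : scheme W}

/-! ### Residues -/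

theorem residue_eq_ratCast (hx : IsHorizontal x) {g : (scheme W).presheaf.stalk x} {q : ℚ}
    (hg : algebraMap ((scheme W).presheaf.stalk x) (FF W) g = q) :
    IsLocalRing.residue ((scheme W).presheaf.stalk x) g = q := by
  have := charZero_of_isHorizontal hx
  have h1 : g * (q.den : (scheme W).presheaf.stalk x) = (q.num : (scheme W).presheaf.stalk x) := by
    apply stalk_injective W x
    rw [map_mul, hg, map_natCast, map_intCast]
    exact_mod_cast Rat.mul_den_eq_num q
  have h2 := congrArg (IsLocalRing.residue ((scheme W).presheaf.stalk x)) h1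
  rw [map_mul, map_natCast, map_intCast] at h2
  rw [Rat.cast_def, eq_div_iff (by exact_mod_cast q.den_ne_zero), h2]

theorem hasResidueAt_of_eq (hx : IsHorizontal x) {t : FF W} (ht : IsUniformizer x t) (q : ℚ)
    {α β : RationalDifferential (scheme W)} (hβ : IsRegularAt (scheme W) β x)
    (h : α = ((q : FF W) / t) • dd W t + β) :
    HasResidueAt (scheme W) α x (q : IsLocalRing.ResidueField ((scheme W).presheaf.stalk x)) := by
  obtain ⟨t', ht', rfl⟩ := ht.exists_span
  obtain ⟨g, hg⟩ := ratCast_mem_localRing hx q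
  refine ⟨t', g, ht', residue_eq_ratCast hx hg, β, hβ, ?_⟩
  rw [hg]
  exact h

theorem HasResidueAt.add_regular {α β : RationalDifferential (scheme W)}
    {c : IsLocalRing.ResidueField ((scheme W).presheaf.stalk x)}
    (hα : HasResidueAt (scheme W) α x c) (hβ : IsRegularAt (scheme W) β x) :
    HasResidueAt (scheme W) (α + β) x c := by
  obtain ⟨t, g, ht, hg, γ, hγ, rfl⟩ := hα
  exact ⟨t, g, ht, hg, γ + β, hγ.add hβ, add_assoc _ _ _⟩

theorem IsUniformizer.exists_unit {t t' : FF W} (ht : IsUniformizer x t) (ht0 : t ≠ 0)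
    (ht' : IsUniformizer x t') : ∃ u ∈ localRing W x, u ∉ maxSet W x ∧ t' = u * t := by
  obtain ⟨u, hu, h⟩ := ht.2 t' ht'.1
  obtain ⟨v, hv, h'⟩ := ht'.2 t ht.1
  refine ⟨u, hu, fun hum ↦ one_notMem_maxSet (x := x) ?_, h⟩
  have h1 : v * u = 1 := by
    apply mul_right_cancel₀ ht0
    rw [mul_assoc, ← h, ← h', one_mul]
  rw [← h1]
  exact mul_mem_maxSet hv hum

theorem IsUniformizer.ne_zero (hx : idealOf W x ≠ ⊥) {t : FF W} (ht : IsUniformizer x t) :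
    t ≠ 0 := by
  rintro rfl
  obtain ⟨d, G, hG, hGx, hG0⟩ := exists_form_mem (idealOf_isHomogeneous W x) hx
  obtain ⟨j, hj⟩ : ∃ j, toCoordRing W (MvPolynomial.X j) ∉ idealOf W x := by
    rcases notMem_or_atInfinity x with h | h
    exacts [⟨2, h⟩, ⟨1, h.hY⟩]
  have hjd : toCoordRing W (MvPolynomial.X j) ^ d ∉ idealOf W x := fun h ↦
    hj ((idealOf_isPrime W x).mem_of_pow_mem _ h)
  have hXd : toCoordRing W (MvPolynomial.X j) ^ d ∈ grading W d := by
    rw [← map_pow]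
    have := (MvPolynomial.isHomogeneous_X ℤ j).pow d
    rw [one_mul] at this
    exact mem_grading W this
  obtain ⟨s, -, hs⟩ := ht.2 _ ((dehom_div_mem_maxSet_iff hG hXd hjd).mpr hGx)
  rw [mul_zero, div_eq_zero_iff] at hs
  exact hs.elim (fun h ↦ hG0 (dehom_eq_zero W hG h)) (dehom_ne_zero W hXd hjd)

/-- The residue determines the polar part: another uniformizer is `u t` with a unit `u`, and the
logarithmic derivative of `u t` differs from that of `t` by the regular differential `du / u`. -/
theorem HasResidueAt.sub_regular (hx : idealOf W x ≠ ⊥) {α α' : RationalDifferential (scheme W)}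
    {c : IsLocalRing.ResidueField ((scheme W).presheaf.stalk x)}
    (hα : HasResidueAt (scheme W) α x c) (hα' : HasResidueAt (scheme W) α' x c) :
    IsRegularAt (scheme W) (α' - α) x := by
  obtain ⟨t, g, ht, hg, β, hβ, rfl⟩ := hα
  obtain ⟨t', g', ht', hg', β', hβ', rfl⟩ := hα'
  have hut := isUniformizer_of_span ht
  have ht0 := hut.ne_zero hx
  have hut' := isUniformizer_of_span ht'
  obtain ⟨u, hu, hum, htt⟩ := hut.exists_unit ht0 hut'
  have hgm : algebraMap _ (FF W) g' - algebraMap _ (FF W) g ∈ maxSet W x := by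
    rw [← map_sub, algebraMap_mem_maxSet, ← IsLocalRing.residue_eq_zero_iff, map_sub, hg, hg',
      sub_self]
  have hgl' := algebraMap_mem_localRing g'
  obtain ⟨r, hr, hrt⟩ := hut.2 _ hgm
  set T := algebraMap _ (FF W) t
  set T' := algebraMap _ (FF W) t'
  set G := algebraMap _ (FF W) g
  set G' := algebraMap _ (FF W) g'
  have hu0 : u ≠ 0 := fun h ↦ hum (h ▸ zero_mem_maxSet)
  have h1 : (G' / T') • dd W T' + β' - ((G / T) • dd W T + β) =
      r • dd W T + (G' * u⁻¹) • dd W u + (β' + -β) := by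
    have h2 : r = (G' - G) / T := eq_div_of_mul_eq ht0 hrt.symm
    have h3 : G' / (u * T) * u = G' / T := by field_simp
    have h4 : G' / (u * T) * T = G' * u⁻¹ := by field_simp
    rw [htt, Derivation.leibniz, smul_add, smul_smul, smul_smul, h3, h4, h2, sub_div]
    module
  change IsRegularAt (scheme W) ((G' / T') • dd W T' + β' - ((G / T) • dd W T + β)) x
  rw [h1]
  have hTl : T ∈ localRing W x := algebraMap_mem_localRing t
  exact (((isRegularAt_dd hTl).smul hr).add
    ((isRegularAt_dd hu).smul (mul_mem hgl' (inv_mem_localRing hu hum)))).add (hβ'.add hβ.neg)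

theorem neronGenerates_of_isHorizontal [(W.baseChange ℚ).IsElliptic] (hx : IsHorizontal x) :
    NeronGenerates x := by
  rcases notMem_or_atInfinity x with h | h
  · exact neronGenerates_affine h (formX_or_formY_notMem hx h)
  · exact neronGenerates_infinity h.hX h.hZ h.hY

theorem neronGenerates_of_coheight [(W.baseChange ℚ).IsElliptic] (hc : Order.coheight x = 1) :
    NeronGenerates x := by
  by_cases hx : IsHorizontal x
  · exact neronGenerates_of_isHorizontal hx
  · obtain ⟨p, hp, rfl⟩ := exists_eq_fibrePt hc hx
    exact neronGenerates_fibrePt p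

theorem exists_isUniformizer [(W.baseChange ℚ).IsElliptic] (hx : IsHorizontal x) :
    ∃ t, IsUniformizer x t := by
  rcases notMem_or_atInfinity x with h | h
  · exact exists_isUniformizer_affine hx h
  · exact ⟨_, h.isUniformizer hx⟩

theorem IsRegularAt.hasResidueAt_zero [(W.baseChange ℚ).IsElliptic] (hx : IsHorizontal x)
    {α : RationalDifferential (scheme W)}
    (hα : IsRegularAt (scheme W) α x) : HasResidueAt (scheme W) α x 0 := by
  obtain ⟨t, ht⟩ := exists_isUniformizer hx
  have h := hasResidueAt_of_eq hx ht 0 hα (by rw [Rat.cast_zero, zero_div, zero_smul, zero_add])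
  rwa [Rat.cast_zero] at h

/-! ### Uniqueness -/

/-- A rational function that is regular at all points of the affine part of the generic fibre is an
element of the affine coordinate ring. -/
theorem exists_affineToFF_eq {f : FF W}
    (hf : ∀ x : scheme W, IsHorizontal x → Order.coheight x = 1 →
      toCoordRing W (MvPolynomial.X 2) ∉ idealOf W x → f ∈ localRing W x) :
    ∃ a, affineToFF W a = f := by
  let I : Ideal (AffineRing W) :=
    { carrier := {b | ∃ a, affineToFF W a = affineToFF W b * f}
      zero_mem' := ⟨0, by rw [map_zero, zero_mul]⟩
      add_mem' := by
        rintro b c ⟨a, ha⟩ ⟨a', ha'⟩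
        exact ⟨a + a', by rw [map_add, map_add, ha, ha', add_mul]⟩
      smul_mem' := by
        rintro c b ⟨a, ha⟩
        exact ⟨c * a, by rw [smul_eq_mul, map_mul, map_mul, ha, mul_assoc]⟩ }
  have hI0 : I ≠ ⊥ := by
    let _ := algebraAffineRing W
    have := isFractionRing_affineRing W
    obtain ⟨a, b, hb, rfl⟩ := IsFractionRing.div_surjective (A := AffineRing W) f
    refine fun h ↦ nonZeroDivisors.ne_zero hb ((Submodule.eq_bot_iff I).mp h b ⟨a, ?_⟩)
    have hb0 : affineToFF W b ≠ 0 := fun h ↦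
      nonZeroDivisors.ne_zero hb (affineToFF_injective W (h.trans (map_zero _).symm))
    exact (mul_div_cancel₀ (affineToFF W a) hb0).symm
  by_cases hI : I = ⊤
  · obtain ⟨a, ha⟩ := (Ideal.eq_top_iff_one I).mp hI
    exact ⟨a, by rw [ha, map_one, one_mul]⟩
  -- If the ideal of denominators is proper, it is contained in a maximal ideal, and `f` is not regular
  -- at the corresponding point of the generic fibre.
  exfalso
  obtain ⟨m, hm, hIm⟩ := Ideal.exists_le_maximal I hI
  let J := Ideal.comap (dehomAffine W) m
  have hJ (d : ℕ) (G : CoordRing W) (hG : G ∈ grading W d) :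
      G ∈ (J.homogeneousCore (grading W)).toIdeal ↔ dehomAffine W G ∈ m :=
    ⟨fun h ↦ Ideal.toIdeal_homogeneousCore_le (grading W) _ h,
      fun h ↦ Ideal.mem_homogeneousCore_of_homogeneous_of_mem ⟨d, hG⟩ h⟩
  have hZ : toCoordRing W (MvPolynomial.X 2) ∉ (J.homogeneousCore (grading W)).toIdeal := by
    rw [hJ 1 _ (mem_grading W (MvPolynomial.isHomogeneous_X ℤ 2))]
    have : dehomAffine W (toCoordRing W (MvPolynomial.X 2)) = 1 := by
      apply affineToFF_injective
      rw [affineToFF_dehomAffine, dehom_X, affineCoord_two, map_one]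
    rw [this]
    exact (Ideal.ne_top_iff_one _).mp hm.ne_top
  have hJp : J.IsPrime := Ideal.comap_isPrime (dehomAffine W) m
  let x : scheme W := show ProjectiveSpectrum (grading W) from
    { asHomogeneousIdeal := J.homogeneousCore (grading W)
      isPrime := hJp.homogeneousCore
      not_irrelevant_le := not_irrelevant_le W (i := 2) hZ }
  have hx : IsHorizontal x := by
    intro n hn
    by_contra hn0
    have h1 := (hJ 0 _ (intCast_mem_grading W n)).mp hn
    rw [map_intCast] at h1
    refine hm.ne_top (Ideal.eq_top_of_isUnit_mem _ h1 ?_)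
    have := (isUnit_iff_ne_zero.mpr (show (n : ℚ) ≠ 0 by exact_mod_cast hn0)).map
      (algebraMap ℚ (AffineRing W))
    rwa [map_intCast] at this
  have hxb : idealOf W x ≠ ⊥ := by
    obtain ⟨a, ha, ha0⟩ := Submodule.exists_mem_ne_zero_of_ne_bot hI0
    obtain ⟨N, hN, d, G, hG, h⟩ := exists_form W a
    have hGm : G ∈ idealOf W x := (hJ d G hG).mpr (h ▸ m.mul_mem_left _ (hIm ha))
    refine fun h0 ↦ ha0 ?_
    rw [h0, Ideal.mem_bot] at hGm
    rw [hGm, map_zero] at h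
    apply affineToFF_injective
    have h2 := congrArg (affineToFF W) h
    rw [map_mul, map_intCast, map_zero] at h2
    rw [map_zero]
    exact (mul_eq_zero.mp h2).resolve_left (by exact_mod_cast hN)
  obtain ⟨d, G, hG, H, hH, hHx, hfr⟩ :=
    exists_eq_dehom_div (hf x hx (coheight_eq_one_affine hx hZ hxb) hZ)
  refine hHx ((hJ d H hH).mpr (hIm ⟨dehomAffine W G, ?_⟩))
  rw [affineToFF_dehomAffine, affineToFF_dehomAffine, hfr,
    mul_div_cancel₀ _ (dehom_ne_zero W hH hHx)]

/-- The only rational functions that are regular on the generic fibre are the constants. -/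
theorem exists_eq_ratCast {f : FF W}
    (hf : ∀ x : scheme W, IsHorizontal x → Order.coheight x = 1 → f ∈ localRing W x) :
    ∃ c : ℚ, f = c := by
  obtain ⟨a, rfl⟩ := exists_affineToFF_eq fun x hx hc _ ↦ hf x hx hc
  obtain ⟨p, q, h⟩ := exists_polyX_add a
  have hO := atInfinity_pointOf_zero (W := W)
  have hx := isHorizontal_pointOf (W := W) 0
  have := hf _ hx (coheight_eq_one_atInfinity hO hx)
  rw [h] at this ⊢
  exact hO.exists_eq_ratCast hx this

variable {P : (W.baseChange ℚ).toAffine.Point} {α α' : RationalDifferential (scheme W)}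

theorem fibrePt_notMem (p : ℕ) [Fact p.Prime] :
    fibrePt W p ∉ ({pointOf W P, pointOf W (-P)} : Set (scheme W)) := by
  rintro (h | h)
  · exact not_isHorizontal_fibrePt p (h ▸ isHorizontal_pointOf P)
  · exact not_isHorizontal_fibrePt p (h ▸ isHorizontal_pointOf (-P))

theorem IsThirdKind.exists_eq_add [(W.baseChange ℚ).IsElliptic] (hα : IsThirdKind W P α)
    (hα' : IsThirdKind W P α') :
    ∃ n : ℤ, α' = α + ((n : FF W) / 4) • neronDifferential W := by
  obtain ⟨f, hf⟩ := exists_eq_smul_neronDifferential (α' - α)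
  obtain ⟨c, rfl⟩ : ∃ c : ℚ, f = c := exists_eq_ratCast fun x hx hc ↦ by
    have := charZero_of_isHorizontal hx
    rw [← isRegularAt_smul_iff (neronGenerates_of_isHorizontal hx), ← hf]
    exact (hα.residue x hc this).sub_regular (idealOf_ne_bot_of_coheight W hc)
      (hα'.residue x hc this)
  obtain ⟨n, hn⟩ : ∃ n : ℤ, 4 * c = n := exists_intCast_eq (W := W) fun p _ ↦ by
    rw [← isRegularAt_smul_iff (neronGenerates_fibrePt p)]
    have h1 := (hα.regular _ (coheight_fibrePt p)).2 (fibrePt_notMem p)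
    have h2 := (hα'.regular _ (coheight_fibrePt p)).2 (fibrePt_notMem p)
    have h3 := h2.add h1.neg
    rwa [← sub_eq_add_neg, ← smul_sub, hf, ← Nat.cast_smul_eq_nsmul (FF W), smul_smul,
      show ((4 : ℕ) : FF W) * (c : FF W) = ((4 * c : ℚ) : FF W) by push_cast; ring] at h3
  refine ⟨n, ?_⟩
  rw [← sub_eq_iff_eq_add', hf]
  congr 1
  rw [eq_div_iff (by norm_num), mul_comm]
  exact_mod_cast congrArg (Rat.cast : ℚ → FF W) hn

end WeierstrassModel

namespace WeierstrassModel

variable {W : WeierstrassCurve ℤ} {x : scheme W} {P : (W.baseChange ℚ).toAffine.Point}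
  {α : RationalDifferential (scheme W)}

theorem IsThirdKind.add_smul [(W.baseChange ℚ).IsElliptic] (hα : IsThirdKind W P α) (n : ℤ) :
    IsThirdKind W P (α + ((n : FF W) / 4) • neronDifferential W) where
  residue x hc _ := by
    have hx : IsHorizontal x := isHorizontal_of_charZero
    refine (hα.residue x hc ‹_›).add_regular ((neronGenerates_of_isHorizontal hx).2.smul ?_)
    convert ratCast_mem_localRing hx ((n : ℚ) / 4) using 1
    push_cast
    rfl
  regular x hc := by
    have hn : IsRegularAt (scheme W) ((n : FF W) • neronDifferential W) x :=
      (neronGenerates_of_coheight hc).2.smul (intCast_mem _ n)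
    have h4 : 4 • (α + ((n : FF W) / 4) • neronDifferential W) =
        4 • α + (n : FF W) • neronDifferential W := by
      rw [smul_add, ← Nat.cast_smul_eq_nsmul (FF W) 4 (((n : FF W) / 4) • neronDifferential W),
        smul_smul]
      congr 2
      push_cast
      field_simp
    rw [h4]
    refine ⟨fun hS g hg ↦ ?_, fun hS ↦ ((hα.regular x hc).2 hS).add hn⟩
    rw [smul_add]
    exact ((hα.regular x hc).1 hS g hg).add (hn.smul (algebraMap_mem_localRing g))

/-! ### Existence -/

theorem isThirdKind_zero [(W.baseChange ℚ).IsElliptic] (hP : -P = P) : IsThirdKind W P 0 where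
  residue x hc _ := by
    rw [hP, sub_self, Finsupp.zero_apply, Rat.cast_zero]
    exact isRegularAt_zero.hasResidueAt_zero isHorizontal_of_charZero
  regular x hc := by
    rw [smul_zero]
    refine ⟨fun hS g hg ↦ ?_, fun hS ↦ isRegularAt_zero⟩
    rw [smul_zero]
    exact isRegularAt_zero

theorem exists_intCast_eq_of_sq {q : ℚ} {m : ℤ} (h : q ^ 2 = m) : ∃ r : ℤ, q = r := by
  obtain ⟨r, hr⟩ := IsIntegrallyClosed.exists_algebraMap_eq_of_isIntegral_pow (R := ℤ) (K := ℚ)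
    (x := q) (n := 2) (by norm_num) (h ▸ isIntegral_algebraMap)
  exact ⟨r, hr.symm⟩

/-- For `P = (x₀, y₀)` with `x₀ = n / d` in lowest terms, the number `d² (2y₀ + a₁x₀ + a₃)` is an
integer, because its square is the integer `d (4n³ + b₂n²d + 2b₄nd² + b₆d³)`. So its double is an
integral combination of `n` and `d`. -/
theorem exists_combination {x₀ y₀ : ℚ} (hP : (W.baseChange ℚ).toAffine.Nonsingular x₀ y₀) :
    ∃ k l : ℤ, 2 * (2 * y₀ + W.a₁ * x₀ + W.a₃) * (x₀.den : ℚ) ^ 2 = k * x₀.num + l * x₀.den := by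
  have hx₀ : x₀ * x₀.den = x₀.num := Rat.mul_den_eq_num x₀
  obtain ⟨r, hr⟩ := exists_intCast_eq_of_sq (q := (2 * y₀ + W.a₁ * x₀ + W.a₃) * (x₀.den : ℚ) ^ 2)
    (m := x₀.den * (4 * x₀.num ^ 3 + W.b₂ * x₀.num ^ 2 * x₀.den + 2 * W.b₄ * x₀.num * x₀.den ^ 2 +
      W.b₆ * x₀.den ^ 3)) (by
    push_cast [WeierstrassCurve.b₂, WeierstrassCurve.b₄, WeierstrassCurve.b₆]
    rw [← hx₀]
    linear_combination 4 * (x₀.den : ℚ) ^ 4 * affine_equation_rat hP)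
  have hcop : IsCoprime x₀.num (x₀.den : ℤ) := by
    rw [Int.isCoprime_iff_gcd_eq_one]
    exact x₀.reduced
  obtain ⟨u, v, huv⟩ := hcop
  refine ⟨2 * r * u, 2 * r * v, ?_⟩
  have huv' : (u : ℚ) * x₀.num + v * x₀.den = 1 := by exact_mod_cast huv
  push_cast
  linear_combination 2 * hr - 2 * r * huv'

/-- The coefficient `¼ (kx + l) / (dx - n)` of a differential with poles at `P` and `-P`, where `n / d`
is the `x`-coordinate of `P`. -/
noncomputable def poleCoeff (W : WeierstrassCurve ℤ) (x₀ : ℚ) (k l : ℤ) : FF W :=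
  ((k : FF W) * affineCoord W 0 + l) / (4 * ((x₀.den : FF W) * affineCoord W 0 - x₀.num))

theorem dd_ratCast (q : ℚ) : dd W (q : FF W) = 0 := by
  have h : (q : FF W) * ((q.den : ℤ) : FF W) = ((q.num : ℤ) : FF W) := by
    exact_mod_cast Rat.mul_den_eq_num q
  have h1 := congrArg (dd W) h
  rw [Derivation.leibniz, dd_intCast, dd_intCast, smul_zero, zero_add] at h1
  exact (smul_eq_zero.mp h1).resolve_left (by exact_mod_cast q.den_ne_zero)

theorem x_sub_ne_zero (x₀ : ℚ) : affineCoord W 0 - (x₀ : FF W) ≠ 0 := by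
  intro h
  have h1 : polyX W (Polynomial.X - Polynomial.C x₀) = 0 := by simpa using h
  exact Polynomial.X_sub_C_ne_zero x₀ (polyX_eq_zero h1)

variable {x₀ y₀ : ℚ} {k l : ℤ}

theorem poleCoeff_eq
    (hkl : 2 * (2 * y₀ + W.a₁ * x₀ + W.a₃) * (x₀.den : ℚ) ^ 2 = k * x₀.num + l * x₀.den) :
    poleCoeff W x₀ k l =
    ((2 * y₀ + W.a₁ * x₀ + W.a₃ : ℚ) : FF W) / (2 * (affineCoord W 0 - (x₀ : FF W))) +
      ((k / (4 * x₀.den) : ℚ) : FF W) := by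
  have hd : (x₀.den : FF W) ≠ 0 := by exact_mod_cast x₀.den_ne_zero
  have hx₀ : (x₀ : FF W) * x₀.den = x₀.num := by exact_mod_cast Rat.mul_den_eq_num x₀
  have h := congrArg (Rat.cast : ℚ → FF W) hkl
  have ht := x_sub_ne_zero (W := W) x₀
  rw [poleCoeff, show (x₀.den : FF W) * affineCoord W 0 - x₀.num =
    x₀.den * (affineCoord W 0 - (x₀ : FF W)) by linear_combination hx₀]
  push_cast at h ⊢
  have h' : 2 * (2 * (y₀ : FF W) + W.a₁ * x₀ + W.a₃) * x₀.den = k * x₀ + l := by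
    apply mul_right_cancel₀ hd
    linear_combination h - k * hx₀
  field_simp
  linear_combination -2 * h'

theorem poleCoeff_mem_localRing
    (hkl : 2 * (2 * y₀ + W.a₁ * x₀ + W.a₃) * (x₀.den : ℚ) ^ 2 = k * x₀.num + l * x₀.den)
    (hx : IsHorizontal x)
    (h : (affineCoord W 0 - (x₀ : FF W))⁻¹ ∈ localRing W x) :
    poleCoeff W x₀ k l ∈ localRing W x := by
  rw [poleCoeff_eq hkl]
  refine add_mem ?_ (ratCast_mem_localRing hx _)
  convert mul_mem (ratCast_mem_localRing hx ((2 * y₀ + W.a₁ * x₀ + W.a₃) / 2)) h using 1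
  push_cast
  field_simp

theorem hasResidueAt_poleCoeff [(W.baseChange ℚ).IsElliptic]
    (hkl : 2 * (2 * y₀ + W.a₁ * x₀ + W.a₃) * (x₀.den : ℚ) ^ 2 = k * x₀.num + l * x₀.den)
    (hx : IsHorizontal x)
    (ht : IsUniformizer x (affineCoord W 0 - (x₀ : FF W))) {s : ℚ}
    (h : ((2 * y₀ + W.a₁ * x₀ + W.a₃ : ℚ) : FF W) - ((2 * s : ℚ) : FF W) * derivY W ∈ maxSet W x) :
    HasResidueAt (scheme W) (poleCoeff W x₀ k l • neronDifferential W) x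
      (s : IsLocalRing.ResidueField ((scheme W).presheaf.stalk x)) := by
  have ht0 := x_sub_ne_zero (W := W) x₀
  obtain ⟨r, hr, hrt⟩ := ht.2 _ h
  have hdt : dd W (affineCoord W 0 - (x₀ : FF W)) = derivY W • neronDifferential W := by
    rw [map_sub, dd_x, dd_ratCast, sub_zero]
  refine hasResidueAt_of_eq hx ht s
    (β := (((1 / 2 : ℚ) : FF W) * r + ((k / (4 * x₀.den) : ℚ) : FF W)) • neronDifferential W)
    ((neronGenerates_of_isHorizontal hx).2.smul (add_mem
      (mul_mem (ratCast_mem_localRing hx _) hr) (ratCast_mem_localRing hx _))) ?_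
  rw [hdt, smul_smul, ← add_smul, poleCoeff_eq hkl]
  congr 1
  rw [eq_div_of_mul_eq ht0 hrt.symm]
  push_cast
  field_simp
  ring

theorem hasAtMostSimplePoleAt_poleCoeff [(W.baseChange ℚ).IsElliptic]
    (hkl : 2 * (2 * y₀ + W.a₁ * x₀ + W.a₃) * (x₀.den : ℚ) ^ 2 = k * x₀.num + l * x₀.den)
    (hx : IsHorizontal x)
    (ht : IsUniformizer x (affineCoord W 0 - (x₀ : FF W))) :
    HasAtMostSimplePoleAt (scheme W) (4 • poleCoeff W x₀ k l • neronDifferential W) x := by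
  intro g hg
  have ht0 := x_sub_ne_zero (W := W) x₀
  obtain ⟨r, hr, hrt⟩ := ht.2 _ (algebraMap_mem_maxSet.mpr hg)
  rw [hrt, ← Nat.cast_smul_eq_nsmul (FF W), smul_smul, smul_smul]
  refine (neronGenerates_of_isHorizontal hx).2.smul ?_
  have h1 : r * (affineCoord W 0 - (x₀ : FF W)) * ((4 : ℕ) : FF W) * poleCoeff W x₀ k l =
      r * (((2 * (2 * y₀ + W.a₁ * x₀ + W.a₃) : ℚ) : FF W) +
        ((k / x₀.den : ℚ) : FF W) * (affineCoord W 0 - (x₀ : FF W))) := by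
    have hd : (x₀.den : FF W) ≠ 0 := by exact_mod_cast x₀.den_ne_zero
    rw [poleCoeff_eq hkl]
    push_cast
    field_simp
    ring
  rw [h1]
  exact mul_mem hr (add_mem (ratCast_mem_localRing hx _) (mul_mem (ratCast_mem_localRing hx _)
    (mem_localRing_of_mem_maxSet ht.1)))

theorem four_mul_poleCoeff_mem_fibrePt (p : ℕ) [hp : Fact p.Prime] :
    ((4 : ℕ) : FF W) * poleCoeff W x₀ k l ∈ localRing W (fibrePt W p) := by
  have hG := isHomogeneous_linear k l 0 2
  have hH := isHomogeneous_linear x₀.den (-x₀.num) 0 2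
  have hHx : toCoordRing W (MvPolynomial.C (x₀.den : ℤ) * MvPolynomial.X 0 +
      MvPolynomial.C (-x₀.num) * MvPolynomial.X 2) ∉ idealOf W (fibrePt W p) := by
    intro h
    have h1 := map_eq_zero_of_mem_fibrePt p hH (by norm_num) h
    have h2 := congrArg (MvPolynomial.eval ![1, 0, 0]) h1
    have h3 := congrArg (MvPolynomial.eval ![0, 0, 1]) h1
    simp at h2 h3
    rw [ZMod.natCast_eq_zero_iff] at h2
    rw [ZMod.intCast_zmod_eq_zero_iff_dvd] at h3
    exact hp.out.one_lt.ne' (Nat.dvd_one.mp (x₀.reduced ▸ Nat.dvd_gcd (Int.natCast_dvd.mp h3) h2))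
  convert dehom_div_mem_localRing (mem_grading W hG) (mem_grading W hH) hHx using 1
  have h0 := dehom_ne_zero W (mem_grading W hH) hHx
  rw [dehom_toCoordRing] at h0 ⊢
  rw [dehom_toCoordRing]
  simp only [map_add, map_mul, MvPolynomial.aeval_X, MvPolynomial.aeval_C, affineCoord_two] at h0 ⊢
  simp only [algebraMap_int_eq, Int.coe_castRingHom, Int.cast_neg, Int.cast_natCast, mul_one,
    ← sub_eq_add_neg] at h0 ⊢
  rw [poleCoeff]
  push_cast
  field_simp

theorem isThirdKind_poleCoeff [(W.baseChange ℚ).IsElliptic]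
    (hkl : 2 * (2 * y₀ + W.a₁ * x₀ + W.a₃) * (x₀.den : ℚ) ^ 2 = k * x₀.num + l * x₀.den)
    (hP : (W.baseChange ℚ).toAffine.Nonsingular x₀ y₀) (hη : 2 * y₀ + W.a₁ * x₀ + W.a₃ ≠ 0) :
    IsThirdKind W (.some x₀ y₀ hP) (poleCoeff W x₀ k l • neronDifferential W) := by
  let P : (W.baseChange ℚ).toAffine.Point := .some x₀ y₀ hP
  have hP' := (WeierstrassCurve.Affine.nonsingular_neg x₀ y₀).mpr hP
  have hη0 (x : scheme W) (hx : IsHorizontal x) :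
      ((2 * y₀ + W.a₁ * x₀ + W.a₃ : ℚ) : FF W) ∉ maxSet W x :=
    (ratCast_mem_maxSet_iff hx _).not.mpr hη
  have hxP := isHorizontal_pointOf (W := W) P
  have hxN := isHorizontal_pointOf (W := W) (-P)
  -- The function `2y + a₁x + a₃` takes opposite values at `P` and `-P`.
  have hdP : derivY W - ((2 * y₀ + W.a₁ * x₀ + W.a₃ : ℚ) : FF W) ∈ maxSet W (pointOf W P) :=
    derivY_sub_mem_maxSet hP
  have hdN : derivY W + ((2 * y₀ + W.a₁ * x₀ + W.a₃ : ℚ) : FF W) ∈ maxSet W (pointOf W (-P)) := by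
    have h : derivY W - ((2 * (W.baseChange ℚ).toAffine.negY x₀ y₀ + W.a₁ * x₀ + W.a₃ : ℚ) : FF W) ∈
        maxSet W (pointOf W (-P)) := derivY_sub_mem_maxSet hP'
    convert h using 1
    rw [negY_eq]
    push_cast
    ring
  have hZP : toCoordRing W (MvPolynomial.X 2) ∉ idealOf W (pointOf W P) := Z_notMem_pointOf_some hP
  have hZN : toCoordRing W (MvPolynomial.X 2) ∉ idealOf W (pointOf W (-P)) :=
    Z_notMem_pointOf_some hP'
  have htP := isUniformizer_x_sub hxP hZP
    (fun h ↦ hη0 _ hxP (by simpa using sub_mem_maxSet h hdP)) (x_sub_mem_maxSet hP)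
  have htN := isUniformizer_x_sub hxN hZN
    (fun h ↦ hη0 _ hxN (by simpa using sub_mem_maxSet hdN h)) (x_sub_mem_maxSet hP')
  have hne : pointOf W P ≠ pointOf W (-P) := by
    intro h
    rw [← h] at hdN
    have h1 := sub_mem_maxSet hdN hdP
    rw [add_sub_sub_cancel, ← two_mul] at h1
    exact hη0 _ hxP (two_inv_mul_mem hxP h1)
  have hreg (x : scheme W) (hx : IsHorizontal x) (h1 : x ≠ pointOf W P) (h2 : x ≠ pointOf W (-P)) :
      poleCoeff W x₀ k l ∈ localRing W x := by
    refine poleCoeff_mem_localRing hkl hx ?_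
    have hr := ratCast_mem_localRing hx x₀
    rcases notMem_or_atInfinity x with hZ | hi
    · exact inv_mem_localRing (sub_mem (x_mem_localRing hZ 0) hr) fun h ↦
        (eq_pointOf_or_eq_pointOf_neg hP hx hZ h).elim h1 h2
    · have h3 := hi.inv_x_mem
      have h4 : 1 - (x₀ : FF W) * (affineCoord W 0)⁻¹ ∉ maxSet W x := fun h ↦
        one_notMem_maxSet (x := x) (by simpa using add_mem_maxSet h (mul_mem_maxSet hr h3))
      have h5 := mem_localRing_of_mem_maxSet h3
      have h6 : (affineCoord W 0 - (x₀ : FF W))⁻¹ =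
          (affineCoord W 0)⁻¹ * (1 - (x₀ : FF W) * (affineCoord W 0)⁻¹)⁻¹ := by
        have h0 := hi.x_ne_zero
        rw [← mul_inv]
        congr 1
        field_simp
      rw [h6]
      exact mul_mem h5 (inv_mem_localRing (sub_mem (one_mem _) (mul_mem hr h5)) h4)
  constructor
  · intro x hc _
    have hx : IsHorizontal x := isHorizontal_of_charZero
    by_cases h1 : x = pointOf W P
    · subst h1
      rw [Finsupp.sub_apply, Finsupp.single_eq_same, Finsupp.single_eq_of_ne hne, sub_zero]
      refine hasResidueAt_poleCoeff hkl hx htP ?_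
      rw [show ((2 * (1 / 2) : ℚ) : FF W) = 1 by norm_num, one_mul, ← neg_sub]
      exact neg_mem_maxSet hdP
    by_cases h2 : x = pointOf W (-P)
    · subst h2
      rw [Finsupp.sub_apply, Finsupp.single_eq_same, Finsupp.single_eq_of_ne hne.symm, zero_sub]
      refine hasResidueAt_poleCoeff hkl hx htN ?_
      rw [show ((2 * -(1 / 2) : ℚ) : FF W) = -1 by norm_num, neg_one_mul, sub_neg_eq_add, add_comm]
      exact hdN
    · rw [Finsupp.sub_apply, Finsupp.single_eq_of_ne h1, Finsupp.single_eq_of_ne h2, sub_zero,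
        Rat.cast_zero]
      exact ((neronGenerates_of_isHorizontal hx).2.smul (hreg x hx h1 h2)).hasResidueAt_zero hx
  · intro x hc
    constructor
    · rintro (rfl | rfl)
      · exact hasAtMostSimplePoleAt_poleCoeff hkl hxP htP
      · exact hasAtMostSimplePoleAt_poleCoeff hkl hxN htN
    · intro hS
      have h4 : 4 • poleCoeff W x₀ k l • neronDifferential W =
          (((4 : ℕ) : FF W) * poleCoeff W x₀ k l) • neronDifferential W := by
        rw [← Nat.cast_smul_eq_nsmul (FF W), smul_smul]
      rw [h4]
      refine (neronGenerates_of_coheight hc).2.smul ?_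
      by_cases hx : IsHorizontal x
      · rw [Set.mem_insert_iff, Set.mem_singleton_iff, not_or] at hS
        exact mul_mem (natCast_mem _ 4) (hreg x hx hS.1 hS.2)
      · obtain ⟨p, hp, rfl⟩ := exists_eq_fibrePt hc hx
        exact four_mul_poleCoeff_mem_fibrePt p

theorem exists_isThirdKind [(W.baseChange ℚ).IsElliptic]
    (P : (W.baseChange ℚ).toAffine.Point) : ∃ α, IsThirdKind W P α := by
  rcases P with _ | ⟨x₀, y₀, hP⟩
  · exact ⟨0, isThirdKind_zero neg_zero⟩
  by_cases hη : 2 * y₀ + W.a₁ * x₀ + W.a₃ = 0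
  · refine ⟨0, isThirdKind_zero ?_⟩
    rw [WeierstrassCurve.Affine.Point.neg_some]
    congr 1
    rw [negY_eq]
    linear_combination -hη
  · obtain ⟨k, l, hkl⟩ := exists_combination hP
    exact ⟨_, isThirdKind_poleCoeff hkl hP hη⟩

end WeierstrassModel

theorem lemma4p3 (W : WeierstrassCurve ℤ) [(W.baseChange ℚ).IsElliptic]
    (hW : WeierstrassModel.IsMinimalModel W) (P : (W.baseChange ℚ).toAffine.Point) :
    (∃ α : WeierstrassModel.RationalDifferential (WeierstrassModel.scheme W),
      WeierstrassModel.IsThirdKind W P α) ∧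
    ∀ α α' : WeierstrassModel.RationalDifferential (WeierstrassModel.scheme W),
      WeierstrassModel.IsThirdKind W P α →
        (WeierstrassModel.IsThirdKind W P α' ↔
          ∃ n : ℤ, α' = α + ((n : (WeierstrassModel.scheme W).functionField) / 4) •
            WeierstrassModel.neronDifferential W) := by
  refine ⟨WeierstrassModel.exists_isThirdKind P, fun α α' hα ↦ ⟨hα.exists_eq_add, ?_⟩⟩
  rintro ⟨n, rfl⟩
  exact hα.add_smul n
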